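/- A planar tree is a locally finite rooted ordered tree whose root has exactly one neighbour. Let $\mathcal T_{\rm fin}$ and $\mathcal T_\infty$ be the sets of finite and infinite planar trees (up to order-preserving isomorphism) and $\mathcal T=\mathcal T_{\rm fin}\cup\mathcal T_\infty$. For $T\in\mathcal T$ let $|T|$ be its number of edges, $h(T)$ its height, and $B_r(T)$ the subtree spanned by the vertices at distance at most $r$ from the root. Equip $\mathcal T$ with the metric $\mathrm{dist}(T,T')=\inf\{1/r: r\ge 1,\ B_r(T)=B_r(T')\}$ and its Borel $\sigma$-algebra. For $\mu>0$ let $\nu^{(\mu)}_N$ be the probability measure on $\{T: |T|=N\}$ with $\nu_N^{(\mu)}(T)$ proportional to $e^{-\mu h(T)}$, and let $\nu^{(\mu)}$ be its weak limit as $N\to\infty$ (which exists). Let $\rho$ be the law of the Bienaymé–Galton–Watson tree with offspring probabilities $2^{-(n+1)}$, i.e. $\rho(T)=2\cdot 4^{-|T|}$ for $T\in\mathcal T_{\rm fin}$. For $n\ge1$ let $\omega$ be the normalised Lebesgue measure on the simplex $\mu\Delta_n=\{(\mu_1,\dots,\mu_n): \mu_i>0,\ \mu_1+\dots+\mu_n=\mu\}$,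 and let $\int_{\mu\Delta_n}d\omega\prod_{i=1}^n\nu^{(\mu_i)}$ denote the corresponding mixture of product measures on $\mathcal T^n$. For $T\in\mathcal T_\infty$ the spine $\chi(T)\in\mathcal T_\infty$ is the subtree spanned by the vertices having infinitely many descendants. Let $\mathcal T^s=\chi(\mathcal T_\infty)$, let $\tilde\nu^{(\mu)}$ be the pushforward of $\nu^{(\mu)}$ under $\chi$, and write $\mathcal B^s_a(T_0)=\{S\in\mathcal T^s:\mathrm{dist}(S,T_0)\le a\}$ for $T_0\in\mathcal T$. **Theorem.** Let $\mu>0$ and let $T^s_0$ be a finite tree of height $r$ with $R$ leaves (not counting the root), all at height $r$. Then: i) $\tilde\nu^{(\mu)}\big(\mathcal B^s_{1/r}(T^s_0)\big)=e^{-(r-1)\mu}\,\dfrac{\mu^{R-1}}{(R-1)!}$. ii) Let $E=\chi^{-1}(\mathcal B^s_{1/r}(T^s_0))$, the set of infinite trees whose spine coincides with $T_0^s$ up to height $r$. Let $\Sigma$ be the set of sectors $(i,n)$ around the vertices $i$ of $T_0^s$ that are neither the root nor leaves (such a vertex with $k$ offspring has the $k+1$ sectors between consecutive edges at $i$). Enumerate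 the leaves of $T^s_0$ as $v_1,\dots,v_R$, in any order. Grafting infinite trees onto the leaves and finite trees in the sectors of $\Sigma$ defines a homeomorphism of $\mathcal T_\infty^R\times\mathcal T_{\rm fin}^{\Sigma}$ onto $E$, and under this identification $$\nu^{(\mu)}(\,\cdot\mid E)=\Big(\int_{\mu\Delta_R}d\omega\prod_{j=1}^R\nu^{(\mu_j)}\Big)\times\prod_{(i,n)\in\Sigma}\rho .$$ Equivalently, conditionally on $E$ the finite branches $T_{(i,n)}$, $(i,n)\in\Sigma$, are i.i.d. with law $\rho$ and are independent of the family of the $R$ infinite branches, whose joint law is $\int_{\mu\Delta_R}d\omega\prod_{j=1}^R\nu^{(\mu_j)}$. -/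

import Mathlib

open MeasureTheory ProbabilityTheory Filter Topology

/-- A planar rooted locally finite tree, whose root `i₀` has exactly one neighbour `i₁`, in
Ulam-Harris coding. The vertices other than the root `i₀` are coded by finite words: `[]` is the
vertex `i₁`, and the offspring of the vertex `w`, from left to right, are
`w ++ [0], …, w ++ [k - 1]`. The root `i₀` and the root edge are implicit. A vertex `w` is at height
(distance from the root) `w.length + 1`, and the edges correspond to the words, each
vertex other than the root being joined to its parent. Each isomorphism class of ordered trees
has exactly one such coding. -/
@[ext]
structure PlaneTree where
  nodes : Set (List ℕ)
  root_mem : [] ∈ nodes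
  offspring : ∀ w, ∃ k, ∀ j, w ++ [j] ∈ nodes ↔ w ∈ nodes ∧ j < k

namespace PlaneTree

/-- The number of offspring of the vertex `w`; the degree of `w` is `T.numKids w + 1`. -/
noncomputable def numKids (T : PlaneTree) (w : List ℕ) : ℕ := {j | w ++ [j] ∈ T.nodes}.ncard

/-- The size `|T|`, i.e. the number of edges. -/
noncomputable def size (T : PlaneTree) : ℕ∞ := T.nodes.encard

/-- The height `h(T)`, the maximal height of a vertex (`⊤` for infinite trees). -/
noncomputable def height (T : PlaneTree) : ℕ∞ := ⨆ w ∈ T.nodes, ((w.length + 1 : ℕ) : ℕ∞)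

theorem mem_of_append (T : PlaneTree) {w v : List ℕ} (h : w ++ v ∈ T.nodes) : w ∈ T.nodes := by
  induction v using List.reverseRecOn with
  | nil => simpa using h
  | append_singleton v j ih =>
    obtain ⟨k, hk⟩ := T.offspring (w ++ v)
    exact ih ((hk j).1 (by simpa using h)).1

theorem mem_append_singleton_iff (T : PlaneTree) (w : List ℕ) (j : ℕ) :
    w ++ [j] ∈ T.nodes ↔ w ∈ T.nodes ∧ j < T.numKids w := by
  obtain ⟨k, hk⟩ := T.offspring w
  by_cases hw : w ∈ T.nodes
  · have h1 : {j | w ++ [j] ∈ T.nodes} = Set.Iio k := by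
      ext i
      exact (hk i).trans (and_iff_right hw)
    have h2 : T.numKids w = k := by
      rw [numKids, h1, ← Finset.coe_Iio, Set.ncard_coe_finset, Nat.card_Iio]
    rw [hk, h2]
  · simp [hk, hw]

/-- The ball `B_r(T)` of radius `r ≥ 1` around the root: the subtree spanned by the vertices at
height at most `r`. -/
def ball (r : ℕ) (T : PlaneTree) : PlaneTree where
  nodes := {w | w ∈ T.nodes ∧ (w = [] ∨ w.length + 1 ≤ r)}
  root_mem := ⟨T.root_mem, Or.inl rfl⟩
  offspring w := by
    obtain ⟨k, hk⟩ := T.offspring w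
    by_cases h : w.length + 1 + 1 ≤ r
    · refine ⟨k, fun j => ?_⟩
      change (w ++ [j] ∈ T.nodes ∧ (w ++ [j] = [] ∨ (w ++ [j]).length + 1 ≤ r)) ↔
        (w ∈ T.nodes ∧ (w = [] ∨ w.length + 1 ≤ r)) ∧ j < k
      have h1 : w.length + 1 ≤ r := by omega
      have h2 : (w ++ [j]).length + 1 ≤ r := by simpa using h
      have h3 := hk j
      tauto
    · refine ⟨0, fun j => ?_⟩
      change (w ++ [j] ∈ T.nodes ∧ (w ++ [j] = [] ∨ (w ++ [j]).length + 1 ≤ r)) ↔ _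
      have h1 : ¬ (w ++ [j]).length + 1 ≤ r := by simpa using h
      have h2 : w ++ [j] ≠ [] := by simp
      have h3 : ¬ j < 0 := by omega
      tauto

theorem ball_congr_of_le {T T' : PlaneTree} {r s : ℕ} (hrs : r ≤ s) (h : ball s T = ball s T') :
    ball r T = ball r T' := by
  have h1 : ∀ w, w ∈ (ball s T).nodes ↔ w ∈ (ball s T').nodes := fun w => by rw [h]
  ext w
  have h2 := h1 w
  simp only [ball, Set.mem_ofPred_eq] at h2 ⊢
  constructor
  · rintro ⟨h3, h4⟩
    exact ⟨(h2.1 ⟨h3, h4.imp_right fun h => by omega⟩).1, h4⟩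
  · rintro ⟨h3, h4⟩
    exact ⟨(h2.2 ⟨h3, h4.imp_right fun h => by omega⟩).1, h4⟩

/-- The numbers `1 / r`, `r ≥ 1`, for which `T` and `T'` have the same ball of radius `r`. -/
def agreeSet (T T' : PlaneTree) : Set ℝ :=
  {a | ∃ r : ℕ, 1 ≤ r ∧ ball r T = ball r T' ∧ a = 1 / (r : ℝ)}

theorem agreeSet_nonneg {T T' : PlaneTree} {a : ℝ} (h : a ∈ agreeSet T T') : 0 ≤ a := by
  obtain ⟨r, -, -, rfl⟩ := h
  positivity

theorem agreeSet_nonempty (T T' : PlaneTree) : (agreeSet T T').Nonempty := by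
  refine ⟨1, 1, le_rfl, ?_, by simp⟩
  ext w
  simp only [ball, Set.mem_ofPred_eq]
  constructor <;> rintro ⟨-, h⟩ <;>
  · have : w = [] := h.elim id fun h => List.eq_nil_of_length_eq_zero (by omega)
    subst this
    exact ⟨root_mem _, Or.inl rfl⟩

/-- The metric `dist(T, T') = inf {1 / r | r ≥ 1, B_r(T) = B_r(T')}`. -/
noncomputable instance : MetricSpace PlaneTree where
  dist T T' := sInf (agreeSet T T')
  dist_self T := by
    apply le_antisymm
    · refine le_of_forall_pos_le_add fun ε hε => ?_
      obtain ⟨n, hn⟩ := exists_nat_one_div_lt hε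
      have : sInf (agreeSet T T) ≤ 1 / ((n + 1 : ℕ) : ℝ) :=
        csInf_le ⟨0, fun a => agreeSet_nonneg⟩ ⟨n + 1, by omega, rfl, rfl⟩
      push_cast at this
      linarith
    · exact Real.sInf_nonneg fun a => agreeSet_nonneg
  dist_comm T T' := by simp only [agreeSet, eq_comm]
  dist_triangle T₁ T₂ T₃ := by
    have key : ∀ a ∈ agreeSet T₁ T₂, ∀ b ∈ agreeSet T₂ T₃, sInf (agreeSet T₁ T₃) ≤ a + b := by
      rintro _ ⟨r, hr, h12, rfl⟩ _ ⟨s, hs, h23, rfl⟩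
      have h13 : ball (min r s) T₁ = ball (min r s) T₃ :=
        (ball_congr_of_le (min_le_left _ _) h12).trans (ball_congr_of_le (min_le_right _ _) h23)
      refine (csInf_le ⟨0, fun a => agreeSet_nonneg⟩ ⟨min r s, by omega, h13, rfl⟩).trans ?_
      have hr0 : (0 : ℝ) ≤ 1 / (r : ℝ) := by positivity
      have hs0 : (0 : ℝ) ≤ 1 / (s : ℝ) := by positivity
      rcases le_total r s with h | h
      · rw [min_eq_left h]; linarith
      · rw [min_eq_right h]; linarith
    have h1 : ∀ a ∈ agreeSet T₁ T₂, sInf (agreeSet T₁ T₃) - a ≤ sInf (agreeSet T₂ T₃) :=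
      fun a ha => le_csInf (agreeSet_nonempty _ _) fun b hb => by linarith [key a ha b hb]
    have h2 : sInf (agreeSet T₁ T₃) - sInf (agreeSet T₂ T₃) ≤ sInf (agreeSet T₁ T₂) :=
      le_csInf (agreeSet_nonempty _ _) fun a ha => by linarith [h1 a ha]
    linarith
  eq_of_dist_eq_zero {T T'} h := by
    have key : ∀ r : ℕ, ball r T = ball r T' := by
      intro r
      have hlt : sInf (agreeSet T T') < 1 / ((r : ℝ) + 1) := by
        change sInf (agreeSet T T') = 0 at h
        rw [h]; positivity
      obtain ⟨_, ⟨s, hs, hs', rfl⟩, hlt⟩ := exists_lt_of_csInf_lt (agreeSet_nonempty _ _) hlt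
      refine ball_congr_of_le ?_ hs'
      have hs0 : (0 : ℝ) < s := by exact_mod_cast hs
      rw [one_div_lt_one_div hs0 (by positivity)] at hlt
      have : r + 1 < s := by exact_mod_cast hlt
      omega
    ext w
    have h1 : w ∈ (ball (w.length + 1) T).nodes ↔ w ∈ (ball (w.length + 1) T').nodes := by
      rw [key]
    have h2 : w.length + 1 ≤ w.length + 1 := le_rfl
    simp only [ball, Set.mem_ofPred_eq] at h1
    tauto

noncomputable instance : MeasurableSpace PlaneTree := borel PlaneTree

instance : BorelSpace PlaneTree := ⟨rfl⟩

/-- The tree in which `i₁` has `n` offspring, all of them leaves; for `n = 0` it consists of the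
root edge only. -/
def star (n : ℕ) : PlaneTree where
  nodes := insert [] ((fun j => [j]) '' Set.Iio n)
  root_mem := Set.mem_insert _ _
  offspring w := by
    rcases w with _ | ⟨i, w⟩
    · exact ⟨n, fun j => by simp⟩
    · exact ⟨0, fun j => by simp⟩

theorem size_star (n : ℕ) : (star n).size = (n + 1 : ℕ) := by
  have hinj : Function.Injective (fun j : ℕ => [j]) := fun a b h => by simpa using h
  rw [size, star, Set.encard_insert_of_notMem (by simp), hinj.encard_image]
  have : (Set.Iio n).encard = n := by
    rw [← Finset.coe_Iio, Set.encard_coe_eq_coe_finsetCard]; simp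
  simp [this]

/-- The set `T_N` of trees of size `N`. -/
abbrev OfSize (N : ℕ) : Type := {T : PlaneTree // T.size = (N : ℕ∞)}

theorem finite_of_size {N : ℕ} {T : PlaneTree} (h : T.size = (N : ℕ∞)) : T.nodes.Finite :=
  Set.finite_of_encard_eq_coe h

theorem bounds_of_size {N : ℕ} {T : PlaneTree} (h : T.size = (N : ℕ∞)) {w : List ℕ}
    (hw : w ∈ T.nodes) : w.length ≤ N ∧ ∀ j ∈ w, j < N := by
  have card_le : ∀ (m : ℕ) (f : ℕ → List ℕ), Set.InjOn f (Set.Iio m) →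
      (∀ i < m, f i ∈ T.nodes) → m ≤ N := by
    intro m f hf hm
    have h1 : (f '' Set.Iio m).encard ≤ T.nodes.encard := by
      apply Set.encard_le_encard
      rintro _ ⟨i, hi, rfl⟩
      exact hm i hi
    have h2 : (Set.Iio m).encard = m := by
      rw [← Finset.coe_Iio, Set.encard_coe_eq_coe_finsetCard]; simp
    rw [hf.encard_image, h2, show T.nodes.encard = N from h] at h1
    exact_mod_cast h1
  constructor
  · refine card_le _ (fun i => w.take i) ?_ ?_
    · intro i hi j hj hij
      have := congrArg List.length hij
      simp only [List.length_take, Set.mem_Iio] at this hi hj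
      omega
    · intro i _
      exact T.mem_of_append (v := w.drop i) (by simpa using hw)
  · intro j hj
    obtain ⟨u, v, rfl⟩ := List.append_of_mem hj
    have hmem : u ++ [j] ∈ T.nodes := T.mem_of_append (v := v) (by simpa using hw)
    rw [mem_append_singleton_iff] at hmem
    refine card_le (j + 1) (fun i => u ++ [i]) (fun a _ b _ hab => by simpa using hab) ?_
    intro i hi
    rw [mem_append_singleton_iff]
    exact ⟨hmem.1, by omega⟩

theorem finite_ofSize (N : ℕ) : Finite (OfSize N) := by
  have hfin : {w : List ℕ | w.length ≤ N ∧ ∀ j ∈ w, j < N}.Finite := by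
    refine ((List.finite_length_le (Fin N) N).image (List.map Fin.val)).subset ?_
    rintro w ⟨h1, h2⟩
    refine ⟨w.pmap (fun j hj => ⟨j, hj⟩) h2, by simpa using h1, ?_⟩
    simp [List.map_pmap]
  have hsub := hfin.finite_subsets
  refine (Set.Finite.of_finite_image (f := PlaneTree.nodes) (hsub.subset ?_) ?_).to_subtype
  · rintro _ ⟨T, hT, rfl⟩ w hw
    exact bounds_of_size hT hw
  · intro T _ T' _ h
    exact PlaneTree.ext h

noncomputable instance (N : ℕ) : Fintype (OfSize N) := @Fintype.ofFinite _ (finite_ofSize N)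

/-- The weight `e^{-μ h(T)}` of a finite tree. -/
noncomputable def weight (μ : ℝ) (T : PlaneTree) : ℝ := Real.exp (-μ * (T.height.toNat : ℝ))

/-- The partition function `Z_N^{(μ)}`. -/
noncomputable def partitionFunction (μ : ℝ) (N : ℕ) : ℝ := ∑ T : OfSize N, weight μ T.1

theorem partitionFunction_pos (μ : ℝ) (N : ℕ) : 0 < partitionFunction μ (N + 1) :=
  Finset.sum_pos (fun _ _ => Real.exp_pos _) ⟨⟨star N, size_star N⟩, Finset.mem_univ _⟩

/-- The measure `ν_N^{(μ)}`, giving mass `e^{-μ h(T)} / Z_N^{(μ)}` to each tree `T` of size `N`. -/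
noncomputable def finiteSizeMeasure (μ : ℝ) (N : ℕ) : Measure PlaneTree :=
  ∑ T : OfSize N, ENNReal.ofReal (weight μ T.1 / partitionFunction μ N) • Measure.dirac T.1

theorem isProbabilityMeasure_finiteSizeMeasure (μ : ℝ) (N : ℕ) :
    IsProbabilityMeasure (finiteSizeMeasure μ (N + 1)) := by
  constructor
  have h : ∀ T ∈ (Finset.univ : Finset (OfSize (N + 1))),
      0 ≤ weight μ T.1 / partitionFunction μ (N + 1) :=
    fun T _ => div_nonneg (Real.exp_pos _).le (partitionFunction_pos μ N).le
  simp only [finiteSizeMeasure, Measure.coe_finsetSum, Finset.sum_apply, Measure.smul_apply,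
    measure_univ, smul_eq_mul, mul_one]
  rw [← ENNReal.ofReal_sum_of_nonneg h, ← Finset.sum_div]
  change ENNReal.ofReal (partitionFunction μ (N + 1) / partitionFunction μ (N + 1)) = 1
  rw [div_self (partitionFunction_pos μ N).ne', ENNReal.ofReal_one]

/-- The sequence of probability measures `ν_1^{(μ)}, ν_2^{(μ)}, …`, numbered from `0`. -/
noncomputable def nuSeq (μ : ℝ) (n : ℕ) : ProbabilityMeasure PlaneTree :=
  ⟨finiteSizeMeasure μ (n + 1), isProbabilityMeasure_finiteSizeMeasure μ n⟩

instance : Nonempty (ProbabilityMeasure PlaneTree) := ⟨nuSeq 0 0⟩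

/-- The local limit `ν^{(μ)}`: the weak limit of `ν_N^{(μ)}` as `N → ∞`. -/
noncomputable def nu (μ : ℝ) : ProbabilityMeasure PlaneTree := limUnder atTop (nuSeq μ)

end PlaneTree

open PlaneTree

/-- The space of finite trees. -/
abbrev FinTree : Type := {T : PlaneTree // T.nodes.Finite}

/-- The space of infinite trees. -/
abbrev InfTree : Type := {T : PlaneTree // T.nodes.Infinite}

/-- The law `ρ` of the critical Bienaymé-Galton-Watson tree with offspring probabilities
`p(n) = 2^{-(n + 1)}`, which is carried by the finite trees. -/
noncomputable def bgwMeasure : Measure PlaneTree :=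
  Measure.sum fun T : FinTree =>
    (∏ w ∈ T.2.toFinset, (2 : ENNReal)⁻¹ ^ (T.1.numKids w + 1)) • Measure.dirac T.1

/-! ### The spine -/

namespace Spine

/-- The descendants (including `w` itself) of the vertex `w`, as words relative to `w`. -/
def desc (S : Set (List ℕ)) (w : List ℕ) : Set (List ℕ) := {v | w ++ v ∈ S}

/-- The vertices of infinite type. -/
def infType (S : Set (List ℕ)) : Set (List ℕ) := {w | (desc S w).Infinite}

/-- The order preserving relabelling of the vertices of infinite type: an offspring of infinite
type is given the number of its siblings of infinite type that are to the left of it. -/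
noncomputable def relabel : Set (List ℕ) → List ℕ → List ℕ
  | _, [] => []
  | S, j :: w => {i | i < j ∧ [i] ∈ infType S}.ncard :: relabel (desc S [j]) w

/-- The vertices of the spine in Ulam-Harris coding. -/
def spineNodes (S : Set (List ℕ)) : Set (List ℕ) := relabel S '' infType S

theorem length_relabel (S : Set (List ℕ)) (w : List ℕ) : (relabel S w).length = w.length := by
  induction w generalizing S with
  | nil => rfl
  | cons j w ih => simp [relabel, ih]

theorem mem_infType_cons {S : Set (List ℕ)} {j : ℕ} {w : List ℕ} :
    j :: w ∈ infType S ↔ w ∈ infType (desc S [j]) := by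
  simp [infType, desc]

theorem infType_nil {S : Set (List ℕ)} : [] ∈ infType S ↔ S.Infinite := by
  simp [infType, desc]

theorem infinite_of_infType {S : Set (List ℕ)} {w : List ℕ} (h : w ∈ infType S) :
    S.Infinite := by
  have : ((fun v => w ++ v) '' desc S w).Infinite :=
    Set.Infinite.image (fun a _ b _ hab => by simpa using hab) h
  refine this.mono ?_
  rintro _ ⟨v, hv, rfl⟩
  exact hv

theorem cons_mem_spineNodes {S : Set (List ℕ)} {m : ℕ} {u : List ℕ} :
    m :: u ∈ spineNodes S ↔ ∃ j, [j] ∈ infType S ∧ {i | i < j ∧ [i] ∈ infType S}.ncard = m ∧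
      u ∈ spineNodes (desc S [j]) := by
  constructor
  · rintro ⟨w, hw, hwu⟩
    rcases w with _ | ⟨j, w⟩
    · simp [relabel] at hwu
    · simp only [relabel, List.cons.injEq] at hwu
      rw [mem_infType_cons] at hw
      refine ⟨j, ?_, hwu.1, w, hw, hwu.2⟩
      rw [mem_infType_cons, infType_nil]
      exact infinite_of_infType hw
  · rintro ⟨j, -, hm, w, hw, rfl⟩
    exact ⟨j :: w, mem_infType_cons.2 hw, by simp [relabel, hm]⟩

/-- The set of words `S` codes a tree. -/
def IsTree (S : Set (List ℕ)) : Prop :=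
  [] ∈ S ∧ ∀ w, ∃ k, ∀ j, w ++ [j] ∈ S ↔ w ∈ S ∧ j < k

theorem IsTree.desc {S : Set (List ℕ)} (hS : IsTree S) {j : ℕ} (h : [j] ∈ S) :
    IsTree (desc S [j]) := by
  refine ⟨by simpa [Spine.desc] using h, fun w => ?_⟩
  obtain ⟨k, hk⟩ := hS.2 ([j] ++ w)
  exact ⟨k, fun i => by simpa [Spine.desc] using hk i⟩

theorem IsTree.singleton_mem {S : Set (List ℕ)} (hS : IsTree S) {j : ℕ} (h : [j] ∈ infType S) :
    [j] ∈ S := by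
  obtain ⟨v, hv⟩ := Set.Infinite.nonempty h
  exact (PlaneTree.mem_of_append ⟨S, hS.1, hS.2⟩ (w := [j]) hv :)

theorem IsTree.finite_kids {S : Set (List ℕ)} (hS : IsTree S) :
    {j | [j] ∈ infType S}.Finite := by
  obtain ⟨k, hk⟩ := hS.2 []
  refine (Set.finite_Iio k).subset fun j hj => ?_
  exact ((hk j).1 (hS.singleton_mem hj)).2

theorem IsTree.exists_kid {S : Set (List ℕ)} (hS : IsTree S) (hinf : S.Infinite) :
    ∃ j, [j] ∈ infType S := by
  by_contra! hcon
  obtain ⟨k, hk⟩ := hS.2 []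
  refine hinf (((Set.finite_singleton []).union
    ((Set.finite_Iio k).biUnion fun j _ =>
      (Set.not_infinite.1 (hcon j)).image (fun v => j :: v))).subset ?_)
  intro w hw
  rcases w with _ | ⟨j, w⟩
  · simp
  · right
    have : [j] ∈ S := (PlaneTree.mem_of_append ⟨S, hS.1, hS.2⟩ (w := [j]) (v := w) hw :)
    simp only [Set.mem_iUnion]
    exact ⟨j, ((hk j).1 this).2, w, hw, rfl⟩

theorem count_lt_iff {A : Set ℕ} (hA : A.Finite) (m : ℕ) :
    (∃ j, j ∈ A ∧ {i | i < j ∧ i ∈ A}.ncard = m) ↔ m < A.ncard := by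
  classical
  have hset : ∀ j, {i | i < j ∧ i ∈ A}.ncard = Nat.count (· ∈ A) j := by
    intro j
    rw [Nat.count_eq_card_filter_range, ← Set.ncard_coe_finset]
    congr 1
    ext i
    simp
  have hcard : hA.toFinset.card = A.ncard := (Set.ncard_eq_toFinset_card A hA).symm
  constructor
  · rintro ⟨j, hj, hm⟩
    rw [← hm]
    refine Set.ncard_lt_ncard ?_ hA
    refine ⟨fun i hi => hi.2, fun h => ?_⟩
    exact lt_irrefl j (h hj).1
  · intro hm
    rw [← hcard] at hm
    refine ⟨Nat.nth (· ∈ A) m, Nat.nth_mem m fun _ => hm, ?_⟩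
    rw [hset]
    exact Nat.count_nth fun _ => hm

theorem count_injOn {A : Set ℕ} {j j' : ℕ} (hj : j ∈ A) (hj' : j' ∈ A)
    (h : {i | i < j ∧ i ∈ A}.ncard = {i | i < j' ∧ i ∈ A}.ncard) : j = j' := by
  have key : ∀ {a b : ℕ}, a ∈ A → a < b →
      {i | i < a ∧ i ∈ A}.ncard < {i | i < b ∧ i ∈ A}.ncard := by
    intro a b ha hab
    refine Set.ncard_lt_ncard ⟨fun i hi => ⟨hi.1.trans hab, hi.2⟩, fun hs => ?_⟩
      ((Set.finite_Iio b).subset fun i hi => hi.1)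
    exact lt_irrefl a (hs ⟨hab, ha⟩).1
  rcases lt_trichotomy j j' with hlt | heq | hlt
  · exact absurd h (key hj hlt).ne
  · exact heq
  · exact absurd h (key hj' hlt).ne'

theorem nil_mem_spineNodes {S : Set (List ℕ)} (hinf : S.Infinite) : [] ∈ spineNodes S :=
  ⟨[], infType_nil.2 hinf, rfl⟩

theorem offspring_spineNodes (u : List ℕ) : ∀ {S : Set (List ℕ)}, IsTree S → S.Infinite →
    ∃ k, ∀ m, u ++ [m] ∈ spineNodes S ↔ u ∈ spineNodes S ∧ m < k := by
  induction u with
  | nil =>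
    intro S hS hinf
    refine ⟨{j | [j] ∈ infType S}.ncard, fun m => ?_⟩
    rw [← count_lt_iff hS.finite_kids, List.nil_append, cons_mem_spineNodes]
    simp only [nil_mem_spineNodes hinf, true_and]
    refine exists_congr fun j => ?_
    constructor
    · rintro ⟨h1, h2, -⟩
      exact ⟨h1, h2⟩
    · rintro ⟨h1, h2⟩
      exact ⟨h1, h2, nil_mem_spineNodes h1⟩
  | cons a u ih =>
    intro S hS hinf
    by_cases hex : ∃ j, [j] ∈ infType S ∧ {i | i < j ∧ [i] ∈ infType S}.ncard = a
    · obtain ⟨j, hj, hja⟩ := hex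
      obtain ⟨k, hk⟩ := ih (hS.desc (hS.singleton_mem hj)) hj
      refine ⟨k, fun m => ?_⟩
      have hred : ∀ v, a :: v ∈ spineNodes S ↔ v ∈ spineNodes (desc S [j]) := by
        intro v
        rw [cons_mem_spineNodes]
        constructor
        · rintro ⟨j', hj', hja', hv⟩
          have : j' = j := count_injOn (A := {i | [i] ∈ infType S}) hj' hj (hja'.trans hja.symm)
          rwa [this] at hv
        · exact fun hv => ⟨j, hj, hja, hv⟩
      rw [List.cons_append, hred, hred, hk]
    · refine ⟨0, fun m => ?_⟩
      simp only [not_lt_zero, and_false, iff_false]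
      rw [List.cons_append, cons_mem_spineNodes]
      rintro ⟨j, h1, h2, -⟩
      exact hex ⟨j, h1, h2⟩

theorem exists_length {n : ℕ} : ∀ {S : Set (List ℕ)}, IsTree S → S.Infinite →
    ∃ u ∈ spineNodes S, u.length = n := by
  induction n with
  | zero => exact fun _ hinf => ⟨[], nil_mem_spineNodes hinf, rfl⟩
  | succ n ih =>
    intro S hS hinf
    obtain ⟨j, hj⟩ := hS.exists_kid hinf
    obtain ⟨u, hu, hn⟩ := ih (hS.desc (hS.singleton_mem hj)) hj
    exact ⟨_ :: u, cons_mem_spineNodes.2 ⟨j, hj, rfl, hu⟩, by simp [hn]⟩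

theorem infinite_spineNodes {S : Set (List ℕ)} (hS : IsTree S) (hinf : S.Infinite) :
    (spineNodes S).Infinite := by
  refine Set.Infinite.of_image List.length ?_
  have : List.length '' spineNodes S = Set.univ :=
    Set.eq_univ_of_forall fun n => exists_length hS hinf
  rw [this]
  exact Set.infinite_univ

end Spine

/-- The spine map `χ`: the subtree spanned by the root and the vertices of infinite type. -/
noncomputable def spine (T : InfTree) : InfTree :=
  ⟨{ nodes := Spine.spineNodes T.1.nodes
     root_mem := Spine.nil_mem_spineNodes T.2
     offspring := fun w => Spine.offspring_spineNodes w ⟨T.1.root_mem, T.1.offspring⟩ T.2 },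
   Spine.infinite_spineNodes ⟨T.1.root_mem, T.1.offspring⟩ T.2⟩

/-- The set of spine trees. -/
def spineTrees : Set InfTree := Set.range spine

/-- The set of spine trees at distance at most `a` from the tree `T₀`. -/
def spineBall (T₀ : PlaneTree) (a : ℝ) : Set InfTree :=
  {S | S ∈ spineTrees ∧ dist S.1 T₀ ≤ a}

/-- The pushforward of `ν^{(μ)}`, as a measure on infinite trees, under the spine map. -/
noncomputable def spineMeasure (μ : ℝ) : Measure InfTree :=
  Measure.map spine (Measure.comap Subtype.val (nu μ : Measure PlaneTree))

/-- The set of infinite trees whose spine is at distance at most `1 / r` from `T₀`. -/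
def spineEvent (T₀ : PlaneTree) (r : ℕ) : Set PlaneTree :=
  Subtype.val '' (spine ⁻¹' spineBall T₀ (1 / (r : ℝ)))

/-- The measure `ν^{(μ)}` conditioned on `spineEvent T₀ r`, as a measure on that event. -/
noncomputable def condNu (μ : ℝ) (T₀ : PlaneTree) (r : ℕ) : Measure (spineEvent T₀ r) :=
  Measure.comap Subtype.val (cond (nu μ : Measure PlaneTree) (spineEvent T₀ r))

/-! ### Grafting -/

namespace PlaneTree

/-- The offspring, from left to right, of the vertex `p` of `T₀` after a tree `b p n` has been
grafted in each sector `(p, n)`, `0 ≤ n ≤ T₀.numKids p`, around `p`. The sector `(p, n)` lies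
immediately to the left of the offspring `p ++ [n]` of `p`, the last one to the right of all
of them. Here `Sum.inl n` is the offspring `p ++ [n]` in `T₀`, and
`Sum.inr (n, c)` is the offspring `[c]` of the vertex `[]` of `b p n`. -/
noncomputable def slots (T₀ : PlaneTree) (b : List ℕ → ℕ → PlaneTree) (p : List ℕ) :
    List (ℕ ⊕ ℕ × ℕ) :=
  (List.range (T₀.numKids p)).flatMap
      (fun n => (List.range ((b p n).numKids [])).map (fun c => Sum.inr (n, c)) ++ [Sum.inl n]) ++
    (List.range ((b p (T₀.numKids p)).numKids [])).map (fun c => Sum.inr (T₀.numKids p, c))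

/-- Membership in the part of the grafted tree above the vertex `p` of `T₀`, with words relative
to that vertex. -/
def graftMem (T₀ : PlaneTree) (b : List ℕ → ℕ → PlaneTree) : List ℕ → List ℕ → Prop
  | _, [] => True
  | p, x :: w =>
    match (slots T₀ b p)[x]? with
    | none => False
    | some (Sum.inl n) => graftMem T₀ b (p ++ [n]) w
    | some (Sum.inr (n, c)) => c :: w ∈ (b p n).nodes

theorem mem_of_slot {T₀ : PlaneTree} {b : List ℕ → ℕ → PlaneTree} {p : List ℕ} {x n c : ℕ}
    (h : (slots T₀ b p)[x]? = some (Sum.inr (n, c))) : [c] ∈ (b p n).nodes := by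
  have hmem := List.mem_of_getElem? h
  have hc : c < (b p n).numKids [] := by
    simp only [slots, List.mem_append, List.mem_flatMap, List.mem_range, List.mem_map,
      Sum.inr.injEq, Prod.mk.injEq, List.mem_singleton, reduceCtorEq, or_false] at hmem
    rcases hmem with ⟨_, _, _, h1, rfl, rfl⟩ | ⟨_, h1, rfl, rfl⟩ <;> exact h1
  exact ((b p n).mem_append_singleton_iff [] c).2 ⟨root_mem _, hc⟩

theorem graftMem_offspring (T₀ : PlaneTree) (b : List ℕ → ℕ → PlaneTree) (w : List ℕ) :
    ∀ p, ∃ k, ∀ j, graftMem T₀ b p (w ++ [j]) ↔ graftMem T₀ b p w ∧ j < k := by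
  induction w with
  | nil =>
    intro p
    refine ⟨(slots T₀ b p).length, fun j => ?_⟩
    simp only [List.nil_append, graftMem, true_and]
    rcases hx : (slots T₀ b p)[j]? with _ | (n | ⟨n, c⟩)
    · simpa using hx
    · have := List.getElem?_eq_some_iff.1 hx
      simpa using this.1
    · have := List.getElem?_eq_some_iff.1 hx
      simpa [mem_of_slot hx] using this.1
  | cons x w ih =>
    intro p
    simp only [List.cons_append, graftMem]
    rcases hx : (slots T₀ b p)[x]? with _ | (n | ⟨n, c⟩)
    · exact ⟨0, fun j => by simp⟩
    · exact ih (p ++ [n])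
    · exact (b p n).offspring (c :: w)

/-- The tree obtained from `T₀` by grafting the tree `b p n` in the sector `(p, n)` for every
vertex `p` of `T₀` (other than the root `i₀`) and `0 ≤ n ≤ T₀.numKids p`. A leaf has only one
sector. The root edge of `b p n` is identified with the edge from `p` to its parent. -/
def graft (T₀ : PlaneTree) (b : List ℕ → ℕ → PlaneTree) : PlaneTree where
  nodes := {w | graftMem T₀ b [] w}
  root_mem := trivial
  offspring w := graftMem_offspring T₀ b w []

/-- The leaves of a tree. -/
abbrev Leaf (T : PlaneTree) : Type := {w : List ℕ // w ∈ T.nodes ∧ T.numKids w = 0}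

/-- The sectors around the vertices other than the root and the leaves. -/
abbrev InnerSector (T : PlaneTree) : Type :=
  {s : List ℕ × ℕ // s.1 ∈ T.nodes ∧ T.numKids s.1 ≠ 0 ∧ s.2 ≤ T.numKids s.1}

theorem finite_innerSector (T : FinTree) : Finite (InnerSector T.1) := by
  have : (⋃ w ∈ T.1.nodes, (fun n => (w, n)) '' Set.Iic (T.1.numKids w)).Finite :=
    T.2.biUnion fun w _ => (Set.finite_Iic _).image _
  refine (this.subset ?_).to_subtype
  rintro ⟨w, n⟩ ⟨h1, -, h2⟩
  simp only [Set.mem_iUnion]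
  exact ⟨w, h1, n, h2, rfl⟩

noncomputable instance (T : FinTree) : Fintype (InnerSector T.1) :=
  @Fintype.ofFinite _ (finite_innerSector T)

open Classical in
/-- The tree obtained from `T₀` by grafting the tree `x i` onto the leaf `e i`, for each `i`, and
the tree `y s` in each sector `s` around a vertex that is neither a leaf nor the root. -/
noncomputable def graftAll (T₀ : PlaneTree) {R : ℕ} (e : Fin R ≃ Leaf T₀)
    (x : Fin R → PlaneTree) (y : InnerSector T₀ → PlaneTree) : PlaneTree :=
  graft T₀ fun p n =>
    if hp : p ∈ T₀.nodes ∧ T₀.numKids p = 0 then x (e.symm ⟨p, hp⟩)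
    else if hs : p ∈ T₀.nodes ∧ T₀.numKids p ≠ 0 ∧ n ≤ T₀.numKids p then y ⟨(p, n), hs⟩
    else star 0

end PlaneTree

/-! ### Mixtures over the simplex -/

/-- The normalised Lebesgue measure on the simplex
`{(μ₁, …, μₙ) | μ₁ + ⋯ + μₙ = μ, μ₁, …, μₙ > 0}`, `n ≥ 1`, `μ > 0`, written in the coordinates
`(μ₁, …, μₙ₋₁)`. -/
noncomputable def simplexMeasure : (n : ℕ) → ℝ → Measure (Fin n → ℝ)
  | 0, _ => 0
  | n + 1, μ =>
    Measure.map (fun x : Fin n → ℝ => Fin.snoc (α := fun _ => ℝ) x (μ - ∑ i, x i))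
      (cond volume {x : Fin n → ℝ | (∀ i, 0 < x i) ∧ ∑ i, x i < μ})

/-- The mixture of the product measures `∏ i, ν^{(μ_i)}` over the simplex. -/
noncomputable def mixedMeasure (n : ℕ) (μ : ℝ) : Measure (Fin n → PlaneTree) :=
  (simplexMeasure n μ).bind fun m => Measure.pi fun i => (nu (m i) : Measure PlaneTree)

/-! Put q = e^{-μ} and let W_K(N) be the sum of q^h over the forests of K trees with N edges, h
being the maximal height. Since q^h = (1 - q) ∑_{m ≥ h} q^m, one has W_K(N) = (1 - q) ∑_m q^m [X^N]
x_m^K, where x_m counts trees of height at most m and x_{m+1} = X / (1 - x_m). A tree that agrees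
with t up to height n + 1 is t with a forest planted on its highest level, so its probability under
ν_N is q^n W_K(N - b) / W_1(N) with K = `top n t` and b = `below n t`. The local limit is thus
determined by W_1(N + 1) / W_1(N) → 4 and by the limits a_K of W_K(N) / W_1(N).

Ratios. The continued fraction x_{m+1} = X / (1 - x_m) makes the Hankel matrices of the coefficients
of x_m and of x_m / (1 - ε x_m), and those of the shifted coefficients, positive semidefinite
(`of_isResolvent`, `succ_of_isResolvent`). Mixtures over m therefore remain log-convex and their
successive ratios increase to the growth rate 4 (`HankelPsd.TwoPsd.ratio`). As this holds for all ε
in [0, 1], limit points of W_K(N) / W_1(N) do not change when N is replaced by N + 1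
(`forestWeight.tendsto_shift`), and cutting the root edges yields ∑_j multichoose(K, j) a_j = (4^K /
q) a_K.

Uniqueness (`IsHarmonic.eq_aCoef`). For the functional x^K ↦ a_K these equations express invariance,
up to the factor q, under the Möbius map x ↦ 1 / (4 (1 - x)), which is parabolic with fixed point
1/2. Positivity is transported along the orbit of 0 to 1/2; there the equations become harmonicity
for Poisson steps, whose nonnegative solutions are geometric. Hence a_K = 2 · 2^{-K} ∑_j C(K, j + 1)
μ^j / j!.

Branches. Write a_K(μ) = 2 · 2^{-K} L_μ((1 + X)^K) with L_μ(X^{n+1}) = μ^n / n! and L_μ(1) = 0. The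
map P ↦ P(0) δ_0 + L_m(P) dm turns products into convolutions. For a grafted tree K is the sum of
the levels of its R branches, so (1 + X)^K factorises and a_K becomes an integral of products over
all faces of the simplex (`lintegral_faces`), a branch having law ν^{(m)} where its coordinate m is
positive and law ρ where it is 0. Requiring all R branches to be infinite selects the open face, of
mass μ^{R-1} / (R - 1)!. The factors e^{-(r-1)μ} and ∏ ρ(T_s) come from the shift of the height and
the edges of the finite branches (`nu_agree_graftAll`). Grafting with fixed finite branches maps
small balls exactly onto balls, so the measures can be compared on balls; the finite branches run
through a countable set, and summation gives the product formula `nu_graftSet`, which contains i)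
and ii). -/

/-! ### The generating functions of the trees of bounded height -/

namespace PowerSeries

theorem coeff_pow_eq_zero_of_lt {f : PowerSeries ℝ} (hf : constantCoeff f = 0) {N j : ℕ}
    (h : N < j) : coeff N (f ^ j) = 0 := by
  have h1 : (X : PowerSeries ℝ) ∣ f := X_dvd_iff.2 hf
  exact X_pow_dvd_iff.1 (pow_dvd_pow_of_dvd h1 j) N h

theorem coeff_subst_eq_sum {f : PowerSeries ℝ} (hf : constantCoeff f = 0) (α : PowerSeries ℝ)
    (N : ℕ) : coeff N (α.subst f) = ∑ j ∈ Finset.range (N + 1), coeff j α * coeff N (f ^ j) := by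
  rw [coeff_subst' (HasSubst.of_constantCoeff_zero' hf)]
  simp only [smul_eq_mul]
  refine finsum_eq_sum_of_support_subset _ fun j hj => ?_
  simp only [Finset.coe_range, Set.mem_Iio]
  by_contra hlt
  exact hj (by simp [coeff_pow_eq_zero_of_lt hf (show N < j by omega)])

theorem coeff_mul_nonneg {f g : PowerSeries ℝ} (hf : ∀ N, 0 ≤ coeff N f)
    (hg : ∀ N, 0 ≤ coeff N g) (N : ℕ) : 0 ≤ coeff N (f * g) := by
  rw [coeff_mul]
  exact Finset.sum_nonneg fun p _ => mul_nonneg (hf _) (hg _)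

theorem coeff_pow_nonneg {f : PowerSeries ℝ} (hf : ∀ N, 0 ≤ coeff N f) (K N : ℕ) :
    0 ≤ coeff N (f ^ K) := by
  induction K generalizing N with
  | zero => rw [pow_zero, coeff_one]; split_ifs <;> simp
  | succ K ih => rw [pow_succ]; exact coeff_mul_nonneg ih hf N

/-- The series with coefficients the numbers of multisets is the inverse of `(1 - X) ^ K`. -/
theorem mk_multichoose_mul (K : ℕ) :
    (mk fun j => (K.multichoose j : ℝ)) * (1 - X) ^ K = 1 := by
  rcases K with _ | K
  · ext N
    rcases N with _ | N <;> simp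
  · have h : (mk fun j => ((K + 1).multichoose j : ℝ)) = mk fun j => ((K + j).choose K : ℝ) := by
      ext j
      rw [coeff_mk, coeff_mk, Nat.multichoose_eq, show K + 1 + j - 1 = K + j by omega,
        Nat.choose_symm_add]
    rw [h, ← mk_one_pow_eq_mk_choose_add, ← mul_pow, mk_one_mul_one_sub_eq_one, one_pow]

theorem subst_mk_multichoose_mul {f : PowerSeries ℝ} (hf : constantCoeff f = 0) (K : ℕ) :
    (mk fun j => (K.multichoose j : ℝ)).subst f * (1 - f) ^ K = 1 := by
  have hs := HasSubst.of_constantCoeff_zero' hf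
  have h := congrArg (substAlgHom (R := ℝ) hs) (mk_multichoose_mul K)
  rw [map_mul, map_pow, map_sub, map_one] at h
  simpa [coe_substAlgHom, subst_X hs] using h

/-- The value at `t` of a series with nonnegative coefficients. -/
noncomputable def evalENN (t : ENNReal) (f : PowerSeries ℝ) : ENNReal :=
  ∑' N, ENNReal.ofReal (coeff N f) * t ^ N

/-- Values in `ENNReal` make the evaluation multiplicative without any convergence condition, which
is needed at t > 1/4 in `exists_not_isBigO`. -/
theorem evalENN_mul (t : ENNReal) {f g : PowerSeries ℝ} (hf : ∀ N, 0 ≤ coeff N f)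
    (hg : ∀ N, 0 ≤ coeff N g) : evalENN t (f * g) = evalENN t f * evalENN t g := by
  simp only [evalENN]
  rw [← ENNReal.tsum_mul_right]
  simp_rw [← ENNReal.tsum_mul_left]
  rw [← ENNReal.tsum_prod' (f := fun p : ℕ × ℕ => ENNReal.ofReal (coeff p.1 f) * t ^ p.1 *
      (ENNReal.ofReal (coeff p.2 g) * t ^ p.2)),
    ← Equiv.tsum_eq Finset.HasAntidiagonal.sigmaAntidiagonalEquivProd,
    ENNReal.tsum_sigma']
  refine tsum_congr fun N => ?_
  rw [coeff_mul, ENNReal.ofReal_sum_of_nonneg fun p _ => mul_nonneg (hf _) (hg _),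
    Finset.sum_mul, tsum_fintype, ← Finset.sum_coe_sort (Finset.HasAntidiagonal.antidiagonal N)]
  refine Finset.sum_congr rfl fun p _ => ?_
  have hp := Finset.HasAntidiagonal.mem_antidiagonal.1 p.2
  simp only [Finset.HasAntidiagonal.sigmaAntidiagonalEquivProd_apply]
  rw [ENNReal.ofReal_mul (hf _), show t ^ N = t ^ p.1.1 * t ^ p.1.2 by rw [← pow_add, hp]]
  ring

theorem evalENN_one (t : ENNReal) : evalENN t 1 = 1 := by
  rw [evalENN, tsum_eq_single 0]
  · simp
  · intro N hN
    simp [coeff_one, hN]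

theorem evalENN_pow (t : ENNReal) {f : PowerSeries ℝ} (hf : ∀ N, 0 ≤ coeff N f) (K : ℕ) :
    evalENN t (f ^ K) = evalENN t f ^ K := by
  induction K with
  | zero => simp [evalENN_one]
  | succ K ih => rw [pow_succ, evalENN_mul t (coeff_pow_nonneg hf K) hf, ih, pow_succ]

end PowerSeries

open PowerSeries in
/-- The generating function, by size, of the trees of height at most `m`. -/
noncomputable def heightSeries : ℕ → PowerSeries ℝ
  | 0 => 0
  | m + 1 => X * (1 - heightSeries m)⁻¹

namespace heightSeries

open PowerSeries

theorem constantCoeff_eq (m : ℕ) : constantCoeff (heightSeries m) = 0 := by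
  cases m <;> simp [heightSeries]

theorem succ_mul (m : ℕ) : heightSeries (m + 1) * (1 - heightSeries m) = X := by
  rw [heightSeries, mul_assoc, PowerSeries.inv_mul_cancel, mul_one]
  simp [constantCoeff_eq]

theorem succ_eq (m : ℕ) :
    heightSeries (m + 1) = X + heightSeries m * heightSeries (m + 1) := by
  linear_combination succ_mul m

theorem succ_pow (m K : ℕ) : heightSeries (m + 1) ^ K =
    (mk fun j => (K.multichoose j : ℝ)).subst (heightSeries m) * X ^ K := by
  have h := subst_mk_multichoose_mul (constantCoeff_eq m) K
  rw [← succ_mul m, mul_pow]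
  linear_combination - heightSeries (m + 1) ^ K * h

/-- Cutting the root edges of K trees leaves a forest of some number j of trees, lower by one;
`K.multichoose j` counts the ways to distribute these j trees, in order, over K vertices. -/
theorem coeff_succ_pow (m K N : ℕ) : coeff (N + K) (heightSeries (m + 1) ^ K) =
    ∑ j ∈ Finset.range (N + 1), (K.multichoose j : ℝ) * coeff N (heightSeries m ^ j) := by
  rw [succ_pow, coeff_mul_X_pow, coeff_subst_eq_sum (constantCoeff_eq m)]
  simp

theorem coeff_succ (m N : ℕ) : coeff (N + 1) (heightSeries (m + 1)) =
    ∑ j ∈ Finset.range (N + 1), coeff N (heightSeries m ^ j) := by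
  simpa using coeff_succ_pow m 1 N

theorem coeff_nonneg (m N : ℕ) : 0 ≤ coeff N (heightSeries m) := by
  induction m generalizing N with
  | zero => simp [heightSeries]
  | succ m ih =>
    rcases N with _ | N
    · rw [coeff_zero_eq_constantCoeff_apply, constantCoeff_eq]
    · rw [coeff_succ]
      exact Finset.sum_nonneg fun j _ => coeff_pow_nonneg ih j N

theorem coeff_pow_nonneg (m K N : ℕ) : 0 ≤ coeff N (heightSeries m ^ K) :=
  PowerSeries.coeff_pow_nonneg (coeff_nonneg m) K N

/-- The only tree counted is a star. -/
theorem coeff_two (N : ℕ) : coeff (N + 1) (heightSeries 2) = 1 := by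
  induction N with
  | zero => simp [coeff_succ]
  | succ N ih =>
    rw [succ_eq, map_add, ← ih]
    have : heightSeries 1 = X := by simp [heightSeries]
    rw [this, coeff_succ_X_mul, coeff_X]
    simp

/-- For t ≠ 0 the right-hand side is `⊤` as soon as the inner value reaches 1, because the
subtraction is truncated. This later excludes such values. -/
theorem evalENN_succ (t : ENNReal) (m : ℕ) :
    evalENN t (heightSeries (m + 1)) = t * (1 - evalENN t (heightSeries m))⁻¹ := by
  rw [← ENNReal.tsum_geometric]
  simp_rw [← evalENN_pow t (coeff_nonneg m)]
  conv_lhs => rw [evalENN, tsum_eq_zero_add' ENNReal.summable]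
  rw [coeff_zero_eq_constantCoeff_apply, constantCoeff_eq]
  simp only [ENNReal.ofReal_zero, zero_mul, zero_add, evalENN]
  rw [ENNReal.tsum_comm, ← ENNReal.tsum_mul_left]
  refine tsum_congr fun N => ?_
  rw [coeff_succ, ENNReal.ofReal_sum_of_nonneg fun j _ => coeff_pow_nonneg m j N,
    ENNReal.tsum_mul_right, tsum_eq_sum (s := Finset.range (N + 1)), pow_succ]
  · ring
  · intro j hj
    rw [coeff_pow_eq_zero_of_lt (constantCoeff_eq m) (by simpa using hj), ENNReal.ofReal_zero]

/-- The iterates of x ↦ (1/4) / (1 - x) from 0 stay below the fixed point 1/2. -/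
theorem evalENN_quarter_le (m : ℕ) : evalENN (1 / 4) (heightSeries m) ≤ 1 / 2 := by
  induction m with
  | zero => simp [heightSeries, evalENN]
  | succ m ih =>
    rw [evalENN_succ]
    have h1 : (1 / 2 : ENNReal) ≤ 1 - evalENN (1 / 4) (heightSeries m) := by
      refine ENNReal.le_sub_of_add_le_left (ne_top_of_le_ne_top (by simp) ih) ?_
      calc _ ≤ (1 / 2 + 1 / 2 : ENNReal) := by gcongr
        _ = 1 := ENNReal.add_halves 1
    calc _ ≤ (1 / 4 : ENNReal) * (1 / 2)⁻¹ := by gcongr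
      _ = 1 / 2 := by
        rw [one_div, one_div, inv_inv, show (4 : ENNReal) = 2 * 2 by norm_num,
          ENNReal.mul_inv (by simp) (by simp), mul_assoc, ENNReal.inv_mul_cancel (by simp) (by simp),
          mul_one]

/-- A single term of the value at 1/4 is at most the whole value, which is at most 1. -/
theorem coeff_pow_le (m K N : ℕ) : coeff N (heightSeries m ^ K) ≤ 4 ^ N := by
  have h1 : evalENN (1 / 4) (heightSeries m ^ K) ≤ 1 := by
    rw [evalENN_pow _ (coeff_nonneg m)]
    refine pow_le_one' ((evalENN_quarter_le m).trans ?_) K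
    simp
  have h2 := (ENNReal.le_tsum N).trans h1
  rw [one_div, ← ENNReal.inv_pow, ← div_eq_mul_inv,
    ENNReal.div_le_iff_le_mul (by simp) (by simp), one_mul] at h2
  have h3 : (4 : ENNReal) ^ N = ENNReal.ofReal (4 ^ N) := by
    rw [ENNReal.ofReal_pow (by norm_num)]; simp
  rw [h3, ENNReal.ofReal_le_ofReal_iff (by positivity)] at h2
  exact h2

/-- The numbers of trees of bounded height do not all grow at a rate smaller than `4`. -/
theorem exists_not_isBigO {ρ : ℝ} (hρ0 : 0 < ρ) (hρ : ρ < 4) :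
    ∃ m, ∀ C : ℝ, ∃ N, C * ρ ^ N < coeff N (heightSeries m) := by
  -- Otherwise all the series converge at some t > 1/4. Their values e_m satisfy e_{m+1} (1 - e_m) =
  -- t, and since x (1 - x) ≤ 1/4 they grow by at least t - 1/4 at each step while remaining below
  -- 1.
  by_contra! hcon
  obtain ⟨t, ht1, ht2⟩ : ∃ t : ℝ, 1 / 4 < t ∧ t < 1 / ρ :=
    exists_between (one_div_lt_one_div_of_lt hρ0 hρ)
  have ht0 : 0 < t := by linarith
  have htρ : t * ρ < 1 := (lt_div_iff₀ hρ0).1 ht2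
  set e : ℕ → ENNReal := fun m => evalENN (ENNReal.ofReal t) (heightSeries m) with he
  have hfin : ∀ m, e m ≠ ⊤ := by
    intro m
    obtain ⟨C, hC⟩ := hcon m
    have hC0 : 0 ≤ C := by simpa [constantCoeff_eq] using hC 0
    have hs : Summable fun N : ℕ => C * (t * ρ) ^ N :=
      (summable_geometric_of_lt_one (by positivity) htρ).mul_left C
    refine ne_top_of_le_ne_top hs.tsum_ofReal_ne_top (ENNReal.tsum_le_tsum fun N => ?_)
    rw [← ENNReal.ofReal_pow ht0.le, ← ENNReal.ofReal_mul (coeff_nonneg m N)]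
    refine ENNReal.ofReal_le_ofReal ?_
    calc _ ≤ C * ρ ^ N * t ^ N := by gcongr; exact hC N
      _ = _ := by rw [mul_pow]; ring
  have hsucc : ∀ m, e (m + 1) = ENNReal.ofReal t * (1 - e m)⁻¹ := fun m => evalENN_succ _ m
  have hlt : ∀ m, e m < 1 := by
    intro m
    by_contra! h
    refine hfin (m + 1) ?_
    rw [hsucc, tsub_eq_zero_of_le h, ENNReal.inv_zero, ENNReal.mul_top]
    simpa using ht0
  have hreal : ∀ m, (e (m + 1)).toReal * (1 - (e m).toReal) = t := by
    intro m
    rw [hsucc, ENNReal.toReal_mul, ENNReal.toReal_inv, ENNReal.toReal_sub_of_le (hlt m).le (by simp),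
      ENNReal.toReal_ofReal ht0.le, ENNReal.toReal_one, mul_assoc, inv_mul_cancel₀, mul_one]
    have : (e m).toReal < 1 := by
      simpa using (ENNReal.toReal_lt_toReal (hfin m) (by simp)).2 (hlt m)
    linarith
  have hlt' : ∀ m, (e m).toReal < 1 := fun m => by
    simpa using (ENNReal.toReal_lt_toReal (hfin m) (by simp)).2 (hlt m)
  have hstep : ∀ m, (e m).toReal + (t - 1 / 4) ≤ (e (m + 1)).toReal := by
    intro m
    have h1 := hreal m
    have h2 := hlt' m
    have h3 : 0 ≤ (e m).toReal := ENNReal.toReal_nonneg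
    by_contra! h
    nlinarith [mul_lt_mul_of_pos_right h (show 0 < 1 - (e m).toReal by linarith),
      sq_nonneg ((e m).toReal - 1 / 2)]
  have hlin : ∀ m : ℕ, m * (t - 1 / 4) ≤ (e m).toReal := by
    intro m
    induction m with
    | zero => simp
    | succ m ih => push_cast; linarith [hstep m]
  obtain ⟨m, hm⟩ := exists_nat_gt (1 / (t - 1 / 4))
  rw [div_lt_iff₀ (by linarith)] at hm
  linarith [hlin m, hlt' m]

end heightSeries

/-! ### Log-convexity -/

/-- The Hankel matrices of the sequence `f` are positive semidefinite. -/
def HankelPsd (f : ℕ → ℝ) : Prop :=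
  ∀ (n : ℕ) (ξ : ℕ → ℝ),
    0 ≤ ∑ i ∈ Finset.range n, ∑ j ∈ Finset.range n, ξ i * ξ j * f (i + j)

namespace HankelPsd

/-- The quadratic form of c S cᵀ at ξ is that of S at cᵀ ξ; this is how positivity passes through a
congruence. -/
theorem sum_congruence (n : ℕ) (ξ : ℕ → ℝ) (c S : ℕ → ℕ → ℝ) :
    ∑ i ∈ Finset.range n, ∑ j ∈ Finset.range n, ξ i * ξ j *
      (∑ k ∈ Finset.range n, ∑ l ∈ Finset.range n, c i k * c j l * S k l) =
    ∑ k ∈ Finset.range n, ∑ l ∈ Finset.range n,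
      (∑ i ∈ Finset.range n, ξ i * c i k) * (∑ j ∈ Finset.range n, ξ j * c j l) * S k l := by
  simp_rw [Finset.sum_mul_sum, Finset.mul_sum, Finset.sum_mul]
  have h1 : ∀ i, ∑ j ∈ Finset.range n, ∑ k ∈ Finset.range n, ∑ l ∈ Finset.range n,
      ξ i * ξ j * (c i k * c j l * S k l) = ∑ k ∈ Finset.range n, ∑ l ∈ Finset.range n,
      ∑ j ∈ Finset.range n, ξ i * c i k * (ξ j * c j l) * S k l := by
    intro i
    rw [Finset.sum_comm]
    refine Finset.sum_congr rfl fun k _ => ?_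
    rw [Finset.sum_comm]
    exact Finset.sum_congr rfl fun l _ => Finset.sum_congr rfl fun j _ => by ring
  simp_rw [h1]
  rw [Finset.sum_comm]
  refine Finset.sum_congr rfl fun k _ => ?_
  rw [Finset.sum_comm]

/-- The sequence `v` is the sequence of coefficients of `1 / (1 - X (ε + S))`, where `s` is the
sequence of coefficients of `S`. -/
structure IsResolvent (ε : ℝ) (s v : ℕ → ℝ) : Prop where
  zero : v 0 = 1
  succ : ∀ n, v (n + 1) = ε * v n + ∑ a ∈ Finset.range (n + 1), v a * s (n - a)

variable {ε : ℝ} {s v : ℕ → ℝ}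

/-- Read `v n` as the total weight of the ways of cutting a segment of length n into blocks, a block
of length l having weight `s (l - 1)`, plus ε if l = 1. Either i is a cut point, or one block
contains it in its interior. Such a block has length at least 2, so ε and `s 0` do not occur. -/
theorem IsResolvent.add (h : IsResolvent ε s v) (i j : ℕ) : v (i + j) = v i * v j +
    ∑ a ∈ Finset.range i, ∑ b ∈ Finset.range j, v a * v b * s (i + j - 1 - a - b) := by
  induction i generalizing j with
  | zero => simp [h.zero]
  | succ i ih =>
    rw [show i + 1 + j = i + (j + 1) by ring, ih (j + 1), Finset.sum_range_succ, h.succ i, h.succ j]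
    simp_rw [show i + (j + 1) - 1 = i + j by omega]
    rw [Finset.sum_range_succ _ j, Finset.sum_range_succ _ i]
    simp_rw [Finset.sum_range_succ _ j, Finset.sum_add_distrib]
    have e1 : ∀ b, i + j - i - b = j - b := fun b => by omega
    have e2 : ∀ a, i + j - a - j = i - a := fun a => by omega
    simp only [e1, e2]
    have e3 : v i * ∑ x ∈ Finset.range j, v x * s (j - x) =
        ∑ x ∈ Finset.range j, v i * v x * s (j - x) := by
      rw [Finset.mul_sum]; exact Finset.sum_congr rfl fun _ _ => by ring
    have e4 : (∑ x ∈ Finset.range i, v x * s (i - x)) * v j =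
        ∑ x ∈ Finset.range i, v x * v j * s (i - x) := by
      rw [Finset.sum_mul]; exact Finset.sum_congr rfl fun _ _ => by ring
    simp only [Nat.sub_self]
    linear_combination e3 - e4

/-- Now the unit step from i to i + 1 is singled out instead of a point. The block containing it may
have length 1, which brings in ε and `s 0`. -/
theorem IsResolvent.add_succ (h : IsResolvent ε s v) (i j : ℕ) :
    v (i + j + 1) = ε * (v i * v j) +
    ∑ a ∈ Finset.range (i + 1), ∑ b ∈ Finset.range (j + 1), v a * v b * s (i + j - a - b) := by
  rw [show i + j + 1 = i + 1 + j by ring, h.add (i + 1) j, h.succ i]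
  simp_rw [Finset.sum_range_succ _ j, Finset.sum_add_distrib]
  rw [add_mul, Finset.sum_mul]
  have e0 : i + 1 + j - 1 = i + j := by omega
  have e2 : ∀ a, i + j - a - j = i - a := fun a => by omega
  simp only [e0, e2]
  have e4 : ∀ x, v x * s (i - x) * v j = v x * v j * s (i - x) := fun x => by ring
  simp only [e4]
  ring

theorem sum_range_reflect_ite {n i : ℕ} (hi : i ≤ n) (g : ℕ → ℕ → ℝ) :
    ∑ a ∈ Finset.range i, g a (i - 1 - a) =
      ∑ k ∈ Finset.range n, if k < i then g (i - 1 - k) k else 0 := by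
  rw [← Finset.sum_filter, ← Finset.sum_range_reflect]
  have : (Finset.range n).filter (· < i) = Finset.range i := by
    ext k; simp; omega
  rw [this]
  refine Finset.sum_congr rfl fun k hk => ?_
  have : k < i := by simpa using hk
  congr 1
  omega

/-- By `IsResolvent.add` the Hankel matrix of v is v vᵀ plus a congruence, by a triangular Toeplitz
matrix, of the Hankel matrix of the shifted s. -/
theorem of_isResolvent (h : IsResolvent ε s v) (hs : HankelPsd fun n => s (n + 1)) :
    HankelPsd v := by
  intro n ξ
  have key : ∀ i ∈ Finset.range n, ∀ j ∈ Finset.range n, ξ i * ξ j * v (i + j) =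
      (ξ i * v i) * (ξ j * v j) + ξ i * ξ j * ∑ k ∈ Finset.range n, ∑ l ∈ Finset.range n,
        (if k < i then v (i - 1 - k) else 0) * (if l < j then v (j - 1 - l) else 0) *
          s (k + l + 1) := by
    intro i hi j hj
    have hi' : i < n := by simpa using hi
    have hj' : j < n := by simpa using hj
    rw [h.add]
    have e1 : ∑ a ∈ Finset.range i, ∑ b ∈ Finset.range j, v a * v b * s (i + j - 1 - a - b) =
        ∑ a ∈ Finset.range i, ∑ b ∈ Finset.range j,
          v a * v b * s ((i - 1 - a) + (j - 1 - b) + 1) := by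
      refine Finset.sum_congr rfl fun a ha => Finset.sum_congr rfl fun b hb => ?_
      have : a < i := by simpa using ha
      have : b < j := by simpa using hb
      congr 2
      omega
    rw [e1, sum_range_reflect_ite hi'.le
      (fun a k => ∑ b ∈ Finset.range j, v a * v b * s (k + (j - 1 - b) + 1))]
    have e2 : ∀ k, (if k < i then ∑ b ∈ Finset.range j,
          v (i - 1 - k) * v b * s (k + (j - 1 - b) + 1) else 0) =
        ∑ l ∈ Finset.range n, (if k < i then v (i - 1 - k) else 0) *
          (if l < j then v (j - 1 - l) else 0) * s (k + l + 1) := by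
      intro k
      split_ifs with hk
      · rw [sum_range_reflect_ite hj'.le (fun b l => v (i - 1 - k) * v b * s (k + l + 1))]
        refine Finset.sum_congr rfl fun l _ => ?_
        split_ifs <;> simp
      · simp
    rw [Finset.sum_congr rfl fun k _ => e2 k]
    ring
  rw [Finset.sum_congr rfl fun i hi => Finset.sum_congr rfl (key i hi)]
  simp_rw [Finset.sum_add_distrib]
  rw [sum_congruence, ← Finset.sum_mul_sum]
  refine add_nonneg (mul_self_nonneg _) ?_
  exact hs n _

/-- By `IsResolvent.add_succ` the shifted Hankel matrix of v is ε v vᵀ plus a congruence of the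
Hankel matrix of s. The sequence and its shift exchange roles, so both properties have to be
propagated together. -/
theorem succ_of_isResolvent (hε : 0 ≤ ε) (h : IsResolvent ε s v) (hs : HankelPsd s) :
    HankelPsd fun n => v (n + 1) := by
  intro n ξ
  have key : ∀ i ∈ Finset.range n, ∀ j ∈ Finset.range n, ξ i * ξ j * v (i + j + 1) =
      ε * ((ξ i * v i) * (ξ j * v j)) + ξ i * ξ j * ∑ k ∈ Finset.range n, ∑ l ∈ Finset.range n,
        (if k < i + 1 then v (i - k) else 0) * (if l < j + 1 then v (j - l) else 0) *
          s (k + l) := by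
    intro i hi j hj
    have hi' : i + 1 ≤ n := by simpa using hi
    have hj' : j + 1 ≤ n := by simpa using hj
    rw [h.add_succ]
    have e1 : ∑ a ∈ Finset.range (i + 1), ∑ b ∈ Finset.range (j + 1),
          v a * v b * s (i + j - a - b) =
        ∑ a ∈ Finset.range (i + 1), ∑ b ∈ Finset.range (j + 1),
          v a * v b * s ((i + 1 - 1 - a) + (j + 1 - 1 - b)) := by
      refine Finset.sum_congr rfl fun a ha => Finset.sum_congr rfl fun b hb => ?_
      have : a < i + 1 := by simpa using ha
      have : b < j + 1 := by simpa using hb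
      congr 2
      omega
    rw [e1, sum_range_reflect_ite hi'
      (fun a k => ∑ b ∈ Finset.range (j + 1), v a * v b * s (k + (j + 1 - 1 - b)))]
    have e2 : ∀ k, (if k < i + 1 then ∑ b ∈ Finset.range (j + 1),
          v (i + 1 - 1 - k) * v b * s (k + (j + 1 - 1 - b)) else 0) =
        ∑ l ∈ Finset.range n, (if k < i + 1 then v (i - k) else 0) *
          (if l < j + 1 then v (j - l) else 0) * s (k + l) := by
      intro k
      split_ifs with hk
      · rw [sum_range_reflect_ite hj' (fun b l => v (i + 1 - 1 - k) * v b * s (k + l))]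
        refine Finset.sum_congr rfl fun l _ => ?_
        split_ifs <;> simp
      · simp
    rw [Finset.sum_congr rfl fun k _ => e2 k]
    ring
  rw [Finset.sum_congr rfl fun i hi => Finset.sum_congr rfl (key i hi)]
  simp_rw [Finset.sum_add_distrib]
  rw [sum_congruence]
  simp_rw [← Finset.mul_sum]
  rw [← Finset.sum_mul]
  refine add_nonneg (mul_nonneg hε (mul_self_nonneg _)) ?_
  exact hs n _

theorem two_by_two {f : ℕ → ℝ} (hf : HankelPsd f) (i : ℕ) (x y : ℝ) :
    0 ≤ x ^ 2 * f (2 * i) + 2 * x * y * f (2 * i + 1) + y ^ 2 * f (2 * i + 2) := by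
  have h := hf (i + 2) fun k => if k = i then x else if k = i + 1 then y else 0
  have hsum : ∀ g : ℕ → ℝ, ∑ k ∈ Finset.range (i + 2),
      (if k = i then x else if k = i + 1 then y else 0) * g k = x * g i + y * g (i + 1) := by
    intro g
    rw [Finset.sum_range_succ, Finset.sum_range_succ, Finset.sum_eq_zero]
    · simp
    · intro k hk
      have : k < i := by simpa using hk
      rw [if_neg (by omega), if_neg (by omega), zero_mul]
  simp_rw [mul_assoc, ← Finset.mul_sum, hsum] at h
  rw [show i + i = 2 * i by ring, show i + (i + 1) = 2 * i + 1 by ring,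
    show i + 1 + i = 2 * i + 1 by ring, show i + 1 + (i + 1) = 2 * i + 2 by ring] at h
  linarith

/-- The inequalities expressing that the nonnegative sequence `v` is log-convex. -/
def TwoPsd (v : ℕ → ℝ) : Prop :=
  ∀ (n : ℕ) (x y : ℝ), 0 ≤ x ^ 2 * v n + 2 * x * y * v (n + 1) + y ^ 2 * v (n + 2)

/-- Diagonal blocks of size two of the Hankel matrix give the even n, those of the shifted matrix
the odd n. -/
theorem twoPsd (h0 : HankelPsd v) (h1 : HankelPsd fun n => v (n + 1)) : TwoPsd v := by
  intro n x y
  obtain ⟨i, rfl | rfl⟩ := n.even_or_odd'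
  · exact h0.two_by_two i x y
  · exact h1.two_by_two i x y

end HankelPsd

/-! ### Log-convexity of the coefficients of the height series. -/

namespace heightSeries

open PowerSeries HankelPsd

/-- Up to the factor X, x_{m+1} is 1 / (1 - x_m), and x_m is X times the series of its shifted
coefficients; hence ε = 0. -/
theorem isResolvent_succ (m : ℕ) : IsResolvent 0 (fun n => coeff (n + 1) (heightSeries m))
    (fun n => coeff (n + 1) (heightSeries (m + 1))) := by
  refine ⟨?_, fun n => ?_⟩
  · simp [coeff_succ]
  · rw [zero_mul, zero_add, succ_eq, map_add, coeff_X, if_neg (by omega), zero_add,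
      ← succ_eq, mul_comm, coeff_mul, Finset.Nat.sum_antidiagonal_eq_sum_range_succ_mk,
      Finset.sum_range_succ', Finset.sum_range_succ]
    simp only [coeff_zero_eq_constantCoeff_apply, constantCoeff_eq, zero_mul, add_zero,
      Nat.sub_self, mul_zero, Nat.reduceSubDiff]
    refine Finset.sum_congr rfl fun a ha => ?_
    have : a < n + 1 := by simpa using ha
    rw [show n + 1 - a = n - a + 1 by omega]

theorem hankelPsd (m : ℕ) : HankelPsd (fun n => coeff (n + 1) (heightSeries m)) ∧
    HankelPsd (fun n => coeff (n + 1 + 1) (heightSeries m)) := by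
  induction m with
  | zero => constructor <;> · intro n ξ; simp [heightSeries]
  | succ m ih =>
    have h := isResolvent_succ m
    constructor
    · refine of_isResolvent h ?_
      exact ih.2
    · have h2 := succ_of_isResolvent le_rfl h ih.1
      exact h2

/-- The series `∑ j, ε ^ j x ^ (j + 1)`, with `x` the generating function of the trees of height at
most `m`. -/
noncomputable def geomSeries (ε : ℝ) (m : ℕ) : PowerSeries ℝ :=
  (X * mk fun j => ε ^ j).subst (heightSeries m)

theorem coeff_geomSeries (ε : ℝ) (m N : ℕ) : coeff N (geomSeries ε m) =
    ∑ j ∈ Finset.range N, ε ^ j * coeff N (heightSeries m ^ (j + 1)) := by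
  rw [geomSeries, coeff_subst_eq_sum (constantCoeff_eq m), Finset.sum_range_succ']
  simp

theorem geomSeries_mul (ε : ℝ) (m : ℕ) :
    geomSeries ε m * (1 - C ε * heightSeries m) = heightSeries m := by
  have hs := HasSubst.of_constantCoeff_zero' (constantCoeff_eq m)
  have h1 : (X * mk fun j => ε ^ j) * (1 - C ε * X) = X := by
    have : (mk fun j => ε ^ j) * (1 - C ε * X) = 1 := by
      rw [mul_sub, mul_one, ← mul_assoc]
      ext N
      rcases N with _ | N
      · simp
      · rw [map_sub, coeff_succ_mul_X, mul_comm, coeff_C_mul]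
        simp [pow_succ, mul_comm]
    rw [mul_assoc, this, mul_one]
  have h := congrArg (substAlgHom (R := ℝ) hs) h1
  rw [map_mul, map_sub, map_mul (substAlgHom hs) (C ε), map_one] at h
  have hC : (substAlgHom (R := ℝ) hs) (C ε) = C ε := by
    simpa using AlgHom.commutes (substAlgHom (R := ℝ) hs) ε
  rw [hC] at h
  simpa only [coe_substAlgHom, subst_X hs, geomSeries] using h

/-- For x = X / (1 - x_m) one has x / (1 - ε x) = X / (1 - ε X - x_m), so ε enters only as the
constant of the resolvent. -/
theorem geomSeries_succ (ε : ℝ) (m : ℕ) : geomSeries ε (m + 1) =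
    X + (C ε * X + heightSeries m) * geomSeries ε (m + 1) := by
  have h1 := geomSeries_mul ε (m + 1)
  have h2 := succ_mul m
  have h3 : (1 - C ε * heightSeries (m + 1)) ≠ 0 := by
    intro h
    have := congrArg constantCoeff h
    simp [constantCoeff_eq] at this
  refine mul_right_cancel₀ h3 ?_
  linear_combination (1 - C ε * X - heightSeries m) * h1 + h2

theorem isResolvent_geomSeries (ε : ℝ) (m : ℕ) :
    IsResolvent ε (fun n => coeff (n + 1) (heightSeries m))
      (fun n => coeff (n + 1) (geomSeries ε (m + 1))) := by
  refine ⟨?_, fun n => ?_⟩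
  · rw [coeff_geomSeries]; simp [coeff_succ]
  · conv_lhs => rw [geomSeries_succ]
    rw [map_add, coeff_X, if_neg (by omega), zero_add, add_mul, map_add, mul_assoc, coeff_C_mul,
      coeff_succ_X_mul]
    congr 1
    rw [mul_comm, coeff_mul, Finset.Nat.sum_antidiagonal_eq_sum_range_succ_mk,
      Finset.sum_range_succ', Finset.sum_range_succ]
    have h0 : coeff 0 (geomSeries ε (m + 1)) = 0 := by rw [coeff_geomSeries]; simp
    simp only [coeff_zero_eq_constantCoeff_apply, constantCoeff_eq, add_zero,
      Nat.sub_self, mul_zero, Nat.reduceSubDiff]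
    rw [← coeff_zero_eq_constantCoeff_apply, h0, zero_mul, add_zero]
    refine Finset.sum_congr rfl fun a ha => ?_
    have : a < n + 1 := by simpa using ha
    rw [show n + 1 - a = n - a + 1 by omega]

theorem twoPsd_geomSeries {ε : ℝ} (hε : 0 ≤ ε) (m : ℕ) :
    TwoPsd fun n => coeff (n + 1) (geomSeries ε m) := by
  rcases m with _ | m
  · intro n x y
    have : ∀ N, coeff N (geomSeries ε 0) = 0 := fun N => by
      rw [coeff_geomSeries]; simp [heightSeries]
    simp [this]
  · exact twoPsd (of_isResolvent (isResolvent_geomSeries ε m) (hankelPsd m).2)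
      (succ_of_isResolvent hε (isResolvent_geomSeries ε m) (hankelPsd m).1)

end heightSeries

/-! ### Partition functions of forests and their ratios -/

/-- A log-convex sequence with exponential growth rate `4` has ratios increasing to `4`. -/
theorem HankelPsd.TwoPsd.ratio {u : ℕ → ℝ} (hu : HankelPsd.TwoPsd u) (hpos : ∀ n, 0 < u n)
    {C : ℝ} (hC : ∀ n, u n ≤ C * 4 ^ n)
    (hbig : ∀ ρ : ℝ, 0 < ρ → ρ < 4 → ∀ C : ℝ, ∃ n, C * ρ ^ n < u n) :
    (∀ n, u (n + 1) ≤ 4 * u n) ∧ Tendsto (fun n => u (n + 1) / u n) atTop (𝓝 4) := by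
  have hmono : Monotone fun n => u (n + 1) / u n := by
    refine monotone_nat_of_le_succ fun n => ?_
    rw [div_le_div_iff₀ (hpos n) (hpos (n + 1))]
    -- At this point the quadratic form equals u_n (u_n u_{n+2} - u_{n+1}²).
    have h := hu n (u (n + 1)) (-u n)
    have h2 : 0 ≤ u n * (u n * u (n + 2) - u (n + 1) ^ 2) := by nlinarith
    have h3 := nonneg_of_mul_nonneg_right h2 (hpos n)
    change u (n + 1) * u (n + 1) ≤ u (n + 2) * u n
    nlinarith
  have hle : ∀ n, u (n + 1) / u n ≤ 4 := by
    intro n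
    -- By monotonicity a ratio r > 4 persists, and growth like r^k contradicts the bound C 4^n.
    by_contra! hlt
    set r := u (n + 1) / u n with hr
    have hgrow : ∀ k, u n * r ^ k ≤ u (n + k) := by
      intro k
      induction k with
      | zero => simp
      | succ k ih =>
        have h1 : r ≤ u (n + k + 1) / u (n + k) := hmono (Nat.le_add_right n k)
        rw [le_div_iff₀ (hpos _)] at h1
        calc u n * r ^ (k + 1) = r * (u n * r ^ k) := by ring
          _ ≤ r * u (n + k) := by gcongr
          _ ≤ u (n + (k + 1)) := h1
    have h1 : Tendsto (fun k : ℕ => (r / 4) ^ k) atTop atTop :=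
      tendsto_pow_atTop_atTop_of_one_lt (by linarith)
    obtain ⟨k, hk⟩ := (h1.eventually_gt_atTop (C * 4 ^ n / u n)).exists
    have h2 := (hgrow k).trans (hC (n + k))
    rw [div_pow, lt_div_iff₀ (by positivity), div_mul_eq_mul_div, div_lt_iff₀ (hpos n)] at hk
    rw [pow_add] at h2
    nlinarith
  refine ⟨fun n => (div_le_iff₀ (hpos n)).1 (hle n), ?_⟩
  refine tendsto_order.2 ⟨fun a ha => ?_, fun a ha => Eventually.of_forall fun n =>
    (hle n).trans_lt ha⟩
  obtain ⟨ρ, hρ1, hρ2⟩ := exists_between (max_lt ha (show (0 : ℝ) < 4 by norm_num))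
  rw [max_lt_iff] at hρ1
  have hex : ∃ n, ρ < u (n + 1) / u n := by
    by_contra! hcon
    obtain ⟨n, hn⟩ := hbig ρ hρ1.2 hρ2 (u 0)
    refine absurd hn (not_lt.2 ?_)
    clear hn
    induction n with
    | zero => simp
    | succ n ih =>
      have := hcon n
      rw [div_le_iff₀ (hpos n)] at this
      calc u (n + 1) ≤ ρ * u n := this
        _ ≤ ρ * (u 0 * ρ ^ n) := by gcongr; exact hρ1.2.le
        _ = _ := by ring
  obtain ⟨n, hn⟩ := hex
  filter_upwards [eventually_ge_atTop n] with k hk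
  exact hρ1.1.trans (hn.trans_le (hmono hk))

open PowerSeries in
/-- The sum of `q ^ h` over the forests of `K` trees with `N` edges in total, where `h` is the
maximal height of the trees. -/
noncomputable def forestWeight (q : ℝ) (K N : ℕ) : ℝ :=
  (1 - q) * ∑' m, q ^ m * coeff N (heightSeries m ^ K)

namespace forestWeight

open PowerSeries

variable {q : ℝ}

theorem summable (hq0 : 0 < q) (hq1 : q < 1) (K N : ℕ) :
    Summable fun m => q ^ m * coeff N (heightSeries m ^ K) := by
  refine Summable.of_nonneg_of_le
    (fun m => mul_nonneg (by positivity) (heightSeries.coeff_pow_nonneg m K N))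
    (fun m => mul_le_mul_of_nonneg_left (heightSeries.coeff_pow_le m K N) (by positivity))
    ((summable_geometric_of_lt_one hq0.le hq1).mul_right _)

theorem nonneg (hq0 : 0 < q) (hq1 : q < 1) (K N : ℕ) : 0 ≤ forestWeight q K N :=
  mul_nonneg (by linarith) (tsum_nonneg fun m =>
    mul_nonneg (by positivity) (heightSeries.coeff_pow_nonneg m K N))

theorem zero_left {N : ℕ} (hN : 1 ≤ N) : forestWeight q 0 N = 0 := by
  have : N ≠ 0 := by omega
  simp [forestWeight, coeff_one, this]

theorem eq_zero_of_lt {K N : ℕ} (h : N < K) : forestWeight q K N = 0 := by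
  simp [forestWeight, coeff_pow_eq_zero_of_lt (heightSeries.constantCoeff_eq _) h]

/-- Removing the K root edges lowers the height by one, whence the factor q. The condition `1 ≤ N`
excludes the empty forest, whose height cannot drop. -/
theorem add_left (hq0 : 0 < q) (hq1 : q < 1) (K : ℕ) {N : ℕ} (hN : 1 ≤ N) :
    forestWeight q K (N + K) =
      q * ∑ j ∈ Finset.range (N + 1), (K.multichoose j : ℝ) * forestWeight q j N := by
  have h0 : coeff (N + K) (heightSeries 0 ^ K) = 0 := by
    rcases K with _ | K
    · simp [coeff_one]; omega
    · simp [heightSeries]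
  rw [forestWeight, (summable hq0 hq1 K (N + K)).tsum_eq_zero_add, h0]
  simp_rw [heightSeries.coeff_succ_pow, Finset.mul_sum, forestWeight]
  rw [Summable.tsum_finsetSum]
  · simp only [mul_zero, zero_add]
    rw [Finset.mul_sum]
    refine Finset.sum_congr rfl fun j _ => ?_
    rw [← tsum_mul_left, ← tsum_mul_left, ← tsum_mul_left, ← tsum_mul_left]
    refine tsum_congr fun m => by ring
  · intro j _
    refine ((summable hq0 hq1 j N).mul_left (q * K.multichoose j)).congr fun m => by ring

theorem mul_le_add_left (hq0 : 0 < q) (hq1 : q < 1) (K j : ℕ) {N : ℕ} (hN : 1 ≤ N) :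
    q * (K.multichoose j * forestWeight q j N) ≤ forestWeight q K (N + K) := by
  rw [add_left hq0 hq1 K hN]
  refine mul_le_mul_of_nonneg_left ?_ hq0.le
  rcases lt_or_ge N j with h | h
  · rw [eq_zero_of_lt h, mul_zero]
    exact Finset.sum_nonneg fun j _ => mul_nonneg (by positivity) (nonneg hq0 hq1 _ _)
  · exact Finset.single_le_sum (f := fun j => (K.multichoose j : ℝ) * forestWeight q j N)
      (fun j _ => mul_nonneg (by positivity) (nonneg hq0 hq1 _ _)) (by simpa using by omega)

theorem one_ge (hq0 : 0 < q) (hq1 : q < 1) (m N : ℕ) :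
    (1 - q) * (q ^ m * coeff N (heightSeries m)) ≤ forestWeight q 1 N := by
  refine mul_le_mul_of_nonneg_left ?_ (by linarith)
  have := (summable hq0 hq1 1 N).le_tsum m fun j _ =>
    mul_nonneg (by positivity) (heightSeries.coeff_pow_nonneg j 1 N)
  simpa using this

theorem one_pos (hq0 : 0 < q) (hq1 : q < 1) {N : ℕ} (hN : 1 ≤ N) : 0 < forestWeight q 1 N := by
  obtain ⟨n, rfl⟩ : ∃ n, N = n + 1 := ⟨N - 1, by omega⟩
  refine lt_of_lt_of_le ?_ (one_ge hq0 hq1 2 _)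
  rw [heightSeries.coeff_two]
  have : 0 < 1 - q := by linarith
  positivity

theorem le_four_pow (hq0 : 0 < q) (hq1 : q < 1) (K N : ℕ) : forestWeight q K N ≤ 4 ^ N := by
  have h1 : 0 < 1 - q := by linarith
  calc forestWeight q K N ≤ (1 - q) * ∑' m, q ^ m * 4 ^ N := by
        refine mul_le_mul_of_nonneg_left ?_ h1.le
        exact (summable hq0 hq1 K N).tsum_le_tsum (fun m => mul_le_mul_of_nonneg_left
          (heightSeries.coeff_pow_le m K N) (by positivity))
          ((summable_geometric_of_lt_one hq0.le hq1).mul_right _)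
    _ = 4 ^ N := by
        rw [tsum_mul_right, tsum_geometric_of_lt_one hq0.le hq1, ← mul_assoc,
          mul_inv_cancel₀ h1.ne', one_mul]

/-- The sum of `ε ^ j` times the weight of the forests with `j + 1` trees. -/
noncomputable def geom (q ε : ℝ) (N : ℕ) : ℝ :=
  ∑ j ∈ Finset.range N, ε ^ j * forestWeight q (j + 1) N

theorem hasSum_geom (hq0 : 0 < q) (hq1 : q < 1) (ε : ℝ) (N : ℕ) :
    HasSum (fun m => (1 - q) * (q ^ m * coeff N (heightSeries.geomSeries ε m))) (geom q ε N) := by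
  simp_rw [heightSeries.coeff_geomSeries, Finset.mul_sum, geom]
  refine hasSum_sum fun j _ => ?_
  have := (((summable hq0 hq1 (j + 1) N).hasSum.mul_left (1 - q)).mul_left (ε ^ j))
  refine HasSum.congr_fun this fun m => by ring

/-- The inequalities `TwoPsd` are linear in the sequence, so they pass to the mixture over m with
weights (1 - q) q^m. -/
theorem twoPsd_geom (hq0 : 0 < q) (hq1 : q < 1) {ε : ℝ} (hε : 0 ≤ ε) :
    HankelPsd.TwoPsd fun n => geom q ε (n + 1) := by
  intro n x y
  have h := (((hasSum_geom hq0 hq1 ε (n + 1)).mul_left (x ^ 2)).add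
    ((hasSum_geom hq0 hq1 ε (n + 1 + 1)).mul_left (2 * x * y))).add
    ((hasSum_geom hq0 hq1 ε (n + 2 + 1)).mul_left (y ^ 2))
  refine h.nonneg fun m => ?_
  have h1 := heightSeries.twoPsd_geomSeries hε m n x y
  have h2 : 0 ≤ (1 - q) * q ^ m := mul_nonneg (by linarith) (by positivity)
  calc (0 : ℝ) ≤ (1 - q) * q ^ m * _ := mul_nonneg h2 h1
    _ = _ := by ring

theorem geom_mono (hq0 : 0 < q) (hq1 : q < 1) {ε δ : ℝ} (hε : 0 ≤ ε) (h : ε ≤ δ) (N : ℕ) :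
    geom q ε N ≤ geom q δ N :=
  Finset.sum_le_sum fun j _ => mul_le_mul_of_nonneg_right (by gcongr) (nonneg hq0 hq1 _ _)

theorem geom_zero {N : ℕ} (hN : 1 ≤ N) : geom q 0 N = forestWeight q 1 N := by
  obtain ⟨n, rfl⟩ : ∃ n, N = n + 1 := ⟨N - 1, by omega⟩
  rw [geom, Finset.sum_range_succ']
  simp

/-- For ε = 1 all nonempty forests with N edges are summed, that is, all trees with N + 1 edges
after removal of the root edge. -/
theorem geom_one (hq0 : 0 < q) (hq1 : q < 1) {N : ℕ} (hN : 1 ≤ N) :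
    q * geom q 1 N = forestWeight q 1 (N + 1) := by
  rw [add_left hq0 hq1 1 hN, Finset.sum_range_succ', geom]
  simp [zero_left hN]

/-- The growth is bounded above by comparison with ε = 1, where `geom_one` and `le_four_pow` give
4^{n+2} / q, hence the constant 16 / q. It is bounded below by comparison with ε = 0, a single tree,
and `exists_not_isBigO`. -/
theorem geom_ratio (hq0 : 0 < q) (hq1 : q < 1) {ε : ℝ} (hε0 : 0 ≤ ε) (hε1 : ε ≤ 1) :
    (∀ n, geom q ε (n + 1 + 1) ≤ 4 * geom q ε (n + 1)) ∧
    Tendsto (fun n => geom q ε (n + 1 + 1) / geom q ε (n + 1)) atTop (𝓝 4) := by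
  have hge : ∀ n, forestWeight q 1 (n + 1) ≤ geom q ε (n + 1) := fun n => by
    rw [← geom_zero (by omega)]
    exact geom_mono hq0 hq1 le_rfl hε0 _
  refine HankelPsd.TwoPsd.ratio (twoPsd_geom hq0 hq1 hε0) (C := 16 / q)
    (fun n => (one_pos hq0 hq1 (by omega)).trans_le (hge n)) (fun n => ?_) fun ρ hρ0 hρ C => ?_
  · refine (geom_mono hq0 hq1 hε0 hε1 _).trans ?_
    have h1 := geom_one hq0 hq1 (show 1 ≤ n + 1 by omega)
    have h2 := le_four_pow hq0 hq1 1 (n + 1 + 1)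
    rw [div_mul_eq_mul_div, le_div_iff₀ hq0]
    calc _ = forestWeight q 1 (n + 1 + 1) := by rw [← h1]; ring
      _ ≤ _ := h2
      _ = _ := by ring
  · obtain ⟨m, hm⟩ := heightSeries.exists_not_isBigO hρ0 hρ
    have hc : 0 < (1 - q) * q ^ m := mul_pos (by linarith) (by positivity)
    obtain ⟨N, hN⟩ := hm (max (C / ρ / ((1 - q) * q ^ m)) 0)
    rcases N with _ | n
    · rw [coeff_zero_eq_constantCoeff_apply, heightSeries.constantCoeff_eq] at hN
      simp at hN
    · refine ⟨n, lt_of_lt_of_le ?_ ((one_ge hq0 hq1 m (n + 1)).trans (hge n))⟩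
      have h1 : C / ρ / ((1 - q) * q ^ m) * ρ ^ (n + 1) < coeff (n + 1) (heightSeries m) :=
        lt_of_le_of_lt (by gcongr; exact le_max_left _ _) hN
      have h2 := mul_lt_mul_of_pos_left h1 hc
      calc C * ρ ^ n = (1 - q) * q ^ m * (C / ρ / ((1 - q) * q ^ m) * ρ ^ (n + 1)) := by
            have h3 : (1 - q) ≠ 0 := by linarith
            field_simp
            ring
        _ < _ := h2
        _ = _ := by ring

theorem one_succ_le (hq0 : 0 < q) (hq1 : q < 1) {N : ℕ} (hN : 1 ≤ N) :
    forestWeight q 1 (N + 1) ≤ 4 * forestWeight q 1 N := by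
  obtain ⟨n, rfl⟩ : ∃ n, N = n + 1 := ⟨N - 1, by omega⟩
  have := (geom_ratio hq0 hq1 le_rfl zero_le_one).1 n
  rwa [geom_zero (by omega), geom_zero (by omega)] at this

theorem one_add_le (hq0 : 0 < q) (hq1 : q < 1) {N : ℕ} (hN : 1 ≤ N) (i : ℕ) :
    forestWeight q 1 (N + i) ≤ 4 ^ i * forestWeight q 1 N := by
  induction i with
  | zero => simp
  | succ i ih =>
    calc _ ≤ 4 * forestWeight q 1 (N + i) := one_succ_le hq0 hq1 (by omega)
      _ ≤ 4 * (4 ^ i * forestWeight q 1 N) := by gcongr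
      _ = _ := by ring

theorem tendsto_one_succ (hq0 : 0 < q) (hq1 : q < 1) :
    Tendsto (fun N => forestWeight q 1 (N + 1) / forestWeight q 1 N) atTop (𝓝 4) := by
  rw [← tendsto_add_atTop_iff_nat 1]
  refine (geom_ratio hq0 hq1 le_rfl zero_le_one).2.congr fun n => ?_
  rw [geom_zero (by omega), geom_zero (by omega)]

/-- Plant the j trees on the tops of k edges, and these on one further edge. Each planting costs a
factor q, and the result is among the trees with N + k + 1 edges, whose weight is at most 4^{k+1}
times that for N edges. -/
theorem multichoose_mul_le (hq0 : 0 < q) (hq1 : q < 1) (k j : ℕ) {N : ℕ} (hN : 1 ≤ N) :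
    k.multichoose j * forestWeight q j N ≤ 4 ^ (k + 1) / q ^ 2 * forestWeight q 1 N := by
  have h1 := mul_le_add_left hq0 hq1 k j hN
  have h2 := mul_le_add_left hq0 hq1 1 k (show 1 ≤ N + k by omega)
  have h3 := one_add_le hq0 hq1 hN (k + 1)
  rw [Nat.multichoose_one, Nat.cast_one, one_mul] at h2
  rw [div_mul_eq_mul_div, le_div_iff₀ (by positivity)]
  calc _ = q * (q * (k.multichoose j * forestWeight q j N)) := by ring
    _ ≤ q * forestWeight q k (N + k) := by gcongr
    _ ≤ forestWeight q 1 (N + (k + 1)) := h2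
    _ ≤ _ := h3

end forestWeight

/-! ### Limit points of the ratios -/

/-- Letting ε → 0 gives `d 0 = 0`; then a factor ε can be divided out, and induction applies. -/
theorem eq_zero_of_tsum_pow_mul_eq_zero (n : ℕ) : ∀ {d : ℕ → ℝ}, (Summable fun j => |d j|) →
    (∀ ε : ℝ, 0 < ε → ε ≤ 1 → ∑' j, ε ^ j * d j = 0) → d n = 0 := by
  have hsum : ∀ {d : ℕ → ℝ}, (Summable fun j => |d j|) → ∀ ε : ℝ, 0 < ε → ε ≤ 1 →
      Summable fun j => ε ^ j * d j := by
    intro d hd ε h0 h1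
    refine Summable.of_norm_bounded hd fun j => ?_
    rw [norm_mul, norm_pow, Real.norm_eq_abs, Real.norm_eq_abs, abs_of_pos h0]
    exact mul_le_of_le_one_left (abs_nonneg _) (pow_le_one₀ h0.le h1)
  have hsplit : ∀ {d : ℕ → ℝ}, (Summable fun j => |d j|) → ∀ ε : ℝ, 0 < ε → ε ≤ 1 →
      ∑' j, ε ^ j * d j = d 0 + ε * ∑' j, ε ^ j * d (j + 1) := by
    intro d hd ε h0 h1
    rw [(hsum hd ε h0 h1).tsum_eq_zero_add, ← tsum_mul_left]
    simp only [pow_zero, one_mul]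
    congr 1
    exact tsum_congr fun j => by ring
  have hzero : ∀ {d : ℕ → ℝ}, (Summable fun j => |d j|) →
      (∀ ε : ℝ, 0 < ε → ε ≤ 1 → ∑' j, ε ^ j * d j = 0) → d 0 = 0 := by
    intro d hd h
    have hd' : Summable fun j => |d (j + 1)| := (summable_nat_add_iff 1).2 hd
    have hb : ∀ ε : ℝ, 0 < ε → ε ≤ 1 → |d 0| ≤ ε * ∑' j, |d (j + 1)| := by
      intro ε h0 h1
      have h2 := hsplit hd ε h0 h1
      rw [h ε h0 h1] at h2
      rw [show d 0 = -(ε * ∑' j, ε ^ j * d (j + 1)) by linarith, abs_neg, abs_mul, abs_of_pos h0]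
      refine mul_le_mul_of_nonneg_left ?_ h0.le
      have h3 := hsum hd' ε h0 h1
      refine (norm_tsum_le_tsum_norm h3.norm).trans (h3.norm.tsum_le_tsum (fun j => ?_) hd')
      rw [norm_mul, norm_pow, Real.norm_eq_abs, Real.norm_eq_abs, abs_of_pos h0]
      exact mul_le_of_le_one_left (abs_nonneg _) (pow_le_one₀ h0.le h1)
    have ht : Tendsto (fun ε : ℝ => ε * ∑' j, |d (j + 1)|) (𝓝[>] 0) (𝓝 0) := by
      have : Tendsto (fun ε : ℝ => ε * ∑' j, |d (j + 1)|) (𝓝 0) (𝓝 (0 * ∑' j, |d (j + 1)|)) :=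
        tendsto_id.mul_const _
      rw [zero_mul] at this
      exact this.mono_left nhdsWithin_le_nhds
    have : |d 0| ≤ 0 := by
      refine ge_of_tendsto ht ?_
      filter_upwards [Ioc_mem_nhdsGT (show (0 : ℝ) < 1 by norm_num)] with ε hε
      exact hb ε hε.1 hε.2
    simpa using this
  induction n with
  | zero => exact hzero
  | succ n ih =>
    intro d hd h
    have h0 := hzero hd h
    refine ih (d := fun j => d (j + 1)) ((summable_nat_add_iff 1).2 hd) fun ε hε0 hε1 => ?_
    have h2 := hsplit hd ε hε0 hε1
    rw [h ε hε0 hε1, h0, zero_add, eq_comm, mul_eq_zero] at h2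
    exact h2.resolve_left hε0.ne'

theorem Nat.multichoose_add_two (K j : ℕ) :
    K * (K + 1) * (K + 2).multichoose j = (j + K) * (j + K + 1) * K.multichoose j := by
  rcases K with _ | K
  · rcases j with _ | j <;> simp
  · rw [Nat.multichoose_eq, Nat.multichoose_eq, show K + 1 + 2 + j - 1 = K + j + 1 + 1 by omega,
      show K + 1 + j - 1 = K + j by omega]
    have h1 := Nat.choose_mul_succ_eq (K + j) j
    have h2 := Nat.choose_mul_succ_eq (K + j + 1) j
    rw [show K + j + 1 - j = K + 1 by omega] at h1
    rw [show K + j + 1 + 1 - j = K + 2 by omega] at h2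
    calc _ = (K + 1) * ((K + j + 1 + 1).choose j * (K + 2)) := by ring
      _ = ((K + j + 1).choose j * (K + 1)) * (K + j + 1 + 1) := by rw [← h2]; ring
      _ = _ := by rw [← h1]; ring

namespace forestWeight

variable {q : ℝ}

/-- Using `multichoose_mul_le` for K + 2 in place of K gains the factor (j + K) (j + K + 1) / (K (K
+ 1)). The resulting bound is summable in j and uniform in N, which justifies passing to the limit
under the sum. -/
theorem multichoose_mul_div_le (hq0 : 0 < q) (hq1 : q < 1) (K j : ℕ) (hK : 1 ≤ K) {N : ℕ}
    (hN : 1 ≤ N) : K.multichoose j * (forestWeight q j N / forestWeight q 1 N) ≤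
      K * (K + 1) * 4 ^ (K + 3) / q ^ 2 * (1 / ((j : ℝ) + 1) ^ 2) := by
  have h1 := multichoose_mul_le hq0 hq1 (K + 2) j hN
  have hpos := one_pos hq0 hq1 hN
  have h2 : (K * (K + 1) * (K + 2).multichoose j : ℝ) =
      (j + K) * (j + K + 1) * K.multichoose j := by
    exact_mod_cast Nat.multichoose_add_two K j
  have hK' : (1 : ℝ) ≤ K := by exact_mod_cast hK
  have h0 := nonneg hq0 hq1 j N
  rw [mul_one_div, le_div_iff₀ (by positivity), ← mul_div_assoc, div_mul_eq_mul_div,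
    div_le_iff₀ hpos]
  calc (K.multichoose j : ℝ) * forestWeight q j N * (j + 1) ^ 2
      ≤ K.multichoose j * forestWeight q j N * ((j + K) * (j + K + 1)) := by
        gcongr
        have : (0 : ℝ) ≤ j := by positivity
        nlinarith
    _ = K * (K + 1) * ((K + 2).multichoose j * forestWeight q j N) := by
        linear_combination - forestWeight q j N * h2
    _ ≤ K * (K + 1) * (4 ^ (K + 2 + 1) / q ^ 2 * forestWeight q 1 N) := by
        refine mul_le_mul_of_nonneg_left ?_ (by positivity)
        exact_mod_cast h1
    _ = _ := by ring

theorem div_le (hq0 : 0 < q) (hq1 : q < 1) (j : ℕ) {N : ℕ} (hN : 1 ≤ N) :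
    forestWeight q j N / forestWeight q 1 N ≤ 512 / q ^ 2 * (1 / ((j : ℝ) + 1) ^ 2) := by
  have := multichoose_mul_div_le hq0 hq1 1 j le_rfl hN
  norm_num [Nat.multichoose_one] at this ⊢
  exact this

theorem div_nonneg (hq0 : 0 < q) (hq1 : q < 1) (j N : ℕ) :
    0 ≤ forestWeight q j N / forestWeight q 1 N :=
  _root_.div_nonneg (nonneg hq0 hq1 _ _) (nonneg hq0 hq1 _ _)

theorem summable_bound (D : ℝ) : Summable fun j : ℕ => D * (1 / ((j : ℝ) + 1) ^ 2) := by
  have := (summable_nat_add_iff 1).2 (Real.summable_one_div_nat_pow.2 (show 1 < 2 by norm_num))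
  refine Summable.mul_left D ?_
  simpa using this

/-- The ratios lie in compact intervals, so along an ultrafilter all of them converge at once. -/
theorem exists_limit (hq0 : 0 < q) (hq1 : q < 1) (U : Ultrafilter ℕ) (hU : (U : Filter ℕ) ≤ atTop) (i : ℕ) :
    ∃ a : ℕ → ℝ, (∀ K, 0 ≤ a K ∧ a K ≤ 512 / q ^ 2 * (1 / ((K : ℝ) + 1) ^ 2)) ∧
      ∀ K, Tendsto (fun N => forestWeight q K (N + i) / forestWeight q 1 (N + i)) U (𝓝 (a K)) := by
  have h : ∀ K : ℕ, ∃ x ∈ Set.Icc 0 (512 / q ^ 2 * (1 / ((K : ℝ) + 1) ^ 2)),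
      Tendsto (fun N => forestWeight q K (N + i) / forestWeight q 1 (N + i)) U (𝓝 x) := by
    intro K
    have hmem : ∀ᶠ N in (U : Filter ℕ),
        forestWeight q K (N + i) / forestWeight q 1 (N + i) ∈
          Set.Icc 0 (512 / q ^ 2 * (1 / ((K : ℝ) + 1) ^ 2)) := by
      filter_upwards [hU (eventually_ge_atTop 1)] with N hN
      exact ⟨div_nonneg hq0 hq1 _ _, div_le hq0 hq1 K (by omega)⟩
    exact isCompact_Icc.ultrafilter_le_nhds
      (U.map fun N => forestWeight q K (N + i) / forestWeight q 1 (N + i))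
      (le_principal_iff.2 hmem)
  choose a ha hlim using h
  exact ⟨a, ha, hlim⟩

theorem tendsto_sum (hq0 : 0 < q) (hq1 : q < 1) {U : Filter ℕ} (hU : U ≤ atTop) {a : ℕ → ℝ}
    {i : ℕ} (ha : ∀ K, Tendsto
      (fun N => forestWeight q K (N + i) / forestWeight q 1 (N + i)) U (𝓝 (a K)))
    (c : ℕ → ℝ) (hc : ∀ j, 0 ≤ c j) {D : ℝ} (hD : ∀ j N, 1 ≤ N →
      c j * (forestWeight q j N / forestWeight q 1 N) ≤ D * (1 / ((j : ℝ) + 1) ^ 2)) :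
    Tendsto (fun N => (∑ j ∈ Finset.range (N + i + 1), c j * forestWeight q j (N + i)) /
      forestWeight q 1 (N + i)) U (𝓝 (∑' j, c j * a j)) := by
  have h := tendsto_tsum_of_dominated_convergence (𝓕 := U)
    (f := fun N j => c j * (forestWeight q j (N + i) / forestWeight q 1 (N + i)))
    (g := fun j => c j * a j) (summable_bound D) (fun j => (ha j).const_mul (c j)) (by
      filter_upwards [hU (eventually_ge_atTop 1)] with N hN j
      rw [Real.norm_eq_abs, abs_of_nonneg (mul_nonneg (hc j) (div_nonneg hq0 hq1 _ _))]
      exact hD j _ (by omega))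
  refine h.congr fun N => ?_
  rw [tsum_eq_sum (s := Finset.range (N + i + 1)), Finset.sum_div]
  · simp_rw [mul_div_assoc]
  · intro j hj
    rw [eq_zero_of_lt (by simpa using hj)]
    simp

theorem tendsto_geom (hq0 : 0 < q) (hq1 : q < 1) {U : Filter ℕ} (hU : U ≤ atTop) {a : ℕ → ℝ}
    {i : ℕ} (ha : ∀ K, Tendsto
      (fun N => forestWeight q K (N + i) / forestWeight q 1 (N + i)) U (𝓝 (a K)))
    {ε : ℝ} (hε0 : 0 ≤ ε) (hε1 : ε ≤ 1) :
    Tendsto (fun N => geom q ε (N + i) / forestWeight q 1 (N + i)) U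
      (𝓝 (∑' j, ε ^ j * a (j + 1))) := by
  have h := tendsto_tsum_of_dominated_convergence (𝓕 := U)
    (f := fun N j => ε ^ j * (forestWeight q (j + 1) (N + i) / forestWeight q 1 (N + i)))
    (g := fun j => ε ^ j * a (j + 1)) ((summable_nat_add_iff 1).2 (summable_bound (512 / q ^ 2)))
    (fun j => (ha (j + 1)).const_mul _) (by
      filter_upwards [hU (eventually_ge_atTop 1)] with N hN j
      have h0 := div_nonneg hq0 hq1 (j + 1) (N + i)
      rw [Real.norm_eq_abs, abs_of_nonneg (mul_nonneg (by positivity) h0)]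
      exact (mul_le_of_le_one_left h0 (pow_le_one₀ hε0 hε1)).trans
        (div_le hq0 hq1 (j + 1) (by omega)))
  refine h.congr fun N => ?_
  rw [tsum_eq_sum (s := Finset.range (N + i)), geom, Finset.sum_div]
  · simp_rw [mul_div_assoc]
  · intro j hj
    have : N + i ≤ j := by simpa using hj
    rw [eq_zero_of_lt (by omega)]
    simp

/-- The limits of the ratios along an ultrafilter do not change under a shift. -/
theorem tendsto_shift (hq0 : 0 < q) (hq1 : q < 1) (U : Ultrafilter ℕ) (hU : (U : Filter ℕ) ≤ atTop)
    {a : ℕ → ℝ} {i : ℕ} (ha : ∀ K, Tendsto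
      (fun N => forestWeight q K (N + i) / forestWeight q 1 (N + i)) U (𝓝 (a K))) (K : ℕ) :
    Tendsto (fun N => forestWeight q K (N + (i + 1)) / forestWeight q 1 (N + (i + 1))) U
      (𝓝 (a K)) := by
  obtain ⟨b, hb, hblim⟩ := exists_limit hq0 hq1 U hU (i + 1)
  obtain ⟨a', ha', halim⟩ := exists_limit hq0 hq1 U hU i
  have haa : a' = a := funext fun K => tendsto_nhds_unique (halim K) (ha K)
  subst haa
  have hzero : ∀ (c : ℕ → ℝ) (i : ℕ), (∀ K, Tendsto
      (fun N => forestWeight q K (N + i) / forestWeight q 1 (N + i)) U (𝓝 (c K))) → c 0 = 0 := by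
    intro c i hc
    refine tendsto_nhds_unique (hc 0) (tendsto_const_nhds.congr' ?_)
    filter_upwards [hU (eventually_ge_atTop 1)] with N hN
    rw [zero_left (by omega), zero_div]
  have hbound : ∀ c : ℕ → ℝ, (∀ K, 0 ≤ c K ∧ c K ≤ 512 / q ^ 2 * (1 / ((K : ℝ) + 1) ^ 2)) →
      Summable c := fun c hc =>
    Summable.of_nonneg_of_le (fun K => (hc K).1) (fun K => (hc K).2) (summable_bound _)
  have hsa := (summable_nat_add_iff 1).2 (hbound a' ha')
  have hsb := (summable_nat_add_iff 1).2 (hbound b hb)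
  have hpow : ∀ c : ℕ → ℝ, Summable c → (∀ j, 0 ≤ c j) → ∀ ε : ℝ, 0 < ε → ε ≤ 1 →
      Summable fun j => ε ^ j * c j := fun c hc hc0 ε h0 h1 =>
    Summable.of_nonneg_of_le (fun j => mul_nonneg (by positivity) (hc0 j))
      (fun j => mul_le_of_le_one_left (hc0 j) (pow_le_one₀ h0.le h1)) hc
  have heq : ∀ K, a' K = b K := by
    intro K
    rcases K with _ | n
    · rw [hzero a' i ha, hzero b (i + 1) hblim]
    have := eq_zero_of_tsum_pow_mul_eq_zero n (d := fun j => a' (j + 1) - b (j + 1))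
      (hsa.sub hsb).abs (fun ε h0 h1 => ?_)
    · simpa [sub_eq_zero] using this
    · simp_rw [mul_sub]
      rw [(hpow _ hsa (fun j => (ha' _).1) ε h0 h1).tsum_sub
        (hpow _ hsb (fun j => (hb _).1) ε h0 h1), sub_eq_zero]
      have h2 := tendsto_geom hq0 hq1 hU ha h0.le h1
      have h3 := tendsto_geom hq0 hq1 hU hblim h0.le h1
      -- The ratio 4 for the sums with parameter ε and, in `h5`, for single trees shows that the
      -- generating functions ∑ ε^j a (j + 1) of the limits at N + i and at N + i + 1 coincide.
      have h4 : Tendsto (fun N => geom q ε (N + i + 1) / geom q ε (N + i)) U (𝓝 4) := by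
        have := (tendsto_add_atTop_iff_nat (f := fun n => geom q ε (n + 1) / geom q ε n) 1).1
          (geom_ratio hq0 hq1 h0.le h1).2
        exact ((tendsto_add_atTop_iff_nat i).2 this).mono_left hU
      have h5 : Tendsto (fun N => forestWeight q 1 (N + i + 1) / forestWeight q 1 (N + i)) U
          (𝓝 4) := ((tendsto_add_atTop_iff_nat i).2 (tendsto_one_succ hq0 hq1)).mono_left hU
      have h6 := (h2.mul h4).div h5 (by norm_num)
      rw [mul_div_assoc, div_self (by norm_num), mul_one] at h6
      refine tendsto_nhds_unique h6 (h3.congr' ?_)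
      filter_upwards [hU (eventually_ge_atTop 1)] with N hN
      have p1 := one_pos hq0 hq1 (show 1 ≤ N + i by omega)
      have p2 := one_pos hq0 hq1 (show 1 ≤ N + i + 1 by omega)
      have p3 : 0 < geom q ε (N + i) := by
        refine p1.trans_le ?_
        rw [← geom_zero (by omega)]
        exact geom_mono hq0 hq1 le_rfl h0.le _
      simp only [Pi.div_apply, ← add_assoc]
      field_simp
  rw [heq K]
  exact hblim K

theorem tendsto_add (hq0 : 0 < q) (hq1 : q < 1) (U : Ultrafilter ℕ) (hU : (U : Filter ℕ) ≤ atTop)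
    {a : ℕ → ℝ} (ha : ∀ K, Tendsto
      (fun N => forestWeight q K N / forestWeight q 1 N) U (𝓝 (a K))) (i K : ℕ) :
    Tendsto (fun N => forestWeight q K (N + i) / forestWeight q 1 (N + i)) U (𝓝 (a K)) := by
  induction i generalizing K with
  | zero => simpa using ha K
  | succ i ih => exact tendsto_shift hq0 hq1 U hU ih K

theorem tendsto_one_add (hq0 : 0 < q) (hq1 : q < 1) (i : ℕ) :
    Tendsto (fun N => forestWeight q 1 (N + i) / forestWeight q 1 N) atTop (𝓝 (4 ^ i)) := by
  induction i with
  | zero =>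
    rw [pow_zero]
    refine tendsto_const_nhds.congr' ?_
    filter_upwards [eventually_ge_atTop 1] with N hN
    exact (div_self (one_pos hq0 hq1 hN).ne').symm
  | succ i ih =>
    have h := ih.mul ((tendsto_add_atTop_iff_nat i).2 (tendsto_one_succ hq0 hq1))
    rw [← pow_succ] at h
    refine h.congr' ?_
    filter_upwards [eventually_ge_atTop 1] with N hN
    have p1 := (one_pos hq0 hq1 hN).ne'
    have p2 := (one_pos hq0 hq1 (show 1 ≤ N + i by omega)).ne'
    rw [← add_assoc]
    field_simp

/-- The equations satisfied by the limits of the ratios. -/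
structure IsHarmonic (q : ℝ) (a : ℕ → ℝ) : Prop where
  zero : a 0 = 0
  one : a 1 = 1
  nonneg : ∀ K, 0 ≤ a K
  hasSum : ∀ K : ℕ, HasSum (fun j => (K.multichoose j : ℝ) * a j) (4 ^ K / q * a K)

/-- Divide `add_left` by the weight of single trees with N edges: the left-hand side tends to 4^K
a_K by `tendsto_one_add` and shift invariance, the sum on the right converges by domination. -/
theorem exists_isHarmonic (hq0 : 0 < q) (hq1 : q < 1) (U : Ultrafilter ℕ) (hU : (U : Filter ℕ) ≤ atTop) :
    ∃ a, IsHarmonic q a ∧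
      ∀ K, Tendsto (fun N => forestWeight q K N / forestWeight q 1 N) U (𝓝 (a K)) := by
  obtain ⟨a, ha, hlim⟩ := exists_limit hq0 hq1 U hU 0
  simp only [add_zero] at hlim
  have hzero : a 0 = 0 := by
    refine tendsto_nhds_unique (hlim 0) (tendsto_const_nhds.congr' ?_)
    filter_upwards [hU (eventually_ge_atTop 1)] with N hN
    rw [zero_left hN, zero_div]
  refine ⟨a, ⟨hzero, ?_, fun K => (ha K).1, fun K => ?_⟩, hlim⟩
  · refine tendsto_nhds_unique (hlim 1) (tendsto_const_nhds.congr' ?_)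
    filter_upwards [hU (eventually_ge_atTop 1)] with N hN
    exact (div_self (one_pos hq0 hq1 hN).ne').symm
  · rcases Nat.eq_zero_or_pos K with rfl | hK
    · rw [hzero, mul_zero]
      convert! hasSum_zero using 1
      funext j
      rcases j with _ | j <;> simp [hzero]
    have hD := multichoose_mul_div_le hq0 hq1 K
    have h1 := tendsto_sum hq0 hq1 hU (a := a) (i := 0) (by simpa using hlim)
      (fun j => (K.multichoose j : ℝ)) (fun j => by positivity) (fun j N hN => hD j hK hN)
    have h2 := tendsto_add hq0 hq1 U hU hlim K K
    have h3 := (tendsto_one_add hq0 hq1 K).mono_left hU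
    have h4 : Summable fun j => (K.multichoose j : ℝ) * a j := by
      refine Summable.of_nonneg_of_le (fun j => mul_nonneg (by positivity) (ha j).1) (fun j => ?_)
        (summable_bound (K * (K + 1) * 4 ^ (K + 3) / q ^ 2))
      refine le_of_tendsto ((hlim j).const_mul _) ?_
      filter_upwards [hU (eventually_ge_atTop 1)] with N hN
      exact hD j hK hN
    convert h4.hasSum using 1
    have h5 := (h3.mul h2).div_const q
    rw [mul_div_right_comm] at h5
    refine tendsto_nhds_unique h5 (h1.congr' ?_)
    filter_upwards [hU (eventually_ge_atTop 1)] with N hN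
    have p1 := (one_pos hq0 hq1 hN).ne'
    have p2 := (one_pos hq0 hq1 (show 1 ≤ N + K by omega)).ne'
    rw [add_left hq0 hq1 K hN]
    simp only [add_zero]
    field_simp

end forestWeight

/-! ### Uniqueness of the limit of the ratios -/

theorem hasSum_uncurry_of_nonneg {α β : Type*} {F : α → β → ℝ} (hF : ∀ i k, 0 ≤ F i k) {A : α → ℝ}
    {S : ℝ} (h1 : ∀ i, HasSum (F i) (A i)) (h2 : HasSum A S) :
    HasSum (fun p : α × β => F p.1 p.2) S := by
  have hs : Summable fun p : α × β => F p.1 p.2 := by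
    rw [summable_prod_of_nonneg fun p => hF _ _]
    refine ⟨fun i => (h1 i).summable, ?_⟩
    simp_rw [(h1 _).tsum_eq]
    exact h2.summable
  have := hs.hasSum.prod_fiberwise h1
  rw [← this.unique h2]
  exact hs.hasSum

/-- Sequences which are harmonic for the walk with Poisson steps are geometric. -/
theorem eq_mul_pow_of_hasSum_div_factorial {μ : ℝ} {b : ℕ → ℝ} (hb : ∀ n, 0 ≤ b n)
    (h : ∀ n, HasSum (fun j : ℕ => b (n + j) / (j.factorial : ℝ)) (Real.exp μ * b n)) (n : ℕ) :
    b n = b 0 * μ ^ n := by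
  -- N independent Poisson steps of mean 1 add up to a Poisson step of mean N.
  have hiter : ∀ N n : ℕ, HasSum (fun j : ℕ => b (n + j) * (N : ℝ) ^ j / (j.factorial : ℝ))
      (Real.exp μ ^ N * b n) := by
    intro N
    induction N with
    | zero =>
      intro n
      convert! hasSum_single (f := fun j : ℕ => b (n + j) * ((0 : ℕ) : ℝ) ^ j / (j.factorial : ℝ)) 0
        (fun j hj => by simp [hj]) using 1
      simp
    | succ N ih =>
      intro n
      have h1 : ∀ i : ℕ, HasSum
          (fun k : ℕ => b (n + i + k) * (N : ℝ) ^ i / (i.factorial * k.factorial : ℝ))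
          (Real.exp μ * (b (n + i) * (N : ℝ) ^ i / (i.factorial : ℝ))) := by
        intro i
        convert! (h (n + i)).mul_right ((N : ℝ) ^ i / i.factorial) using 1
        · funext k; field_simp
        · ring
      have h2 := (ih n).mul_left (Real.exp μ)
      have h3 := hasSum_uncurry_of_nonneg (fun i k => by have := hb (n + i + k); positivity) h1 h2
      rw [← Finset.HasAntidiagonal.sigmaAntidiagonalEquivProd.hasSum_iff] at h3
      have h4 := h3.sigma (g := fun j => b (n + j) * ((N + 1 : ℕ) : ℝ) ^ j / (j.factorial : ℝ))
        (fun j => by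
          convert! hasSum_fintype _ using 1
          simp only [Function.comp_apply, Finset.HasAntidiagonal.sigmaAntidiagonalEquivProd_apply]
          rw [Finset.sum_coe_sort (Finset.HasAntidiagonal.antidiagonal j) (fun p : ℕ × ℕ =>
            b (n + p.1 + p.2) * (N : ℝ) ^ p.1 / (p.1.factorial * p.2.factorial : ℝ))]
          push_cast
          rw [add_pow, ← Finset.Nat.sum_antidiagonal_eq_sum_range_succ_mk
            (f := fun p => (N : ℝ) ^ p.1 * 1 ^ p.2 * (j.choose p.1 : ℝ)), Finset.mul_sum,
            Finset.sum_div]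
          refine Finset.sum_congr rfl fun p hp => ?_
          have hp' := Finset.HasAntidiagonal.mem_antidiagonal.1 hp
          have hc : ((j.choose p.1 : ℕ) : ℝ) * p.1.factorial * p.2.factorial = j.factorial := by
            rw [← hp', Nat.choose_symm_add]
            exact_mod_cast Nat.add_choose_mul_factorial_mul_factorial p.1 p.2
          have hj : (j.factorial : ℝ) ≠ 0 := by positivity
          have h1 : (p.1.factorial : ℝ) ≠ 0 := by positivity
          have h2 : (p.2.factorial : ℝ) ≠ 0 := by positivity
          rw [add_assoc, hp', one_pow, mul_one, div_eq_div_iff hj (mul_ne_zero h1 h2), ← hc]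
          ring)
      convert! h4 using 1
      ring
  have hmom : ∀ N n : ℕ, HasSum (fun j : ℕ => (j : ℝ) * (b (n + j) * (N : ℝ) ^ j / (j.factorial : ℝ)))
      (N * (Real.exp μ ^ N * b (n + 1))) := by
    intro N n
    rw [← hasSum_nat_add_iff' 1]
    convert! (hiter N (n + 1)).mul_left (N : ℝ) using 1
    · funext j
      rw [Nat.factorial_succ, show n + (j + 1) = n + 1 + j by ring]
      push_cast
      field_simp
      ring
    · simp
  have hmom2 : ∀ N n : ℕ, HasSum
      (fun j : ℕ => (j : ℝ) ^ 2 * (b (n + j) * (N : ℝ) ^ j / (j.factorial : ℝ)))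
      ((N : ℝ) ^ 2 * (Real.exp μ ^ N * b (n + 2)) + N * (Real.exp μ ^ N * b (n + 1))) := by
    intro N n
    rw [← hasSum_nat_add_iff' 1]
    convert! ((hmom N (n + 1)).mul_left (N : ℝ)).add ((hiter N (n + 1)).mul_left (N : ℝ)) using 1
    · funext j
      rw [Nat.factorial_succ, show n + (j + 1) = n + 1 + j by ring]
      push_cast
      field_simp
      ring
    · simp; ring
  -- Sum (N y - j)² ≥ 0 against the weights b (n + j) N^j / j!, divide by N² e^{μN} and let N → ∞.
  -- This gives the log-convexity of b.
  have hquad : ∀ (n : ℕ) (y : ℝ), 0 ≤ y ^ 2 * b n - 2 * y * b (n + 1) + b (n + 2) := by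
    intro n y
    have hN : ∀ N : ℕ, 0 ≤ y ^ 2 * b n - 2 * y * b (n + 1) + b (n + 2) +
        b (n + 1) * (1 / ((N : ℝ) + 1)) := by
      intro N
      have hx := (((hiter (N + 1) n).mul_left ((((N + 1 : ℕ) : ℝ) * y) ^ 2)).sub
        ((hmom (N + 1) n).mul_left (2 * (((N + 1 : ℕ) : ℝ) * y)))).add (hmom2 (N + 1) n)
      have h0 := hx.nonneg fun j => by
        have : 0 ≤ b (n + j) * ((N + 1 : ℕ) : ℝ) ^ j / (j.factorial : ℝ) := by
          have := hb (n + j); positivity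
        nlinarith [mul_nonneg this (sq_nonneg (((N + 1 : ℕ) : ℝ) * y - j))]
      have hE : 0 < Real.exp μ ^ (N + 1) := by positivity
      have hN1 : (0 : ℝ) < (N + 1 : ℕ) := by positivity
      have e1 : (y ^ 2 * b n - 2 * y * b (n + 1) + b (n + 2) + b (n + 1) * (1 / ((N : ℝ) + 1))) *
          ((N + 1 : ℕ) ^ 2 * Real.exp μ ^ (N + 1)) = (((N + 1 : ℕ) : ℝ) * y) ^ 2 *
          (Real.exp μ ^ (N + 1) * b n) - 2 * (((N + 1 : ℕ) : ℝ) * y) * (((N + 1 : ℕ) : ℝ) *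
          (Real.exp μ ^ (N + 1) * b (n + 1))) + (((N + 1 : ℕ) : ℝ) ^ 2 *
          (Real.exp μ ^ (N + 1) * b (n + 2)) + ((N + 1 : ℕ) : ℝ) *
          (Real.exp μ ^ (N + 1) * b (n + 1))) := by
        have : (N : ℝ) + 1 ≠ 0 := by positivity
        push_cast
        field_simp
        ring
      rw [← e1] at h0
      exact nonneg_of_mul_nonneg_left h0 (by positivity)
    have hlim : Tendsto (fun N : ℕ => y ^ 2 * b n - 2 * y * b (n + 1) + b (n + 2) +
        b (n + 1) * (1 / ((N : ℝ) + 1))) atTop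
        (𝓝 (y ^ 2 * b n - 2 * y * b (n + 1) + b (n + 2) + b (n + 1) * 0)) :=
      (tendsto_one_div_add_atTop_nhds_zero_nat.const_mul _).const_add _
    rw [mul_zero, add_zero] at hlim
    exact ge_of_tendsto hlim (Eventually.of_forall hN)
  have hzero : ∀ n, b n = 0 → b (n + 1) = 0 := by
    intro n hn
    have h1 := h n
    rw [hn, mul_zero, hasSum_zero_iff_of_nonneg fun j => by have := hb (n + j); positivity] at h1
    simpa using congrFun h1 1
  have hlog : ∀ n, b (n + 1) ^ 2 ≤ b n * b (n + 2) := by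
    intro n
    rcases (hb n).eq_or_lt with h0 | h0
    · rw [hzero n h0.symm, ← h0]; simp
    · have h1 := hquad n (b (n + 1) / b n)
      have h2 := mul_nonneg h1 h0.le
      have h3 : ((b (n + 1) / b n) ^ 2 * b n - 2 * (b (n + 1) / b n) * b (n + 1) + b (n + 2)) * b n =
          b n * b (n + 2) - b (n + 1) ^ 2 := by field_simp; ring
      linarith
  -- By log-convexity b (n + j) ≥ r^j b n for the ratio r at n, so the relation yields e^r ≤ e^μ.
  have hratio : ∀ n, b (n + 1) ≤ μ * b n := by
    intro n
    rcases (hb n).eq_or_lt with h0 | h0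
    · rw [hzero n h0.symm, ← h0]; simp
    set r := b (n + 1) / b n with hr
    have hr0 : 0 ≤ r := div_nonneg (hb _) (hb _)
    have hstep : ∀ j, r * b (n + j) ≤ b (n + j + 1) := by
      intro j
      induction j with
      | zero => rw [hr, add_zero, div_mul_cancel₀ _ h0.ne']
      | succ j ih =>
        rcases (hb (n + j)).eq_or_lt with h1 | h1
        · have h2 := hzero _ h1.symm
          rw [← add_assoc, h2, mul_zero]; exact hb _
        · have h2 := hlog (n + j)
          have h3 := hb (n + j + 1)
          change r * b (n + j + 1) ≤ b (n + j + 2)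
          refine le_of_mul_le_mul_left ?_ h1
          nlinarith
    have hgeom : ∀ j, b n * r ^ j ≤ b (n + j) := by
      intro j
      induction j with
      | zero => simp
      | succ j ih =>
        calc b n * r ^ (j + 1) = r * (b n * r ^ j) := by ring
          _ ≤ r * b (n + j) := by gcongr
          _ ≤ _ := hstep j
    have hexp : HasSum (fun j : ℕ => b n * (r ^ j / (j.factorial : ℝ))) (b n * Real.exp r) := by
      rw [Real.exp_eq_exp_ℝ]
      exact (NormedSpace.expSeries_div_hasSum_exp r).mul_left _
    have h1 := hasSum_le (fun j => by
      rw [← mul_div_assoc]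
      gcongr
      exact hgeom j) hexp (h n)
    have h2 : Real.exp r ≤ Real.exp μ := by
      rw [mul_comm] at h1
      exact le_of_mul_le_mul_right h1 h0
    have h3 : r ≤ μ := Real.exp_le_exp.1 h2
    rwa [hr, div_le_iff₀ h0] at h3
  rcases (hb 0).eq_or_lt with h0 | h0
  · have : ∀ n, b n = 0 := fun n => by
      induction n with
      | zero => exact h0.symm
      | succ n ih => exact hzero n ih
    rw [this, this, zero_mul]
  have hμ : 0 ≤ μ := by
    have := (hb 1).trans (hratio 0)
    exact nonneg_of_mul_nonneg_left this h0
  have hle : ∀ n, b n ≤ b 0 * μ ^ n := by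
    intro n
    induction n with
    | zero => simp
    | succ n ih =>
      calc b (n + 1) ≤ μ * b n := hratio n
        _ ≤ μ * (b 0 * μ ^ n) := by gcongr
        _ = _ := by ring
  have hexp : HasSum (fun j : ℕ => b 0 * (μ ^ j / (j.factorial : ℝ))) (b 0 * Real.exp μ) := by
    rw [Real.exp_eq_exp_ℝ]
    exact (NormedSpace.expSeries_div_hasSum_exp μ).mul_left _
  -- The terms are bounded one by one by those of the exponential series and the sums agree, so each
  -- term agrees.
  have hdiff := hexp.sub (h 0)
  rw [mul_comm, sub_self, hasSum_zero_iff_of_nonneg] at hdiff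
  · have := congrFun hdiff n
    simp only [zero_add, Pi.zero_apply] at this
    have hf : (n.factorial : ℝ) ≠ 0 := by positivity
    field_simp at this
    linarith
  · intro j
    simp only [zero_add, ← mul_div_assoc, ← sub_div]
    have := hle j
    exact div_nonneg (by linarith) (by positivity)

/-- The limit of the ratio of the weight of the forests with `K` trees to that of a single tree, as
the total number of edges tends to infinity. -/
noncomputable def aCoef (μ : ℝ) (K : ℕ) : ℝ :=
  2 * (1 / 2) ^ K * ∑ j ∈ Finset.range K, (K.choose (j + 1) : ℝ) * (μ ^ j / (j.factorial : ℝ))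

theorem Nat.multichoose_add_mul_choose (K s i : ℕ) (hK : 1 ≤ K) :
    K.multichoose (s + i) * (s + i).choose s = K.multichoose s * (K + s).multichoose i := by
  obtain ⟨k, rfl⟩ : ∃ k, K = k + 1 := ⟨K - 1, by omega⟩
  rw [Nat.multichoose_eq, Nat.multichoose_eq, Nat.multichoose_eq,
    show k + 1 + (s + i) - 1 = k + s + i by omega, show k + 1 + s - 1 = k + s by omega,
    show k + 1 + s + i - 1 = k + s + i by omega]
  have h := Nat.choose_mul (n := k + s + i) (k := s + i) (s := i) (by omega)
  rw [show k + s + i - i = k + s by omega, show s + i - i = s by omega] at h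
  rw [Nat.choose_symm_add (a := s) (b := i), h, mul_comm]

theorem hasSum_multichoose_mul_pow {t : ℝ} (h0 : 0 ≤ t) (h1 : t < 1) {K : ℕ} (hK : 1 ≤ K) :
    HasSum (fun i => (K.multichoose i : ℝ) * t ^ i) (1 / (1 - t) ^ K) := by
  obtain ⟨k, rfl⟩ : ∃ k, K = k + 1 := ⟨K - 1, by omega⟩
  have ht : ‖t‖ < 1 := by rwa [Real.norm_eq_abs, abs_of_nonneg h0]
  refine (hasSum_choose_mul_geometric_of_norm_lt_one k ht).congr_fun fun n => ?_
  rw [Nat.multichoose_eq, show k + 1 + n - 1 = n + k by omega, Nat.choose_symm_add]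

/-- The alternating sums of multiset numbers count compositions. -/
theorem sum_choose_mul_multichoose (S s : ℕ) :
    ∑ K ∈ Finset.range (S + 1), (S.choose K : ℝ) * (-1) ^ (S - K) * (K.multichoose s : ℝ) =
      if S ≤ s then (S.multichoose (s - S) : ℝ) else 0 := by
  have hG : ∀ K : ℕ, (PowerSeries.mk 1 : PowerSeries ℝ) ^ K =
      PowerSeries.mk fun n => (K.multichoose n : ℝ) := by
    intro K
    rcases K with _ | k
    · ext n; rcases n with _ | n <;> simp
    · rw [PowerSeries.mk_one_pow_eq_mk_choose_add]
      ext n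
      rw [PowerSeries.coeff_mk, PowerSeries.coeff_mk, Nat.multichoose_eq,
        show k + 1 + n - 1 = k + n by omega, Nat.choose_symm_add]
  -- With G = 1 / (1 - X) this is G - 1 = X G; the claim compares the coefficients of (G - 1)^S and
  -- X^S G^S.
  have h1 : (PowerSeries.mk 1 : PowerSeries ℝ) - 1 = PowerSeries.mk 1 * PowerSeries.X := by
    have := PowerSeries.mk_one_mul_one_sub_eq_one ℝ
    linear_combination this
  have h2 : ((PowerSeries.mk 1 : PowerSeries ℝ) + (-1)) ^ S =
      PowerSeries.mk 1 ^ S * PowerSeries.X ^ S := by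
    rw [← sub_eq_add_neg, h1, mul_pow]
  have h3 := congrArg (PowerSeries.coeff s) h2
  rw [PowerSeries.coeff_mul_X_pow', add_pow, map_sum, hG] at h3
  rw [PowerSeries.coeff_mk] at h3
  rw [← h3]
  refine Finset.sum_congr rfl fun K _ => ?_
  rw [hG, show ((-1 : PowerSeries ℝ) ^ (S - K)) = PowerSeries.C ((-1) ^ (S - K)) by simp,
    show ((S.choose K : ℕ) : PowerSeries ℝ) = PowerSeries.C (S.choose K : ℝ) by simp,
    PowerSeries.coeff_mul_C, PowerSeries.coeff_mul_C, PowerSeries.coeff_mk]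
  ring

namespace forestWeight

/-- The value at `(x - t) ^ s` of the linear functional on polynomials which maps `x ^ i` to
`a i`. -/
noncomputable def shifted (a : ℕ → ℝ) (t : ℝ) (s : ℕ) : ℝ :=
  ∑ i ∈ Finset.range (s + 1), (s.choose i : ℝ) * (-t) ^ (s - i) * a i

/-- Apply the functional x^i ↦ a i to the expansion of ((x - t) + t)^K. -/
theorem eq_sum_shifted (a : ℕ → ℝ) (t : ℝ) (K : ℕ) :
    a K = ∑ s ∈ Finset.range (K + 1), (K.choose s : ℝ) * t ^ (K - s) * shifted a t s := by
  set Λ : Polynomial ℝ →ₗ[ℝ] ℝ := Polynomial.lsum fun i => a i • LinearMap.id with hΛ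
  have hX : ∀ (c : ℝ) (i : ℕ), Λ (Polynomial.C c * Polynomial.X ^ i) = c * a i := by
    intro c i
    rw [Polynomial.C_mul_X_pow_eq_monomial, hΛ]
    simp [Polynomial.lsum_apply, mul_comm]
  have hs : ∀ s, Λ ((Polynomial.X + Polynomial.C (-t)) ^ s) = shifted a t s := by
    intro s
    rw [add_pow, map_sum, shifted]
    refine Finset.sum_congr rfl fun i _ => ?_
    rw [← hX]
    congr 1
    rw [← Polynomial.C_pow, ← Polynomial.C_eq_natCast, mul_comm, Polynomial.C_mul]
    ring
  have h1 : Λ (Polynomial.X ^ K) = a K := by simpa using hX 1 K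
  have h2 : (Polynomial.X : Polynomial ℝ) = (Polynomial.X + Polynomial.C (-t)) + Polynomial.C t := by
    simp
  rw [← h1, h2, add_pow, map_sum]
  refine Finset.sum_congr rfl fun s _ => ?_
  have e : (Polynomial.X + Polynomial.C (-t)) ^ s * Polynomial.C t ^ (K - s) *
      (K.choose s : Polynomial ℝ) = ((K.choose s : ℝ) * t ^ (K - s)) •
      (Polynomial.X + Polynomial.C (-t)) ^ s := by
    rw [Polynomial.smul_eq_C_mul, ← Polynomial.C_pow, ← Polynomial.C_eq_natCast, Polynomial.C_mul]
    ring
  rw [e, LinearMap.map_smul, hs, smul_eq_mul]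

theorem shifted_zero_right (a : ℕ → ℝ) (t : ℝ) : shifted a t 0 = a 0 := by simp [shifted]

variable {q : ℝ} {a : ℕ → ℝ}

/-- The equations say that the functional x^i ↦ a i takes the value 4^K / q · a K at 1 / (1 - x)^K.
Here this function is expanded in powers of x - t; the nonnegative values at (x - t)^s permit the
rearrangement. -/
theorem IsHarmonic.hasSum_shifted (h : IsHarmonic q a) {t : ℝ} (h0 : 0 ≤ t)
    (h1 : t < 1) (hpos : ∀ s, 0 ≤ shifted a t s) (K : ℕ) :
    HasSum (fun s => (K.multichoose s : ℝ) / (1 - t) ^ (K + s) * shifted a t s)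
      (4 ^ K / q * a K) := by
  rcases Nat.eq_zero_or_pos K with rfl | hK
  · rw [h.zero, mul_zero]
    convert! hasSum_zero using 1
    funext s
    rcases s with _ | s
    · simp [shifted_zero_right, h.zero]
    · simp
  set F : ℕ → ℕ → ℝ := fun j s =>
    (K.multichoose j : ℝ) * ((j.choose s : ℝ) * t ^ (j - s) * shifted a t s) with hF
  have hF0 : ∀ j s, 0 ≤ F j s := fun j s => by
    have := hpos s
    simp only [hF]
    positivity
  have hrow : ∀ j, HasSum (F j) ((K.multichoose j : ℝ) * a j) := by
    intro j
    rw [eq_sum_shifted a t j, Finset.mul_sum]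
    refine hasSum_sum_of_ne_finset_zero fun s hs => ?_
    have : j < s := by simpa using hs
    simp [hF, Nat.choose_eq_zero_of_lt this]
  have hall := hasSum_uncurry_of_nonneg hF0 hrow (h.hasSum K)
  rw [← (Equiv.prodComm ℕ ℕ).hasSum_iff] at hall
  refine hall.prod_fiberwise fun s => ?_
  have h2 := (hasSum_multichoose_mul_pow h0 h1 (show 1 ≤ K + s by omega)).mul_left
    ((K.multichoose s : ℝ) * shifted a t s)
  rw [← hasSum_nat_add_iff' s, Finset.sum_eq_zero, sub_zero]
  · convert! h2 using 1
    · funext i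
      simp only [Function.comp_apply, Equiv.prodComm_apply, Prod.swap_prod_mk, hF]
      have h3 : (K.multichoose (s + i) * (s + i).choose s : ℝ) =
          K.multichoose s * (K + s).multichoose i := by
        exact_mod_cast Nat.multichoose_add_mul_choose K s i hK
      rw [add_comm i s, Nat.add_sub_cancel_left]
      linear_combination t ^ i * shifted a t s * h3
    · ring
  · intro j hj
    have : j < s := by simpa using hj
    simp [hF, Nat.choose_eq_zero_of_lt this]

/-- Let φ(x) = 1 / (4 (1 - x)), so that t' = φ(t). Binomial combinations of the equations over K
turn (φ(x) - t')^S into (x - t')^S / q. Since φ(x) - t' = t' (x - t) / (1 - x), the left side has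
nonnegative coefficients in x - t for 0 ≤ t', and positivity passes from t to t'. -/
theorem IsHarmonic.hasSum_shifted' (h : IsHarmonic q a) {t t' : ℝ} (h0 : 0 ≤ t)
    (h1 : t < 1) (ht' : 4 * (1 - t) * t' = 1) (hpos : ∀ s, 0 ≤ shifted a t s) (S : ℕ) :
    HasSum (fun s => (if S ≤ s then (S.multichoose (s - S) : ℝ) else 0) *
      (t' ^ S / (1 - t) ^ s * shifted a t s)) (shifted a t' S / q) := by
  have hne : 1 - t ≠ 0 := by linarith
  have h2 := hasSum_sum (s := Finset.range (S + 1)) fun K _ =>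
    (h.hasSum_shifted h0 h1 hpos K).mul_left ((S.choose K : ℝ) * (-t') ^ (S - K) / 4 ^ K)
  convert! h2 using 1
  · funext s
    rw [← sum_choose_mul_multichoose, Finset.sum_mul]
    refine Finset.sum_congr rfl fun K hK => ?_
    have hK' : K ≤ S := by simpa [Nat.lt_succ_iff] using hK
    obtain ⟨d, rfl⟩ : ∃ d, S = K + d := ⟨S - K, by omega⟩
    have e1 : t' ^ K * (4 ^ K * (1 - t) ^ K) = 1 := by
      rw [← mul_pow, ← mul_pow, mul_comm, ht', one_pow]
    rw [Nat.add_sub_cancel_left, pow_add t', pow_add (1 - t), neg_pow t']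
    have e2 : t' ^ K = 1 / (4 ^ K * (1 - t) ^ K) := by
      rw [eq_div_iff (by positivity)]; exact e1
    rw [e2]
    field_simp
  · rw [shifted, Finset.sum_div]
    refine Finset.sum_congr rfl fun K _ => ?_
    field_simp

/-- The orbit of 0 under x ↦ 1 / (4 (1 - x)) is n / (2 (n + 1)), which tends to the fixed point 1/2.
At 0 the claim is the positivity of a. -/
theorem IsHarmonic.shifted_half_nonneg (h : IsHarmonic q a) (hq : 0 < q) (s : ℕ) :
    0 ≤ shifted a (1 / 2) s := by
  have hn : ∀ n : ℕ, ∀ s, 0 ≤ shifted a (1 / 2 - 1 / 2 * (1 / ((n : ℝ) + 1))) s := by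
    intro n
    induction n with
    | zero =>
      intro s
      have : shifted a (1 / 2 - 1 / 2 * (1 / (((0 : ℕ) : ℝ) + 1))) s = a s := by
        rw [shifted, Finset.sum_range_succ, Finset.sum_eq_zero]
        · simp
        · intro i hi
          have : s - i ≠ 0 := by simp at hi; omega
          simp [this]
      rw [this]
      exact h.nonneg s
    | succ n ih =>
      intro s
      have hlt : 1 / 2 - 1 / 2 * (1 / ((n : ℝ) + 1)) < 1 := by
        have : 0 < 1 / ((n : ℝ) + 1) := by positivity
        linarith
      have hge : 0 ≤ 1 / 2 - 1 / 2 * (1 / ((n : ℝ) + 1)) := by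
        have : 1 / ((n : ℝ) + 1) ≤ 1 := by
          rw [div_le_one (by positivity)]; linarith [show (0 : ℝ) ≤ n by positivity]
        linarith
      have hge' : 0 ≤ 1 / 2 - 1 / 2 * (1 / (((n + 1 : ℕ) : ℝ) + 1)) := by
        have : 1 / (((n + 1 : ℕ) : ℝ) + 1) ≤ 1 := by
          rw [div_le_one (by positivity)]; linarith [show (0 : ℝ) ≤ (n + 1 : ℕ) by positivity]
        linarith
      have h2 := h.hasSum_shifted' hge hlt
        (t' := 1 / 2 - 1 / 2 * (1 / (((n + 1 : ℕ) : ℝ) + 1))) (by push_cast; field_simp; ring) ih s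
      have h3 := h2.nonneg fun j => by
        have h4 := ih j
        have h5 : 0 < 1 - (1 / 2 - 1 / 2 * (1 / ((n : ℝ) + 1))) := by linarith
        refine mul_nonneg ?_ (mul_nonneg (_root_.div_nonneg (pow_nonneg hge' _) (pow_nonneg h5.le _)) h4)
        split_ifs <;> positivity
      have h4 := mul_nonneg h3 hq.le
      rwa [div_mul_cancel₀ _ hq.ne'] at h4
  have hcont : Continuous fun t : ℝ => shifted a t s := by
    unfold shifted
    fun_prop
  have hlim : Tendsto (fun n : ℕ => 1 / 2 - 1 / 2 * (1 / ((n : ℝ) + 1))) atTop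
      (𝓝 (1 / 2 - 1 / 2 * 0)) := (tendsto_one_div_add_atTop_nhds_zero_nat.const_mul _).const_sub _
  rw [mul_zero, sub_zero] at hlim
  exact ge_of_tendsto ((hcont.tendsto _).comp hlim) (Eventually.of_forall fun n => hn n s)

/-- At t = t' = 1/2 the equations, rescaled by n! 2^{n+1}, are those for Poisson steps. Hence `b n`
is 2 μ^n, the constant coming from a 0 = 0 and a 1 = 1, and expanding x^K about 1/2 gives `aCoef`.
-/
theorem IsHarmonic.eq_aCoef {μ : ℝ} (h : IsHarmonic (Real.exp (-μ)) a) : a = aCoef μ := by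
  have hpos := h.shifted_half_nonneg (Real.exp_pos _)
  set b : ℕ → ℝ := fun n => (n.factorial : ℝ) * 2 ^ (n + 1) * shifted a (1 / 2) (n + 1) with hb
  have hb0 : b 0 = 2 := by
    simp [hb, shifted, Finset.sum_range_succ, h.zero, h.one]
  have hgeom := eq_mul_pow_of_hasSum_div_factorial (μ := μ) (b := b)
    (fun n => by have := hpos (n + 1); positivity) (fun n => by
      have h1 := h.hasSum_shifted' (t := 1 / 2) (t' := 1 / 2) (by norm_num) (by norm_num)
        (by norm_num) hpos (n + 1)
      rw [← hasSum_nat_add_iff' (n + 1), Finset.sum_eq_zero, sub_zero] at h1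
      · convert! h1.mul_left ((n.factorial : ℝ) * 2 ^ (n + 1)) using 1
        · funext j
          rw [if_pos (by omega), Nat.add_sub_cancel, Nat.multichoose_eq,
            show n + 1 + j - 1 = n + j by omega, hb]
          have hc : ((n + j).choose j : ℝ) * n.factorial * j.factorial = (n + j).factorial := by
            exact_mod_cast Nat.add_choose_mul_factorial_mul_factorial n j
          have hj : (j.factorial : ℝ) ≠ 0 := by positivity
          simp only
          rw [← hc, show j + (n + 1) = n + j + 1 by ring, show (1 : ℝ) - 1 / 2 = 1 / 2 by norm_num,
            one_div_pow, one_div_pow]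
          field_simp
        · rw [hb, Real.exp_neg]
          simp only
          rw [div_inv_eq_mul]
          ring
      · intro s hs
        have : ¬ (n + 1 ≤ s) := by simpa using hs
        rw [if_neg this, zero_mul])
  funext K
  rw [eq_sum_shifted a (1 / 2) K, Finset.sum_range_succ', shifted_zero_right, h.zero, mul_zero,
    add_zero, aCoef, Finset.mul_sum]
  refine Finset.sum_congr rfl fun j hj => ?_
  have hj' : j + 1 ≤ K := by simpa using hj
  obtain ⟨d, rfl⟩ : ∃ d, K = j + 1 + d := ⟨K - (j + 1), by omega⟩
  have h1 := hgeom j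
  rw [hb0, hb] at h1
  simp only at h1
  have hf : (j.factorial : ℝ) ≠ 0 := by positivity
  have h2 : shifted a (1 / 2) (j + 1) = 2 * μ ^ j / (j.factorial * 2 ^ (j + 1)) := by
    rw [eq_div_iff (by positivity)]
    linarith
  rw [h2, Nat.add_sub_cancel_left, pow_add (1 / 2 : ℝ) (j + 1), one_div_pow, one_div_pow]
  field_simp

/-- The equations need no direct check: a solution exists as a limit along an ultrafilter, and
uniqueness identifies it. -/
theorem _root_.isHarmonic_aCoef {μ : ℝ} (hμ : 0 < μ) :
    IsHarmonic (Real.exp (-μ)) (aCoef μ) := by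
  have hU : ((Ultrafilter.of atTop : Ultrafilter ℕ) : Filter ℕ) ≤ atTop := Ultrafilter.of_le _
  obtain ⟨a, ha, -⟩ := exists_isHarmonic (Real.exp_pos _)
    (Real.exp_lt_one_iff.2 (by linarith : -μ < 0)) (Ultrafilter.of atTop) hU
  rwa [← ha.eq_aCoef]

theorem tendsto_div {μ : ℝ} (hμ : 0 < μ) (K : ℕ) :
    Tendsto (fun N => forestWeight (Real.exp (-μ)) K N / forestWeight (Real.exp (-μ)) 1 N) atTop
      (𝓝 (aCoef μ K)) := by
  rw [tendsto_iff_ultrafilter]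
  intro U hU
  obtain ⟨a, ha, hlim⟩ := exists_isHarmonic (Real.exp_pos _)
    (Real.exp_lt_one_iff.2 (by linarith : -μ < 0)) U hU
  rw [← ha.eq_aCoef]
  exact hlim K

/-- The ratio of the weight of the forests with `K` trees and `N - i` edges to the weight of the
trees with `N` edges. -/
theorem tendsto_sub_div {μ : ℝ} (hμ : 0 < μ) (K i : ℕ) :
    Tendsto (fun N => forestWeight (Real.exp (-μ)) K (N - i) / forestWeight (Real.exp (-μ)) 1 N)
      atTop (𝓝 ((1 / 4) ^ i * aCoef μ K)) := by
  have hq1 := Real.exp_lt_one_iff.2 (by linarith : -μ < 0)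
  rw [← tendsto_add_atTop_iff_nat i]
  have h := ((tendsto_one_add (Real.exp_pos (-μ)) hq1 i).inv₀ (by positivity)).mul (tendsto_div hμ K)
  rw [one_div_pow, one_div]
  refine h.congr' ?_
  filter_upwards [eventually_ge_atTop 1] with N hN
  have p1 := (one_pos (Real.exp_pos (-μ)) hq1 hN).ne'
  rw [Nat.add_sub_cancel]
  field_simp

end forestWeight

/-! ### Trees as lists of trees -/

namespace PlaneTree

/-- The subtree above the `j`-th offspring of the vertex `[]`. -/
def sub (T : PlaneTree) (j : ℕ) : PlaneTree where
  -- Inserting `[]` gives a tree even when j is not an offspring.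
  nodes := insert [] {w | j :: w ∈ T.nodes}
  root_mem := Set.mem_insert _ _
  offspring w := by
    obtain ⟨k, hk⟩ := T.offspring (j :: w)
    by_cases h : j :: w ∈ T.nodes
    · refine ⟨k, fun i => ?_⟩
      have := hk i
      simp only [List.cons_append] at this
      simp [this, h]
    · refine ⟨0, fun i => ?_⟩
      have := hk i
      simp only [List.cons_append] at this
      simp [this, h]

/-- The tree in which the subtrees above the offspring of the vertex `[]` are given by a list. -/
def node (L : List PlaneTree) : PlaneTree where
  nodes := {w | match w with
    | [] => True
    | j :: v => ∃ t, L[j]? = some t ∧ v ∈ t.nodes}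
  root_mem := trivial
  offspring w := by
    rcases w with _ | ⟨i, w⟩
    · refine ⟨L.length, fun j => ?_⟩
      simp only [List.nil_append, Set.mem_ofPred_eq, true_and]
      constructor
      · rintro ⟨t, ht, -⟩
        exact (List.getElem?_eq_some_iff.1 ht).1
      · intro hj
        exact ⟨L[j], List.getElem?_eq_getElem hj, root_mem _⟩
    · rcases h : L[i]? with _ | t
      · exact ⟨0, fun j => by simp [h]⟩
      · obtain ⟨k, hk⟩ := t.offspring w
        exact ⟨k, fun j => by simp [h, hk]⟩

theorem cons_mem_node {L : List PlaneTree} {j : ℕ} {v : List ℕ} :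
    j :: v ∈ (node L).nodes ↔ ∃ t, L[j]? = some t ∧ v ∈ t.nodes := Iff.rfl

theorem numKids_eq {T : PlaneTree} {w : List ℕ} {k : ℕ} (hw : w ∈ T.nodes)
    (h : ∀ j, w ++ [j] ∈ T.nodes ↔ j < k) : T.numKids w = k := by
  have h1 : ∀ j, j < T.numKids w ↔ j < k := fun j => by
    rw [← h, mem_append_singleton_iff]; simp [hw]
  exact le_antisymm (not_lt.1 fun h => lt_irrefl _ ((h1 _).1 h))
    (not_lt.1 fun h => lt_irrefl _ ((h1 _).2 h))

theorem singleton_mem_iff {T : PlaneTree} {j : ℕ} : [j] ∈ T.nodes ↔ j < T.numKids [] := by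
  have := T.mem_append_singleton_iff [] j
  simpa [T.root_mem] using this

theorem singleton_mem_of_cons {T : PlaneTree} {j : ℕ} {w : List ℕ} (h : j :: w ∈ T.nodes) :
    [j] ∈ T.nodes := T.mem_of_append (w := [j]) (v := w) h

/-- The list of the subtrees above the offspring of the vertex `[]`. -/
noncomputable def kids (T : PlaneTree) : List PlaneTree := (List.range (T.numKids [])).map T.sub

theorem numKids_node_nil (L : List PlaneTree) : (node L).numKids [] = L.length := by
  refine numKids_eq (root_mem _) fun j => ?_
  rw [List.nil_append, cons_mem_node]
  constructor
  · rintro ⟨t, ht, -⟩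
    exact (List.getElem?_eq_some_iff.1 ht).1
  · intro hj
    exact ⟨L[j], List.getElem?_eq_getElem hj, root_mem _⟩

theorem length_kids (T : PlaneTree) : (kids T).length = T.numKids [] := by simp [kids]

theorem node_kids (T : PlaneTree) : node (kids T) = T := by
  ext w
  rcases w with _ | ⟨j, w⟩
  · simp [root_mem]
  · rw [cons_mem_node, kids]
    constructor
    · rintro ⟨t, ht, hw⟩
      simp only [List.getElem?_map, Option.map_eq_some_iff] at ht
      obtain ⟨i, hi, rfl⟩ := ht
      obtain ⟨hi1, hi2⟩ := List.getElem?_eq_some_iff.1 hi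
      simp only [List.getElem_range] at hi2
      subst hi2
      rcases hw with rfl | hw
      · rw [singleton_mem_iff]; simpa using hi1
      · exact hw
    · intro hw
      have h1 := singleton_mem_iff.1 (singleton_mem_of_cons hw)
      refine ⟨T.sub j, by simp [h1], Or.inr hw⟩

theorem kids_node (L : List PlaneTree) : kids (node L) = L := by
  apply List.ext_getElem
  · rw [length_kids, numKids_node_nil]
  · intro j h1 h2
    simp only [kids, List.getElem_map, List.getElem_range]
    ext w
    have h3 : L[j]? = some L[j] := List.getElem?_eq_getElem h2
    change w = [] ∨ j :: w ∈ (node L).nodes ↔ _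
    rw [cons_mem_node, h3]
    simp only [Option.some.injEq, exists_eq_left', or_iff_right_iff_imp]
    rintro rfl
    exact root_mem _

/-- A tree is the same as the list of the subtrees above the offspring of the vertex `[]`. -/
noncomputable def nodeEquiv : List PlaneTree ≃ PlaneTree :=
  ⟨node, kids, kids_node, node_kids⟩

theorem node_injective : Function.Injective node := nodeEquiv.injective

theorem cons_mem_iff {T : PlaneTree} {j : ℕ} {v : List ℕ} :
    j :: v ∈ T.nodes ↔ ∃ t, (kids T)[j]? = some t ∧ v ∈ t.nodes := by
  conv_lhs => rw [← node_kids T]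
  exact cons_mem_node

/-! ### Agreement up to a given height -/

/-- The trees `T` and `t` agree up to height `n + 1`. -/
def Agree (n : ℕ) (T t : PlaneTree) : Prop := ball (n + 1) T = ball (n + 1) t

theorem mem_ball_succ {n : ℕ} {T : PlaneTree} {w : List ℕ} :
    w ∈ (ball (n + 1) T).nodes ↔ w ∈ T.nodes ∧ w.length ≤ n := by
  change w ∈ T.nodes ∧ (w = [] ∨ w.length + 1 ≤ n + 1) ↔ _
  rcases w with _ | ⟨j, w⟩ <;> simp

theorem agree_iff {n : ℕ} {T t : PlaneTree} :
    Agree n T t ↔ ∀ w : List ℕ, w.length ≤ n → (w ∈ T.nodes ↔ w ∈ t.nodes) := by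
  rw [Agree, PlaneTree.ext_iff, Set.ext_iff]
  simp only [mem_ball_succ]
  exact forall_congr' fun w => by tauto

theorem Agree.refl (n : ℕ) (T : PlaneTree) : Agree n T T := rfl

theorem Agree.symm {n : ℕ} {T t : PlaneTree} (h : Agree n T t) : Agree n t T := Eq.symm h

theorem Agree.trans {n : ℕ} {T t u : PlaneTree} (h : Agree n T t) (h' : Agree n t u) :
    Agree n T u := Eq.trans h h'

theorem Agree.mono {m n : ℕ} (hmn : m ≤ n) {T t : PlaneTree} (h : Agree n T t) : Agree m T t :=
  agree_iff.2 fun w hw => agree_iff.1 h w (hw.trans hmn)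

theorem agree_zero (T t : PlaneTree) : Agree 0 T t :=
  agree_iff.2 fun w hw => by
    rw [List.eq_nil_of_length_eq_zero (Nat.le_zero.1 hw)]
    simp [root_mem]

theorem eq_of_forall_agree {T t : PlaneTree} (h : ∀ n, Agree n T t) : T = t := by
  ext w
  exact agree_iff.1 (h w.length) w le_rfl

/-- This reduces agreement to a relation between lists of subtrees; the later inductions on the
height rest on it. -/
theorem agree_succ {n : ℕ} {T t : PlaneTree} :
    Agree (n + 1) T t ↔ List.Forall₂ (Agree n) (kids T) (kids t) := by
  constructor
  · intro h
    have hlen : (kids T).length = (kids t).length := by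
      rw [length_kids, length_kids]
      refine numKids_eq (root_mem _) fun j => ?_
      rw [List.nil_append, ← singleton_mem_iff]
      exact agree_iff.1 h [j] (by simp)
    rw [List.forall₂_iff_get]
    refine ⟨hlen, fun i h1 h2 => agree_iff.2 fun w hw => ?_⟩
    have h3 := agree_iff.1 h (i :: w) (by simpa using hw)
    rw [cons_mem_iff, cons_mem_iff, List.getElem?_eq_getElem h1, List.getElem?_eq_getElem h2] at h3
    simpa using h3
  · intro h
    rw [List.forall₂_iff_get] at h
    refine agree_iff.2 fun w hw => ?_
    rcases w with _ | ⟨i, w⟩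
    · simp [root_mem]
    rw [cons_mem_iff, cons_mem_iff]
    by_cases hi : i < (kids T).length
    · have hi' : i < (kids t).length := h.1 ▸ hi
      rw [List.getElem?_eq_getElem hi, List.getElem?_eq_getElem hi']
      have := agree_iff.1 (h.2 i hi hi') w (by simpa using hw)
      simpa using this
    · have hi' : ¬ i < (kids t).length := h.1 ▸ hi
      rw [List.getElem?_eq_none (by omega), List.getElem?_eq_none (by omega)]

theorem ball_agree (n : ℕ) (T : PlaneTree) : Agree n (ball (n + 1) T) T :=
  agree_iff.2 fun w hw => by rw [mem_ball_succ]; simp [hw]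

/-! ### Height, size and levels -/

/-- The height of the tree is at most `m`. -/
def HeightLE (m : ℕ) (T : PlaneTree) : Prop := ∀ w ∈ T.nodes, w.length + 1 ≤ m

theorem heightLE_iff {m : ℕ} {T : PlaneTree} : HeightLE m T ↔ T.height ≤ m := by
  simp only [height, iSup_le_iff, HeightLE]
  exact forall₂_congr fun w _ => by exact_mod_cast Iff.rfl

theorem not_heightLE_zero (T : PlaneTree) : ¬ HeightLE 0 T := fun h => by
  simpa using h [] T.root_mem

theorem heightLE_succ {m : ℕ} {T : PlaneTree} :
    HeightLE (m + 1) T ↔ ∀ t ∈ kids T, HeightLE m t := by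
  constructor
  · intro h t ht w hw
    obtain ⟨j, hj⟩ := List.mem_iff_getElem?.1 ht
    have := h (j :: w) (cons_mem_iff.2 ⟨t, hj, hw⟩)
    simpa using this
  · intro h w hw
    rcases w with _ | ⟨j, w⟩
    · simp
    · obtain ⟨t, ht, hw⟩ := cons_mem_iff.1 hw
      have := h t (List.mem_of_getElem? ht) w hw
      simpa using this

theorem heightLE_mono {m n : ℕ} (hmn : m ≤ n) {T : PlaneTree} (h : HeightLE m T) : HeightLE n T :=
  fun w hw => (h w hw).trans hmn

theorem heightLE_one {T : PlaneTree} : HeightLE 1 T ↔ T = node [] := by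
  rw [heightLE_succ]
  constructor
  · intro h
    rw [← node_kids T]
    congr 1
    rcases hk : kids T with _ | ⟨t, L⟩
    · rfl
    · exact absurd (h t (by simp [hk])) (not_heightLE_zero t)
  · rintro rfl
    simp [kids_node]

theorem ball_heightLE (n : ℕ) (T : PlaneTree) : HeightLE (n + 1) (ball (n + 1) T) :=
  fun _ hw => by have := (mem_ball_succ.1 hw).2; omega

theorem eq_of_agree_of_heightLE {n : ℕ} {T t : PlaneTree} (h : Agree n T t)
    (hT : HeightLE (n + 1) T) (ht : HeightLE (n + 1) t) : T = t := by
  ext w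
  by_cases hw : w.length ≤ n
  · exact agree_iff.1 h w hw
  · exact ⟨fun h => absurd (hT w h) (by omega), fun h => absurd (ht w h) (by omega)⟩

/-- One level more is compared than in `eq_of_agree_of_heightLE`. The absence of vertices just above
t is thus visible, and no bound on the height of T is required. -/
theorem eq_of_agree_of_heightLE' {n : ℕ} {T t : PlaneTree} (h : Agree (n + 1) T t)
    (ht : HeightLE (n + 1) t) : T = t := by
  induction n generalizing T t with
  | zero =>
    rw [heightLE_one] at ht
    subst ht
    rw [agree_succ, kids_node, List.forall₂_nil_right_iff] at h
    rw [← node_kids T, h]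
  | succ n ih =>
    rw [← node_kids T, ← node_kids t]
    rw [agree_succ] at h
    rw [heightLE_succ] at ht
    congr 1
    rw [← List.forall₂_eq_eq_eq]
    rw [List.forall₂_iff_get] at h ⊢
    exact ⟨h.1, fun i h1 h2 => ih (h.2 i h1 h2) (ht _ (List.get_mem _ _))⟩

theorem encard_cons_mem (L : List PlaneTree) :
    {w : List ℕ | ∃ j v, w = j :: v ∧ ∃ t, L[j]? = some t ∧ v ∈ t.nodes}.encard =
      (L.map size).sum := by
  induction L with
  | nil => simp
  | cons t L ih =>
    set S := {w : List ℕ | ∃ j v, w = j :: v ∧ ∃ t, L[j]? = some t ∧ v ∈ t.nodes} with hS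
    set f : List ℕ → List ℕ := fun w => match w with
      | [] => []
      | j :: v => (j + 1) :: v with hf
    have hfinj : Function.Injective f := by
      intro a b hab
      rcases a with _ | ⟨i, a⟩ <;> rcases b with _ | ⟨j, b⟩ <;> simp_all
    have hcinj : Function.Injective fun v : List ℕ => 0 :: v := fun a b h => by simpa using h
    have hunion : {w : List ℕ | ∃ j v, w = j :: v ∧ ∃ t', (t :: L)[j]? = some t' ∧ v ∈ t'.nodes} =
        (fun v => 0 :: v) '' t.nodes ∪ f '' S := by
      ext w
      simp only [Set.mem_ofPred_eq, Set.mem_union, Set.mem_image, hS]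
      constructor
      · rintro ⟨j, v, rfl, t', ht', hv⟩
        rcases j with _ | j
        · simp only [List.getElem?_cons_zero, Option.some.injEq] at ht'
          subst ht'
          exact Or.inl ⟨v, hv, rfl⟩
        · exact Or.inr ⟨j :: v, ⟨j, v, rfl, t', by simpa using ht', hv⟩, rfl⟩
      · rintro (⟨v, hv, rfl⟩ | ⟨_, ⟨j, v, rfl, t', ht', hv⟩, rfl⟩)
        · exact ⟨0, v, rfl, t, by simp, hv⟩
        · exact ⟨j + 1, v, rfl, t', by simpa using ht', hv⟩
    rw [hunion, Set.encard_union_eq, hcinj.encard_image, hfinj.encard_image, ih, List.map_cons,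
      List.sum_cons]
    · rfl
    · rw [Set.disjoint_left]
      rintro _ ⟨v, -, rfl⟩ ⟨_, ⟨j, v', rfl, -⟩, h⟩
      simp [hf] at h

theorem size_node (L : List PlaneTree) : (node L).size = 1 + (L.map size).sum := by
  rw [← encard_cons_mem, size]
  have : (node L).nodes =
      insert [] {w : List ℕ | ∃ j v, w = j :: v ∧ ∃ t, L[j]? = some t ∧ v ∈ t.nodes} := by
    ext w
    rcases w with _ | ⟨j, w⟩
    · simp [root_mem]
    · rw [cons_mem_node]; simp
  rw [this, Set.encard_insert_of_notMem (by simp), add_comm]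

theorem size_eq (T : PlaneTree) : T.size = 1 + ((kids T).map size).sum := by
  rw [← size_node, node_kids]

/-- The number of vertices at height `n + 1`. -/
noncomputable def top : ℕ → PlaneTree → ℕ
  | 0, _ => 1
  | n + 1, T => ((kids T).map (top n)).sum

/-- The number of vertices, other than the root, at height at most `n`. -/
noncomputable def below : ℕ → PlaneTree → ℕ
  | 0, _ => 0
  | n + 1, T => 1 + ((kids T).map (below n)).sum

theorem map_eq_of_forall₂ {α β : Type*} {R : α → α → Prop} {f : α → β} {L L' : List α}
    (h : List.Forall₂ R L L') (hf : ∀ a b, R a b → f a = f b) : L.map f = L'.map f := by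
  induction h with
  | nil => rfl
  | cons h _ ih => rw [List.map_cons, List.map_cons, hf _ _ h, ih]

theorem Agree.top_eq {n : ℕ} {T t : PlaneTree} (h : Agree n T t) : top n T = top n t := by
  induction n generalizing T t with
  | zero => rfl
  | succ n ih =>
    rw [top, top, map_eq_of_forall₂ (agree_succ.1 h) fun a b => ih]

theorem Agree.below_eq {n : ℕ} {T t : PlaneTree} (h : Agree n T t) : below n T = below n t := by
  induction n generalizing T t with
  | zero => rfl
  | succ n ih =>
    rw [below, below, map_eq_of_forall₂ (agree_succ.1 h) fun a b => ih]

theorem below_succ (n : ℕ) (T : PlaneTree) : below (n + 1) T = below n T + top n T := by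
  induction n generalizing T with
  | zero =>
    have : ((kids T).map (below 0)).sum = 0 := by
      refine List.sum_eq_zero fun x hx => ?_
      obtain ⟨t, -, rfl⟩ := List.mem_map.1 hx
      rfl
    change 1 + ((kids T).map (below 0)).sum = 0 + 1
    rw [this]
  | succ n ih =>
    rw [below, below, top, funext ih, List.sum_map_add, add_assoc]

theorem heightLE_of_top_eq_zero {n : ℕ} {T : PlaneTree} (h : top n T = 0) : HeightLE n T := by
  induction n generalizing T with
  | zero => simp [top] at h
  | succ n ih =>
    rw [heightLE_succ]
    intro t ht
    rw [top, List.sum_eq_zero_iff] at h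
    exact ih (h _ (List.mem_map_of_mem ht))

theorem top_eq_zero_of_heightLE {n : ℕ} {T : PlaneTree} (h : HeightLE n T) : top n T = 0 := by
  induction n generalizing T with
  | zero => exact absurd h (not_heightLE_zero T)
  | succ n ih =>
    rw [top, List.sum_eq_zero]
    intro x hx
    obtain ⟨t, ht, rfl⟩ := List.mem_map.1 hx
    exact ih (heightLE_succ.1 h t ht)

theorem size_eq_below {n : ℕ} {T : PlaneTree} (h : HeightLE n T) : T.size = below n T := by
  induction n generalizing T with
  | zero => exact absurd h (not_heightLE_zero T)
  | succ n ih =>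
    rw [size_eq, below]
    push_cast
    congr 1
    rw [heightLE_succ] at h
    rw [List.map_map]
    congr 1
    exact List.map_congr_left fun t ht => ih (h t ht)

theorem finite_iff_exists_heightLE {T : PlaneTree} : T.nodes.Finite ↔ ∃ n, HeightLE n T := by
  constructor
  · intro h
    obtain ⟨n, hn⟩ := (h.image List.length).bddAbove
    exact ⟨n + 1, fun w hw => by have := hn ⟨w, hw, rfl⟩; omega⟩
  · rintro ⟨n, h⟩
    exact finite_of_size (size_eq_below h)

end PlaneTree

/-! ### Generating functions of weighted sets -/

namespace PowerSeries

/-- The generating function `∑ a, W a * X ^ σ a`. -/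
noncomputable def gf {α : Type*} (σ : α → ℕ∞) (W : α → ENNReal) : PowerSeries ENNReal :=
  -- Elements with `σ a = ⊤`, such as infinite trees counted by size, contribute to no coefficient.
  mk fun N => ∑' a, if σ a = (N : ℕ∞) then W a else 0

theorem coeff_gf {α : Type*} (σ : α → ℕ∞) (W : α → ENNReal) (N : ℕ) :
    coeff N (gf σ W) = ∑' a, if σ a = (N : ℕ∞) then W a else 0 := coeff_mk _ _

theorem gf_equiv {α β : Type*} (f : β ≃ α) (σ : α → ℕ∞) (W : α → ENNReal) :
    gf (fun b => σ (f b)) (fun b => W (f b)) = gf σ W := by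
  ext N
  rw [coeff_gf, coeff_gf]
  exact f.tsum_eq fun a => if σ a = (N : ℕ∞) then W a else 0

theorem gf_injective {α β : Type*} {f : β → α} (hf : Function.Injective f) (σ : α → ℕ∞)
    (W : α → ENNReal) (h : ∀ a, W a ≠ 0 → a ∈ Set.range f) :
    gf (fun b => σ (f b)) (fun b => W (f b)) = gf σ W := by
  ext N
  rw [coeff_gf, coeff_gf]
  refine hf.tsum_eq (f := fun a => if σ a = (N : ℕ∞) then W a else 0) fun a ha => h a ?_
  intro h0
  simp [h0] at ha

theorem gf_add {α : Type*} (σ : α → ℕ∞) (W V : α → ENNReal) :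
    gf σ (fun a => W a + V a) = gf σ W + gf σ V := by
  ext N
  rw [map_add, coeff_gf, coeff_gf, coeff_gf, ← ENNReal.tsum_add]
  refine tsum_congr fun a => ?_
  split_ifs <;> simp

theorem gf_const_mul {α : Type*} (z : ENNReal) (σ : α → ℕ∞) (W : α → ENNReal) :
    gf σ (fun a => z * W a) = C z * gf σ W := by
  ext N
  rw [coeff_C_mul, coeff_gf, coeff_gf, ← ENNReal.tsum_mul_left]
  exact tsum_congr fun a => by simp

theorem gf_single {α : Type*} (σ : α → ℕ∞) (W : α → ENNReal) (a₀ : α) (c : ℕ) (hc : σ a₀ = c)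
    (h : ∀ a, a ≠ a₀ → W a = 0) : gf σ W = C (W a₀) * X ^ c := by
  ext N
  rw [coeff_gf, tsum_eq_single a₀ fun a ha => by simp [h a ha], hc, coeff_C_mul, coeff_X_pow]
  by_cases hN : N = c
  · simp [hN]
  · rw [if_neg, if_neg hN, mul_zero]
    exact fun h => hN (by exact_mod_cast h.symm)

theorem gf_prod {α β : Type*} (σ : α → ℕ∞) (τ : β → ℕ∞) (W : α → ENNReal) (V : β → ENNReal) :
    gf (fun p : α × β => σ p.1 + τ p.2) (fun p => W p.1 * V p.2) = gf σ W * gf τ V := by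
  ext N
  rw [coeff_gf, coeff_mul]
  simp only [coeff_gf]
  have key : ∀ p : α × β, (if σ p.1 + τ p.2 = (N : ℕ∞) then W p.1 * V p.2 else 0) =
      ∑ ij ∈ Finset.HasAntidiagonal.antidiagonal N, (if σ p.1 = (ij.1 : ℕ∞) then W p.1 else 0) *
        (if τ p.2 = (ij.2 : ℕ∞) then V p.2 else 0) := by
    rintro ⟨a, b⟩
    simp only
    have h0 : ∀ i : ℕ, (⊤ : ℕ∞) ≠ (i : ℕ∞) := fun i => ENat.top_ne_natCast i
    generalize σ a = s
    generalize τ b = t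
    induction s using ENat.recTopCoe with
    | top => simp [h0]
    | coe s =>
    induction t using ENat.recTopCoe with
    | top => simp [h0]
    | coe t =>
    simp only [← Nat.cast_add, Nat.cast_inj]
    by_cases hst : s + t = N
    · rw [if_pos hst, Finset.sum_eq_single (s, t)]
      · simp
      · rintro ⟨i, j⟩ - hne
        by_cases hi : s = i
        · by_cases hj : t = j
          · exact absurd (by rw [hi, hj]) hne
          · simp [hj]
        · simp [hi]
      · exact fun h => absurd (Finset.HasAntidiagonal.mem_antidiagonal.2 hst) h
    · rw [if_neg hst, Finset.sum_eq_zero]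
      rintro ⟨i, j⟩ hij
      rw [Finset.HasAntidiagonal.mem_antidiagonal] at hij
      simp only at hij
      by_cases hi : s = i
      · have hj : t ≠ j := by omega
        simp [hj]
      · simp [hi]
  simp only [key]
  rw [Summable.tsum_finsetSum fun _ _ => ENNReal.summable]
  refine Finset.sum_congr rfl fun ij _ => ?_
  rw [ENNReal.tsum_prod']
  simp only [ENNReal.tsum_mul_left, ENNReal.tsum_mul_right]

theorem gf_shift {α : Type*} (c : ℕ) (σ : α → ℕ∞) (W : α → ENNReal) :
    gf (fun a => (c : ℕ∞) + σ a) W = X ^ c * gf σ W := by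
  have h := gf_prod (fun _ : Unit => (c : ℕ∞)) σ (fun _ => 1) W
  rw [gf_single (fun _ : Unit => (c : ℕ∞)) (fun _ => 1) () c rfl (by simp)] at h
  rw [map_one, one_mul] at h
  rw [← h, ← gf_equiv (Equiv.punitProd α).symm]
  simp

-- The entries related to those of L₀ are chosen independently of each other, so the generating
-- functions multiply.
open Classical in
theorem gf_forall₂ {α β : Type*} (P : α → β → Prop) (σ : α → ℕ∞) (W : α → ENNReal) (L₀ : List β) :
    gf (fun L : List α => (L.map σ).sum)
        (fun L => if List.Forall₂ P L L₀ then (L.map W).prod else 0) =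
      (L₀.map fun b => gf σ fun a => if P a b then W a else 0).prod := by
  induction L₀ with
  | nil =>
    rw [gf_single _ _ [] 0 (by simp)]
    · simp
    · intro L hL
      simp [hL]
  | cons b L₀ ih =>
    rw [List.map_cons, List.prod_cons, ← ih, ← gf_prod]
    have hinj : Function.Injective fun p : α × List α => p.1 :: p.2 := by
      rintro ⟨a, L⟩ ⟨a', L'⟩ h
      simpa using h
    rw [← gf_injective hinj]
    · congr 1
      · ext p
        simp only [List.forall₂_cons, List.map_cons, List.prod_cons]
        by_cases h1 : P p.1 b <;> by_cases h2 : List.Forall₂ P p.2 L₀ <;> simp [h1, h2]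
    · intro L hL
      rcases L with _ | ⟨a, L⟩
      · simp at hL
      · exact ⟨(a, L), rfl⟩

/-- The coefficients of `f` are those of `f'`, which are nonnegative. -/
def OfReal (f : PowerSeries ENNReal) (f' : PowerSeries ℝ) : Prop :=
  ∀ N, 0 ≤ coeff N f' ∧ coeff N f = ENNReal.ofReal (coeff N f')

theorem OfReal.mul {f g : PowerSeries ENNReal} {f' g' : PowerSeries ℝ} (hf : OfReal f f')
    (hg : OfReal g g') : OfReal (f * g) (f' * g') := fun N => by
  refine ⟨coeff_mul_nonneg (fun N => (hf N).1) (fun N => (hg N).1) N, ?_⟩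
  rw [coeff_mul, coeff_mul, ENNReal.ofReal_sum_of_nonneg fun i _ => mul_nonneg (hf _).1 (hg _).1]
  refine Finset.sum_congr rfl fun i _ => ?_
  rw [ENNReal.ofReal_mul (hf _).1, (hf _).2, (hg _).2]

theorem OfReal.one : OfReal 1 1 := fun N => by
  rw [coeff_one, coeff_one]
  split_ifs <;> simp

theorem OfReal.pow {f : PowerSeries ENNReal} {f' : PowerSeries ℝ} (hf : OfReal f f') (K : ℕ) :
    OfReal (f ^ K) (f' ^ K) := by
  induction K with
  | zero => simpa using OfReal.one
  | succ K ih => simpa only [pow_succ] using ih.mul hf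

theorem mk_one_pow (K : ℕ) :
    (mk fun _ => (1 : ℝ)) ^ K = mk fun j => (K.multichoose j : ℝ) := by
  have h1 := mk_multichoose_mul 1
  have hK := mk_multichoose_mul K
  simp only [Nat.multichoose_one, Nat.cast_one, pow_one] at h1
  have hne : ((1 : PowerSeries ℝ) - X) ^ K ≠ 0 := fun h => by simp [h] at hK
  refine mul_right_cancel₀ hne ?_
  rw [← mul_pow, h1, one_pow, hK]

end PowerSeries

/-! ### Counting the trees that agree with a given tree. -/

namespace PlaneTree

open PowerSeries

open Classical in
/-- The generating function of the trees agreeing with a given tree up to a given height. -/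
theorem gf_agree (c : ℕ) (z : ENNReal) (σ : ℕ → PlaneTree → ℕ∞) (W : ℕ → PlaneTree → ENNReal)
    (hσ : ∀ n T, σ (n + 1) T = c + ((kids T).map (σ n)).sum)
    (hW : ∀ n T, W (n + 1) T = z * ((kids T).map (W n)).prod) (n : ℕ) (t : PlaneTree) :
    gf (σ n) (fun T => if Agree n T t then W n T else 0) =
      C z ^ below n t * X ^ (c * below n t) * gf (σ 0) (W 0) ^ top n t := by
  induction n generalizing t with
  | zero => simp [agree_zero, below, top]
  | succ n ih =>
    rw [← gf_equiv nodeEquiv]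
    have h1 : (fun L => σ (n + 1) (nodeEquiv L)) = fun L => (c : ℕ∞) + (L.map (σ n)).sum := by
      funext L
      rw [hσ]
      congr 3
      exact kids_node L
    have h2 : (fun L => if Agree (n + 1) (nodeEquiv L) t then W (n + 1) (nodeEquiv L) else 0) =
        fun L => z * if List.Forall₂ (Agree n) L (kids t) then (L.map (W n)).prod else 0 := by
      funext L
      have h3 : kids (nodeEquiv L) = L := kids_node L
      rw [hW, h3, mul_ite, mul_zero]
      refine if_congr ?_ rfl rfl
      rw [agree_succ, h3]
    rw [h1, h2, gf_shift, gf_const_mul, gf_forall₂, funext ih, below, top]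
    generalize kids t = L
    induction L with
    | nil => simp [mul_comm]
    | cons b L ihL =>
      simp only [List.map_cons, List.prod_cons, List.sum_cons]
      generalize (L.map fun t => C z ^ below n t * X ^ (c * below n t) *
        gf (σ 0) (W 0) ^ top n t).prod = Y at ihL ⊢
      rw [show X ^ c * (C z * ((C z ^ below n b * X ^ (c * below n b) *
          gf (σ 0) (W 0) ^ top n b) * Y)) =
        (C z ^ below n b * X ^ (c * below n b) * gf (σ 0) (W 0) ^ top n b) *
          (X ^ c * (C z * Y)) by ring, ihL]
      ring

/-- A tree is either the root edge alone, or is determined by its first subtree together with the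
tree that remains when this is removed. -/
theorem gf_cons (σ : PlaneTree → ℕ∞) (W W' : PlaneTree → ENNReal) (c : ℕ)
    (hc : σ (node []) = c) (hσ : ∀ t L, σ (node (t :: L)) = σ t + σ (node L))
    (hW : ∀ t L, W' (node (t :: L)) = W t * W' (node L)) :
    gf σ W' = C (W' (node [])) * X ^ c + gf σ W * gf σ W' := by
  classical
  have hcons : Function.Injective fun p : PlaneTree × PlaneTree => node (p.1 :: kids p.2) := by
    rintro ⟨a, b⟩ ⟨a', b'⟩ h
    have := node_injective h
    rw [List.cons.injEq] at this
    have h2 := congrArg node this.2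
    rw [node_kids, node_kids] at h2
    rw [Prod.mk.injEq]
    exact ⟨this.1, h2⟩
  have hsplit : W' = fun T => (if T = node [] then W' T else 0) +
      if T ≠ node [] then W' T else 0 := by
    funext T
    by_cases hT : T = node [] <;> simp [hT]
  have h1 : gf σ W' = gf σ (fun T => if T = node [] then W' T else 0) +
      gf σ fun T => if T ≠ node [] then W' T else 0 := by
    rw [← gf_add, ← hsplit]
  have h2 := gf_single σ (fun T => if T = node [] then W' T else 0) (node []) c hc
    fun a ha => if_neg ha
  simp only [if_true] at h2
  have h3 : gf σ (fun T => if T ≠ node [] then W' T else 0) = gf σ W * gf σ W' := by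
    rw [← gf_prod, ← gf_injective hcons]
    · congr 1
      · funext p
        rw [hσ, node_kids]
      funext p
      have : node (p.1 :: kids p.2) ≠ node [] := fun h => by simpa using node_injective h
      rw [if_pos this, hW, node_kids]
    · intro T hT
      have hT' : T ≠ node [] := fun h => hT (if_neg (not_not.2 h))
      rcases hk : kids T with _ | ⟨t, L⟩
      · exact absurd (by rw [← hk, node_kids]) hT'
      · exact ⟨(t, node L), by simp only [kids_node]; rw [← hk, node_kids]⟩
  rwa [h2, h3] at h1

-- Both series satisfy g (m + 1) = X + g m * g (m + 1). As the constant coefficients vanish, this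
-- determines the coefficients recursively, which avoids inverses over `ENNReal`.
open Classical in
theorem gf_size_heightLE (m : ℕ) :
    OfReal (gf size fun T => if HeightLE m T then 1 else 0) (heightSeries m) := by
  set g : ℕ → PowerSeries ENNReal := fun m => gf size fun T => if HeightLE m T then 1 else 0
    with hg
  have hrec : ∀ m, g (m + 1) = X + g m * g (m + 1) := by
    intro m
    have h := gf_cons size (fun T => if HeightLE m T then 1 else 0)
      (fun T => if HeightLE (m + 1) T then 1 else 0) 1 (by simp [size_node])
      (fun t L => by rw [size_node, size_node, List.map_cons, List.sum_cons]; ring)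
      (fun t L => by
        rw [heightLE_succ, heightLE_succ, kids_node, kids_node]
        by_cases h1 : HeightLE m t <;> by_cases h2 : ∀ t ∈ L, HeightLE m t <;> simp [h1, h2])
    rw [if_pos (heightLE_mono (by omega) (heightLE_one.2 rfl)), map_one, one_mul, pow_one] at h
    exact h
  have h0 : ∀ m, coeff 0 (g m) = 0 := by
    intro m
    rw [coeff_gf, ENNReal.tsum_eq_zero]
    intro T
    rw [if_neg]
    rw [size_eq]
    simp
  change OfReal (g m) _
  induction m with
  | zero =>
    intro N
    rw [coeff_gf]
    simp [not_heightLE_zero, heightSeries]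
  | succ m ih =>
    intro N
    refine ⟨heightSeries.coeff_nonneg _ _, ?_⟩
    induction N using Nat.strong_induction_on with
    | _ N ihN =>
      rw [hrec, heightSeries.succ_eq, map_add, map_add, ENNReal.ofReal_add, coeff_mul, coeff_mul,
        ENNReal.ofReal_sum_of_nonneg]
      · congr 1
        · rw [coeff_X, coeff_X]
          split_ifs <;> simp
        · refine Finset.sum_congr rfl ?_
          rintro ⟨i, j⟩ hij
          rw [Finset.HasAntidiagonal.mem_antidiagonal] at hij
          simp only at hij ⊢
          rw [ENNReal.ofReal_mul (ih i).1, ← (ih i).2]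
          rcases Nat.eq_zero_or_pos i with rfl | hi
          · rw [h0, zero_mul, zero_mul]
          · rw [ihN j (by omega)]
      · exact fun ij _ => mul_nonneg (ih _).1 (heightSeries.coeff_nonneg _ _)
      · rw [coeff_X]
        split_ifs <;> simp
      · exact coeff_mul_nonneg (fun N => (ih N).1) (heightSeries.coeff_nonneg _) N

open Classical in
theorem heightLE_indicator_succ (m : ℕ) (T : PlaneTree) :
    (if HeightLE (m + 1) T then (1 : ENNReal) else 0) =
      ((kids T).map fun t => if HeightLE m t then (1 : ENNReal) else 0).prod := by
  rw [heightLE_succ]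
  induction kids T with
  | nil => simp
  | cons t L ih =>
    rw [List.map_cons, List.prod_cons, ← ih]
    by_cases h1 : HeightLE m t <;> by_cases h2 : ∀ t ∈ L, HeightLE m t <;> simp [h1, h2]

open Classical in
/-- The number of trees of size `N` and height at most `m + n` that agree with `t`. -/
theorem tsum_size_heightLE_agree (m n N : ℕ) (t : PlaneTree) (hN : below n t ≤ N) :
    (∑' T : PlaneTree, if T.size = N then
      (if Agree n T t then (if HeightLE (m + n) T then (1 : ENNReal) else 0) else 0) else 0) =
      ENNReal.ofReal (coeff (N - below n t) (heightSeries m ^ top n t)) := by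
  -- Each of the `top n t` vertices at the highest level of t carries an arbitrary tree of height at
  -- most m.
  have h := gf_agree 1 1 (fun _ => size) (fun n T => if HeightLE (m + n) T then 1 else 0)
    (fun n T => by rw [size_eq]; rfl) (fun n T => by rw [one_mul]; exact heightLE_indicator_succ (m + n) T) n t
  have h2 := congrArg (coeff N) h
  rw [coeff_gf] at h2
  rw [h2, map_one, one_pow, one_mul, one_mul, coeff_X_pow_mul', if_pos hN]
  exact (((gf_size_heightLE m).pow _) _).2

open Classical in
/-- The number of trees of height at most `n + 2` with `j` vertices at height `n + 2` that agree
with `t`. -/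
theorem tsum_top_agree (n j : ℕ) (t : PlaneTree) :
    (∑' T : PlaneTree, if top (n + 1) T = j then
      (if Agree n T t then (if HeightLE (n + 2) T then (1 : ENNReal) else 0) else 0) else 0) =
      (top n t).multichoose j := by
  -- The statistic counts the vertices one level higher. For n = 0 and height at most 2 there is one
  -- tree for each number of offspring, so the series is 1 / (1 - X).
  have h := gf_agree 0 1 (fun n T => (top (n + 1) T : ℕ∞))
    (fun n T => if HeightLE (n + 2) T then 1 else 0)
    (fun n T => by
      rw [top, Nat.cast_zero, zero_add]
      push_cast
      rw [List.map_map]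
      rfl) (fun n T => by rw [one_mul]; exact heightLE_indicator_succ (n + 2) T) n t
  have h2 := congrArg (coeff j) h
  rw [coeff_gf] at h2
  simp only [Nat.cast_inj] at h2
  rw [h2, map_one, one_pow, zero_mul, pow_zero, one_mul, one_mul]
  have h3 : OfReal (gf (fun T => (top (0 + 1) T : ℕ∞)) fun T => if HeightLE (0 + 2) T then 1 else 0)
      (PowerSeries.mk fun _ => (1 : ℝ)) := by
    intro N
    refine ⟨by simp, ?_⟩
    have htop : ∀ T, top (0 + 1) T = (kids T).length := fun T => by
      simp [top, List.map_const']
    rw [coeff_gf, coeff_mk, ENNReal.ofReal_one,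
      tsum_eq_single (node (List.replicate N (node [])))]
    · rw [if_pos, if_pos]
      · rw [show 0 + 2 = 1 + 1 from rfl, heightLE_succ, kids_node]
        intro u hu
        rw [List.eq_of_mem_replicate hu, heightLE_one]
      · rw [htop, kids_node, List.length_replicate]
    · intro T hT
      rw [htop]
      by_contra hne
      have h4 : (kids T).length = N := by
        by_contra h5
        rw [if_neg (by exact_mod_cast h5)] at hne
        exact hne rfl
      have h5 : HeightLE (1 + 1) T := by
        by_contra h6
        rw [if_neg (c := HeightLE (0 + 2) T) h6] at hne
        simp at hne
      refine hT ?_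
      rw [← node_kids T]
      congr 1
      rw [List.eq_replicate_iff]
      exact ⟨h4, fun u hu => heightLE_one.1 (heightLE_succ.1 h5 u hu)⟩
  rw [((h3.pow _) j).2, mk_one_pow, coeff_mk, ENNReal.ofReal_natCast]

end PlaneTree

/-! ### The topology of the space of trees -/

namespace PlaneTree

/-- Trees that differ up to height n + 1 agree at best up to height n, which keeps their distance at
least 1 / n. For n = 0 agreement is automatic. -/
theorem dist_le_iff {n : ℕ} {T t : PlaneTree} :
    dist T t ≤ 1 / ((n : ℝ) + 1) ↔ Agree n T t := by
  have hbdd : BddBelow (agreeSet T t) := ⟨0, fun a => agreeSet_nonneg⟩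
  constructor
  · intro h
    by_contra hne
    have hlt : dist T t < 1 / (n : ℝ) ∨ n = 0 := by
      rcases Nat.eq_zero_or_pos n with h0 | h0
      · exact Or.inr h0
      · refine Or.inl (h.trans_lt ?_)
        have : (0 : ℝ) < n := by exact_mod_cast h0
        exact one_div_lt_one_div_of_lt this (by linarith)
    rcases hlt with hlt | rfl
    · have hle : ∀ a ∈ agreeSet T t, 1 / (n : ℝ) ≤ a := by
        rintro _ ⟨s, hs, hs', rfl⟩
        have hsn : s ≤ n := by
          by_contra hc
          exact hne (ball_congr_of_le (by omega : n + 1 ≤ s) hs')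
        have hs0 : (0 : ℝ) < s := by exact_mod_cast hs
        exact one_div_le_one_div_of_le hs0 (by exact_mod_cast hsn)
      exact absurd (le_csInf (agreeSet_nonempty T t) hle) (not_le.2 hlt)
    · exact hne (agree_zero T t)
  · intro h
    exact csInf_le hbdd ⟨n + 1, by omega, h, by push_cast; rfl⟩

theorem closedBall_eq (n : ℕ) (t : PlaneTree) :
    Metric.closedBall t (1 / ((n : ℝ) + 1)) = {T | Agree n T t} := by
  ext T
  exact dist_le_iff

instance : IsUltrametricDist PlaneTree := by
  refine ⟨fun x y z => ?_⟩
  by_contra! hlt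
  obtain ⟨h1, h2⟩ := max_lt_iff.1 hlt
  obtain ⟨_, ⟨r, hr, hxy, rfl⟩, h3⟩ := exists_lt_of_csInf_lt (agreeSet_nonempty x y) h1
  obtain ⟨_, ⟨s, hs, hyz, rfl⟩, h4⟩ := exists_lt_of_csInf_lt (agreeSet_nonempty y z) h2
  have hle : dist x z ≤ 1 / ((min r s : ℕ) : ℝ) :=
    csInf_le ⟨0, fun a => agreeSet_nonneg⟩ ⟨min r s, by omega,
      (ball_congr_of_le (min_le_left _ _) hxy).trans (ball_congr_of_le (min_le_right _ _) hyz), rfl⟩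
  rcases min_choice r s with h | h <;> rw [h] at hle <;> linarith

instance : Countable FinTree := by
  have hinj : Function.Injective fun T : FinTree => T.2.toFinset := by
    intro T T' h
    apply Subtype.ext
    ext w
    have := Finset.ext_iff.1 h w
    simpa using this
  exact hinj.countable

theorem finite_of_heightLE {n : ℕ} {T : PlaneTree} (h : HeightLE n T) : T.nodes.Finite :=
  finite_iff_exists_heightLE.2 ⟨n, h⟩

instance (n : ℕ) : Countable {t : PlaneTree // HeightLE n t} := by
  have hinj : Function.Injective fun t : {t : PlaneTree // HeightLE n t} =>
      (⟨t.1, finite_of_heightLE t.2⟩ : FinTree) := by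
    intro t t' h
    exact Subtype.ext (congrArg (fun T : FinTree => T.1) h)
  exact hinj.countable

theorem denseRange_finTree : DenseRange (Subtype.val : FinTree → PlaneTree) := by
  refine Metric.denseRange_iff.2 fun T ε hε => ?_
  obtain ⟨n, hn⟩ := exists_nat_one_div_lt hε
  refine ⟨⟨ball (n + 1) T, finite_of_heightLE (ball_heightLE n T)⟩, ?_⟩
  exact (dist_le_iff.2 (ball_agree n T).symm).trans_lt hn

instance : SecondCountableTopology PlaneTree := by
  have : TopologicalSpace.SeparableSpace PlaneTree :=
    ⟨⟨_, Set.countable_range _, denseRange_finTree⟩⟩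
  exact UniformSpace.secondCountable_of_separable PlaneTree

/-- A word w belongs to the limit if it belongs to the tree at an index beyond which nothing changes
up to height `w.length + 1`. Completeness serves the compactness criterion and makes the space
Polish, as needed for `measurableEmbedding_graftAll`. -/
instance : CompleteSpace PlaneTree := by
  refine Metric.complete_of_cauchySeq_tendsto fun u hu => ?_
  have hN : ∀ n : ℕ, ∃ N, ∀ k ≥ N, Agree n (u k) (u N) := by
    intro n
    obtain ⟨N, hN⟩ := Metric.cauchySeq_iff'.1 hu (1 / ((n : ℝ) + 1)) (by positivity)
    exact ⟨N, fun k hk => dist_le_iff.1 (hN k hk).le⟩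
  choose N hN using hN
  have hcomp : ∀ n m, n ≤ m → Agree n (u (N m)) (u (N n)) := by
    intro n m hnm
    have h1 := (hN m (max (N m) (N n)) (le_max_left _ _)).mono hnm
    have h2 := hN n (max (N m) (N n)) (le_max_right _ _)
    exact h1.symm.trans h2
  let T : PlaneTree :=
    { nodes := {w | w ∈ (u (N w.length)).nodes}
      root_mem := root_mem _
      offspring := fun w => by
        obtain ⟨k, hk⟩ := (u (N (w.length + 1))).offspring w
        refine ⟨k, fun j => ?_⟩
        have h1 := agree_iff.1 (hcomp w.length (w.length + 1) (by omega)) w le_rfl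
        have h2 := hk j
        simp only [Set.mem_ofPred_eq, List.length_append, List.length_singleton]
        rw [h2, h1] }
  have hT : ∀ n, Agree n T (u (N n)) := by
    intro n
    refine agree_iff.2 fun w hw => ?_
    exact (agree_iff.1 (hcomp w.length n hw) w le_rfl).symm
  refine ⟨T, Metric.tendsto_atTop.2 fun ε hε => ?_⟩
  obtain ⟨n, hn⟩ := exists_nat_one_div_lt hε
  refine ⟨N n, fun k hk => (dist_le_iff.2 ?_).trans_lt hn⟩
  exact (hN n k hk).trans (hT n).symm

theorem isClopen_agree (n : ℕ) (t : PlaneTree) : IsClopen {T | Agree n T t} := by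
  rw [← closedBall_eq]
  exact IsUltrametricDist.isClopen_closedBall t (by positivity)

theorem measurableSet_agree (n : ℕ) (t : PlaneTree) : MeasurableSet {T | Agree n T t} :=
  (isClopen_agree n t).isOpen.measurableSet

/-- A set is compact if it is closed and has finitely many balls of each radius. -/
theorem isCompact_of_finite {K : Set PlaneTree} (hK : IsClosed K)
    (h : ∀ n, ∃ F : Set PlaneTree, F.Finite ∧ ∀ T ∈ K, ∃ t ∈ F, Agree n T t) : IsCompact K := by
  refine TotallyBounded.isCompact_of_isClosed (Metric.totallyBounded_iff.2 fun ε hε => ?_) hK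
  obtain ⟨n, hn⟩ := exists_nat_one_div_lt hε
  obtain ⟨F, hF, hKF⟩ := h n
  refine ⟨F, hF, fun T hT => ?_⟩
  obtain ⟨t, ht, hTt⟩ := hKF T hT
  simp only [Set.mem_iUnion]
  exact ⟨t, ht, (dist_le_iff.2 hTt).trans_lt hn⟩

end PlaneTree

/-! ### Measures on ultrametric spaces -/

theorem exists_closedBall_subset {X : Type*} [PseudoMetricSpace X] (k₀ : ℕ) {U : Set X}
    (hU : IsOpen U) {x : X} (hx : x ∈ U) :
    ∃ k ≥ k₀, Metric.closedBall x (1 / ((k : ℝ) + 1)) ⊆ U := by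
  obtain ⟨ε, hε, hxU⟩ := Metric.isOpen_iff.1 hU x hx
  obtain ⟨n, hn⟩ := exists_nat_one_div_lt hε
  refine ⟨max n k₀, le_max_right _ _, fun y hy => hxU ?_⟩
  rw [Metric.mem_ball]
  refine (Metric.mem_closedBall.1 hy).trans_lt (lt_of_le_of_lt ?_ hn)
  gcongr
  exact le_max_left n k₀

/-- Ultrametric balls that meet are nested. The bound k₀ permits tests on small radii only. -/
theorem isPiSystem_closedBall {X : Type*} [PseudoMetricSpace X] [IsUltrametricDist X] (k₀ : ℕ) :
    IsPiSystem {s : Set X | ∃ k ≥ k₀, ∃ x, s = Metric.closedBall x (1 / ((k : ℝ) + 1))} := by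
  rintro _ ⟨k, hk, x, rfl⟩ _ ⟨l, hl, y, rfl⟩ ⟨z, hz⟩
  rw [IsUltrametricDist.closedBall_eq_of_mem hz.1, IsUltrametricDist.closedBall_eq_of_mem hz.2]
  rcases le_total k l with h | h
  · refine ⟨l, hl, z, ?_⟩
    rw [Set.inter_eq_right]
    exact Metric.closedBall_subset_closedBall (by gcongr)
  · refine ⟨k, hk, z, ?_⟩
    rw [Set.inter_eq_left]
    exact Metric.closedBall_subset_closedBall (by gcongr)

theorem isTopologicalBasis_closedBall {X : Type*} [PseudoMetricSpace X] [IsUltrametricDist X]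
    (k₀ : ℕ) : TopologicalSpace.IsTopologicalBasis
      {s : Set X | ∃ k ≥ k₀, ∃ x, s = Metric.closedBall x (1 / ((k : ℝ) + 1))} := by
  refine TopologicalSpace.isTopologicalBasis_of_isOpen_of_nhds ?_ ?_
  · rintro _ ⟨k, -, x, rfl⟩
    exact (IsUltrametricDist.isClopen_closedBall x (by positivity)).isOpen
  · intro x U hx hU
    obtain ⟨k, hk, hkU⟩ := exists_closedBall_subset k₀ hU hx
    exact ⟨_, ⟨k, hk, x, rfl⟩, Metric.mem_closedBall_self (by positivity), hkU⟩

theorem exists_countable_closedBall {X : Type*} [PseudoMetricSpace X] [IsUltrametricDist X]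
    [SecondCountableTopology X] (k : ℕ) : ∃ S : Set X, S.Countable ∧
      ⋃ x ∈ S, Metric.closedBall x (1 / ((k : ℝ) + 1)) = Set.univ := by
  obtain ⟨S, hS, hd⟩ := TopologicalSpace.exists_countable_dense X
  refine ⟨S, hS, Set.eq_univ_of_forall fun y => ?_⟩
  obtain ⟨x, hx, hxy⟩ := hd.exists_dist_lt y (show (0 : ℝ) < 1 / ((k : ℝ) + 1) by positivity)
  simp only [Set.mem_iUnion]
  exact ⟨x, hx, hxy.le⟩

theorem generateFrom_closedBall {X : Type*} [PseudoMetricSpace X] [IsUltrametricDist X]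
    [SecondCountableTopology X] [MeasurableSpace X] [BorelSpace X] (k₀ : ℕ) :
    ‹MeasurableSpace X› = MeasurableSpace.generateFrom
      {s : Set X | ∃ k ≥ k₀, ∃ x, s = Metric.closedBall x (1 / ((k : ℝ) + 1))} := by
  rw [BorelSpace.measurable_eq (α := X)]
  exact (isTopologicalBasis_closedBall k₀).borel_eq_generateFrom

/-- Finite measures on an ultrametric space that agree on all small closed balls are equal. -/
theorem Measure.ext_of_closedBall {X : Type*} [PseudoMetricSpace X] [IsUltrametricDist X]
    [SecondCountableTopology X] [MeasurableSpace X] [BorelSpace X] {μ ν : Measure X}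
    [IsFiniteMeasure μ] (k₀ : ℕ)
    (h : ∀ k ≥ k₀, ∀ x, μ (Metric.closedBall x (1 / ((k : ℝ) + 1))) =
      ν (Metric.closedBall x (1 / ((k : ℝ) + 1)))) : μ = ν := by
  obtain ⟨S, hS, hcover⟩ := exists_countable_closedBall (X := X) k₀
  refine Measure.ext_of_generateFrom_of_cover_subset (generateFrom_closedBall k₀)
    (isPiSystem_closedBall k₀)
    (T := (fun x => Metric.closedBall x (1 / ((k₀ : ℝ) + 1))) '' S) ?_ (hS.image _) ?_ ?_ ?_
  · rintro _ ⟨x, -, rfl⟩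
    exact ⟨k₀, le_rfl, x, rfl⟩
  · rw [Set.sUnion_image]
    exact hcover
  · intro s _
    exact measure_ne_top μ s
  · rintro _ ⟨k, hk, x, rfl⟩
    exact h k hk x

/-! ### The probability of a ball -/

namespace PlaneTree

open PowerSeries

/-- The limiting probability that a large tree agrees with `t` up to height `n + 1`. -/
noncomputable def localProb (μ : ℝ) (n : ℕ) (t : PlaneTree) : ℝ :=
  Real.exp (-μ) ^ n * ((1 / 4) ^ below n t * aCoef μ (top n t))

theorem heightLE_iff_toNat {m : ℕ} {T : PlaneTree} (hT : T.nodes.Finite) :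
    HeightLE m T ↔ T.height.toNat ≤ m := by
  obtain ⟨n, hn⟩ := finite_iff_exists_heightLE.1 hT
  rw [heightLE_iff] at hn ⊢
  have hne : T.height ≠ ⊤ := ne_top_of_le_ne_top (ENat.natCast_ne_top n) hn
  rw [← ENat.natCast_toNat hne, ENat.toNat_natCast, Nat.cast_le]

open Classical in
theorem tsum_geometric_ge (Q : ENNReal) (h : ℕ) :
    ∑' m, (if h ≤ m then Q ^ m else 0) = Q ^ h * (1 - Q)⁻¹ := by
  rw [← (add_left_injective h).tsum_eq]
  · simp only [Nat.le_add_left, if_true, pow_add]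
    rw [ENNReal.tsum_mul_right, ENNReal.tsum_geometric, mul_comm]
  · intro m hm
    have : h ≤ m := by
      by_contra hc
      simp [hc] at hm
    exact ⟨m - h, Nat.sub_add_cancel this⟩

-- Writing q^h as (1 - q) ∑_{m ≥ h} q^m trades the height for bounds on the height, which the
-- generating functions can handle. The sum may be shifted by n because the tree is higher than n.
open Classical in
theorem ofReal_weight {μ : ℝ} (hμ : 0 < μ) {n : ℕ} {T : PlaneTree} (hT : T.nodes.Finite)
    (hn : ¬ HeightLE n T) : ENNReal.ofReal (weight μ T) =
      ENNReal.ofReal (Real.exp (-μ)) ^ n * (1 - ENNReal.ofReal (Real.exp (-μ))) *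
        ∑' m, ENNReal.ofReal (Real.exp (-μ)) ^ m * if HeightLE (m + n) T then 1 else 0 := by
  set Q := ENNReal.ofReal (Real.exp (-μ)) with hQ
  have hQ1 : Q < 1 := by
    rw [hQ, ENNReal.ofReal_lt_one]
    exact Real.exp_lt_one_iff.2 (by linarith)
  rw [heightLE_iff_toNat hT, not_le] at hn
  obtain ⟨h, hh⟩ : ∃ h, T.height.toNat = h + n := ⟨_, (Nat.sub_add_cancel hn.le).symm⟩
  have h1 : ∀ m, (Q ^ m * if HeightLE (m + n) T then 1 else 0) = if h ≤ m then Q ^ m else 0 := by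
    intro m
    rw [heightLE_iff_toNat hT, hh, add_le_add_iff_right]
    split_ifs <;> simp
  have h2 : 1 - Q ≠ 0 := (tsub_pos_of_lt hQ1).ne'
  rw [tsum_congr h1, tsum_geometric_ge, weight, hh]
  rw [show Q ^ n * (1 - Q) * (Q ^ h * (1 - Q)⁻¹) = Q ^ (h + n) * ((1 - Q) * (1 - Q)⁻¹) by ring,
    ENNReal.mul_inv_cancel h2 (ENNReal.sub_ne_top ENNReal.one_ne_top), mul_one, hQ,
    ← ENNReal.ofReal_pow (Real.exp_pos _).le, ← Real.exp_nat_mul]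
  congr 2
  ring

open Classical in
theorem sum_ofSize (N : ℕ) (f : PlaneTree → ENNReal) :
    ∑ T : OfSize N, f T.1 = ∑' T : PlaneTree, if T.size = N then f T else 0 := by
  rw [← tsum_fintype (L := .unconditional _)]
  refine (tsum_subtype {T : PlaneTree | T.size = N} f).trans (tsum_congr fun T => ?_)
  rw [Set.indicator_apply]
  rfl

-- A tree agreeing with t is t with a forest of `top n t` trees on its highest level, and its height
-- is n more than that of the forest. If `top n t = 0`, every agreeing tree has only `below n t`
-- edges, fewer than N.
open Classical in
theorem sum_weight_agree {μ : ℝ} (hμ : 0 < μ) (n : ℕ) (t : PlaneTree) {N : ℕ}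
    (hN : below n t < N) :
    ∑ T : OfSize N, (if Agree n T.1 t then ENNReal.ofReal (weight μ T.1) else 0) =
      ENNReal.ofReal (Real.exp (-μ) ^ n *
        forestWeight (Real.exp (-μ)) (top n t) (N - below n t)) := by
  have hq1 : Real.exp (-μ) < 1 := Real.exp_lt_one_iff.2 (by linarith)
  have hq0 := Real.exp_pos (-μ)
  rcases Nat.eq_zero_or_pos (top n t) with h0 | h0
  · rw [h0, forestWeight.zero_left (by omega), mul_zero, ENNReal.ofReal_zero]
    refine Finset.sum_eq_zero fun T _ => if_neg fun hT => ?_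
    have h1 := hT.top_eq.trans h0
    have h2 := size_eq_below (heightLE_of_top_eq_zero h1)
    rw [T.2, hT.below_eq, Nat.cast_inj] at h2
    omega
  · set Q := ENNReal.ofReal (Real.exp (-μ)) with hQ
    have h1 : ∀ T : OfSize N, (if Agree n T.1 t then ENNReal.ofReal (weight μ T.1) else 0) =
        Q ^ n * (1 - Q) * ∑' m, Q ^ m *
          (if Agree n T.1 t then (if HeightLE (m + n) T.1 then 1 else 0) else 0) := by
      intro T
      by_cases hT : Agree n T.1 t
      · simp only [hT, if_true]
        refine ofReal_weight hμ (finite_of_size T.2) fun h => ?_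
        have := top_eq_zero_of_heightLE h
        rw [hT.top_eq] at this
        omega
      · simp [hT]
    rw [Finset.sum_congr rfl fun T _ => h1 T, ← Finset.mul_sum,
      ← Summable.tsum_finsetSum fun _ _ => ENNReal.summable]
    simp only [← Finset.mul_sum]
    have h2 : ∀ m, ∑ T : OfSize N, (if Agree n T.1 t then
        (if HeightLE (m + n) T.1 then (1 : ENNReal) else 0) else 0) =
        ENNReal.ofReal (coeff (N - below n t) (heightSeries m ^ top n t)) := by
      intro m
      rw [sum_ofSize N fun T => if Agree n T t then (if HeightLE (m + n) T then 1 else 0) else 0]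
      exact tsum_size_heightLE_agree m n N t hN.le
    simp only [h2]
    rw [forestWeight, ENNReal.ofReal_mul (by positivity), ENNReal.ofReal_mul (by linarith),
      ENNReal.ofReal_pow hq0.le, ← hQ, ENNReal.ofReal_sub _ hq0.le, ENNReal.ofReal_one, ← hQ,
      mul_assoc, ENNReal.ofReal_tsum_of_nonneg _ (forestWeight.summable hq0 hq1 _ _)]
    · congr 3
      ext m
      rw [ENNReal.ofReal_mul (by positivity), ENNReal.ofReal_pow hq0.le]
    · exact fun m => mul_nonneg (by positivity) (heightSeries.coeff_pow_nonneg _ _ _)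

theorem partitionFunction_eq {μ : ℝ} (hμ : 0 < μ) {N : ℕ} (hN : 0 < N) :
    partitionFunction μ N = forestWeight (Real.exp (-μ)) 1 N := by
  have h := sum_weight_agree hμ 0 (star 0) (N := N) hN
  simp only [agree_zero, if_true, pow_zero, one_mul, below, top, Nat.sub_zero] at h
  rw [← ENNReal.ofReal_sum_of_nonneg (f := fun T : OfSize N => weight μ T.1)
    fun T _ => (Real.exp_pos _).le] at h
  rw [ENNReal.ofReal_eq_ofReal_iff] at h
  · exact h
  · exact Finset.sum_nonneg fun T _ => (Real.exp_pos _).le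
  · exact forestWeight.nonneg (Real.exp_pos _) (Real.exp_lt_one_iff.2 (by linarith)) _ _

theorem finiteSizeMeasure_agree {μ : ℝ} (hμ : 0 < μ) (n : ℕ) (t : PlaneTree) {N : ℕ}
    (hN : below n t < N) : finiteSizeMeasure μ N {T | Agree n T t} =
      ENNReal.ofReal (Real.exp (-μ) ^ n *
        (forestWeight (Real.exp (-μ)) (top n t) (N - below n t) /
          forestWeight (Real.exp (-μ)) 1 N)) := by
  classical
  have hpos := forestWeight.one_pos (Real.exp_pos _)
    (Real.exp_lt_one_iff.2 (by linarith : -μ < 0)) (by omega : 1 ≤ N)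
  rw [← mul_div_assoc, ENNReal.ofReal_div_of_pos hpos, ← sum_weight_agree hμ n t hN,
    finiteSizeMeasure, partitionFunction_eq hμ (by omega), Measure.coe_finsetSum,
    Finset.sum_apply, div_eq_mul_inv, Finset.sum_mul]
  refine Finset.sum_congr rfl fun T _ => ?_
  rw [Measure.smul_apply, Measure.dirac_apply' _ (measurableSet_agree n t), smul_eq_mul,
    ENNReal.ofReal_div_of_pos hpos, Set.indicator_apply]
  simp only [Set.mem_ofPred_eq, Pi.one_apply]
  split_ifs <;> simp [div_eq_mul_inv]

theorem tendsto_nuSeq_agree {μ : ℝ} (hμ : 0 < μ) (n : ℕ) (t : PlaneTree) :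
    Tendsto (fun k => (nuSeq μ k : Measure PlaneTree) {T | Agree n T t}) atTop
      (𝓝 (ENNReal.ofReal (localProb μ n t))) := by
  have h1 := (forestWeight.tendsto_sub_div hμ (top n t) (below n t)).const_mul
    (Real.exp (-μ) ^ n)
  have h2 := (ENNReal.continuous_ofReal.tendsto _).comp ((tendsto_add_atTop_iff_nat 1).2 h1)
  refine h2.congr' ?_
  filter_upwards [eventually_ge_atTop (below n t)] with k hk
  exact (finiteSizeMeasure_agree hμ n t (by omega)).symm

/-! ### Consistency of the limiting probabilities -/

-- Sort the extensions of t by one level according to the number j of new vertices;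
-- `IsHarmonic.hasSum` is then exactly the consistency of the local probabilities.
open Classical in
theorem tsum_localProb_extend {μ : ℝ} (hμ : 0 < μ) (n : ℕ) (t : PlaneTree) :
    (∑' T : PlaneTree, if Agree n T t then
      (if HeightLE (n + 2) T then ENNReal.ofReal (localProb μ (n + 1) T) else 0) else 0) =
      ENNReal.ofReal (localProb μ n t) := by
  have hh := isHarmonic_aCoef hμ
  have hq0 := Real.exp_pos (-μ)
  set c : ENNReal := ENNReal.ofReal (Real.exp (-μ) ^ (n + 1) * (1 / 4) ^ (below n t + top n t))
    with hc
  have h1 : ∀ T : PlaneTree, (if Agree n T t then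
      (if HeightLE (n + 2) T then ENNReal.ofReal (localProb μ (n + 1) T) else 0) else 0) =
      ∑' j, c * ((if top (n + 1) T = j then
        (if Agree n T t then (if HeightLE (n + 2) T then (1 : ENNReal) else 0) else 0) else 0) *
          ENNReal.ofReal (aCoef μ j)) := by
    intro T
    rw [ENNReal.tsum_mul_left, tsum_eq_single (top (n + 1) T) fun j hj => by simp [hj.symm]]
    by_cases hT : Agree n T t <;> by_cases hT2 : HeightLE (n + 2) T <;> simp [hT, hT2]
    rw [localProb, below_succ, hT.below_eq, hT.top_eq, ← mul_assoc,
      ENNReal.ofReal_mul (by positivity), hc]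
  rw [tsum_congr h1, ENNReal.tsum_comm]
  simp only [ENNReal.tsum_mul_left, ENNReal.tsum_mul_right, tsum_top_agree]
  have h2 := hh.hasSum (top n t)
  have h3 : ∑' j, ((top n t).multichoose j : ENNReal) * ENNReal.ofReal (aCoef μ j) =
      ENNReal.ofReal (4 ^ top n t / Real.exp (-μ) * aCoef μ (top n t)) := by
    rw [← h2.tsum_eq, ENNReal.ofReal_tsum_of_nonneg
      (fun j => mul_nonneg (Nat.cast_nonneg _) (hh.nonneg j)) h2.summable]
    refine tsum_congr fun j => ?_
    rw [ENNReal.ofReal_mul (Nat.cast_nonneg _), ENNReal.ofReal_natCast]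
  rw [h3, hc, ← ENNReal.ofReal_mul (by positivity), localProb]
  congr 1
  rw [pow_succ, pow_add, one_div_pow, one_div_pow]
  field_simp

-- No mass is lost in the limit; this is the input for tightness.
open Classical in
theorem tsum_localProb {μ : ℝ} (hμ : 0 < μ) (n : ℕ) :
    (∑' T : PlaneTree, if HeightLE (n + 1) T then ENNReal.ofReal (localProb μ n T) else 0) = 1 := by
  induction n with
  | zero =>
    rw [tsum_eq_single (node []) fun T hT => if_neg fun h => hT (heightLE_one.1 h),
      if_pos (heightLE_one.2 rfl), localProb, below, top, (isHarmonic_aCoef hμ).one]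
    simp
  | succ n ih =>
    have h1 : ∀ T : PlaneTree,
        (if HeightLE (n + 2) T then ENNReal.ofReal (localProb μ (n + 1) T) else 0) =
        ∑' t, if HeightLE (n + 1) t then (if Agree n T t then
          (if HeightLE (n + 2) T then ENNReal.ofReal (localProb μ (n + 1) T) else 0) else 0)
          else 0 := by
      intro T
      rw [tsum_eq_single (ball (n + 1) T), if_pos (ball_heightLE n T),
        if_pos (ball_agree n T).symm]
      intro t ht
      by_cases h1 : HeightLE (n + 1) t
      · rw [if_pos h1, if_neg]
        intro h2
        exact ht (eq_of_agree_of_heightLE (h2.symm.trans (ball_agree n T).symm) h1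
          (ball_heightLE n T))
      · rw [if_neg h1]
    rw [tsum_congr h1, ENNReal.tsum_comm, ← ih]
    refine tsum_congr fun t => ?_
    split_ifs
    · exact tsum_localProb_extend hμ n t
    · exact tsum_zero

end PlaneTree

/-! ### The local limit -/

namespace PlaneTree

/-- For each n finitely many truncated trees carry almost all of the limiting mass, hence of the
mass for all large N, and finitely many more take care of the other N. The trees that comply with
such a choice for every n form a compact set. -/
theorem isTightMeasureSet_nuSeq {μ : ℝ} (hμ : 0 < μ) :
    IsTightMeasureSet {(π : Measure PlaneTree) | π ∈ Set.range (nuSeq μ)} := by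
  classical
  have finite_compl : ∀ (π : Measure PlaneTree) [IsProbabilityMeasure π] (n : ℕ) (ε : ENNReal),
      0 < ε → ∃ F : Finset {t : PlaneTree // HeightLE (n + 1) t},
        1 - ε < ∑ t ∈ F, π {T | Agree n T t.1} := by
    intro π _ n ε hε
    have h1 : ∑' t : {t : PlaneTree // HeightLE (n + 1) t}, π {T | Agree n T t.1} = 1 := by
      rw [← measure_iUnion]
      · rw [← measure_univ (μ := π)]
        congr 1
        refine Set.eq_univ_of_forall fun T => Set.mem_iUnion.2 ?_
        exact ⟨⟨ball (n + 1) T, ball_heightLE n T⟩, (ball_agree n T).symm⟩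
      · intro t t' hne
        refine Set.disjoint_left.2 fun T hT hT' => hne (Subtype.ext ?_)
        exact eq_of_agree_of_heightLE (hT.symm.trans hT') t.2 t'.2
      · exact fun t => measurableSet_agree n t.1
    have h2 := ENNReal.summable.hasSum (f := fun t : {t : PlaneTree // HeightLE (n + 1) t} =>
      π {T | Agree n T t.1})
    rw [h1] at h2
    have h3 : (1 : ENNReal) - ε < 1 := ENNReal.sub_lt_self ENNReal.one_ne_top one_ne_zero hε.ne'
    exact (h2.eventually (lt_mem_nhds h3)).exists
  have key : ∀ (n : ℕ) (ε : ENNReal), 0 < ε →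
      ∃ F : Finset {t : PlaneTree // HeightLE (n + 1) t}, ∀ k,
        1 - ε ≤ ∑ t ∈ F, (nuSeq μ k : Measure PlaneTree) {T | Agree n T t.1} := by
    intro n ε hε
    have h1 : ∑' t : {t : PlaneTree // HeightLE (n + 1) t},
        ENNReal.ofReal (localProb μ n t.1) = 1 := by
      rw [← tsum_localProb hμ n]
      refine (tsum_subtype {t : PlaneTree | HeightLE (n + 1) t}
        fun t => ENNReal.ofReal (localProb μ n t)).trans (tsum_congr fun T => ?_)
      rw [Set.indicator_apply]
      rfl
    have h2 := ENNReal.summable.hasSum (f := fun t : {t : PlaneTree // HeightLE (n + 1) t} =>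
      ENNReal.ofReal (localProb μ n t.1))
    rw [h1] at h2
    have h3 : (1 : ENNReal) - ε < 1 := ENNReal.sub_lt_self ENNReal.one_ne_top one_ne_zero hε.ne'
    obtain ⟨F₀, hF₀⟩ := (h2.eventually (lt_mem_nhds h3)).exists
    have h4 : Tendsto (fun k => ∑ t ∈ F₀, (nuSeq μ k : Measure PlaneTree) {T | Agree n T t.1})
        atTop (𝓝 (∑ t ∈ F₀, ENNReal.ofReal (localProb μ n t.1))) :=
      tendsto_finsetSum _ fun t _ => tendsto_nuSeq_agree hμ n t.1
    obtain ⟨k₀, hk₀⟩ := eventually_atTop.1 (h4.eventually (lt_mem_nhds hF₀))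
    choose F hF using fun k => finite_compl (nuSeq μ k : Measure PlaneTree) n ε hε
    refine ⟨F₀ ∪ (Finset.range k₀).biUnion F, fun k => ?_⟩
    by_cases hk : k₀ ≤ k
    · exact (hk₀ k hk).le.trans (Finset.sum_le_sum_of_subset Finset.subset_union_left)
    · refine (hF k).le.trans (Finset.sum_le_sum_of_subset ?_)
      refine Finset.Subset.trans ?_ Finset.subset_union_right
      exact Finset.subset_biUnion_of_mem F (Finset.mem_range.2 (not_le.1 hk))
  rw [isTightMeasureSet_iff_exists_isCompact_measure_compl_le]
  intro ε hε
  obtain ⟨δ, hδ0, hδ⟩ := ENNReal.exists_pos_sum_of_countable hε.ne' ℕ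
  choose F hF using fun n => key n (δ n) (by exact_mod_cast hδ0 n)
  set U : ℕ → Set PlaneTree := fun n => ⋃ t ∈ F n, {T | Agree n T t.1} with hU
  have hUclosed : ∀ n, IsClosed (U n) := fun n =>
    Set.Finite.isClosed_biUnion (F n).finite_toSet fun t _ => (isClopen_agree n t.1).isClosed
  refine ⟨⋂ n, U n, isCompact_of_finite (isClosed_iInter hUclosed) fun n => ?_, ?_⟩
  · refine ⟨Subtype.val '' (F n : Set {t : PlaneTree // HeightLE (n + 1) t}),
      (F n).finite_toSet.image _, fun T hT => ?_⟩
    have := Set.mem_iInter.1 hT n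
    simp only [hU, Set.mem_iUnion] at this
    obtain ⟨t, ht, hTt⟩ := this
    exact ⟨t.1, ⟨t, ht, rfl⟩, hTt⟩
  · rintro _ ⟨_, ⟨k, rfl⟩, rfl⟩
    rw [Set.compl_iInter]
    refine (measure_iUnion_le _).trans (le_trans (ENNReal.tsum_le_tsum fun n => ?_) hδ.le)
    rw [measure_compl (hUclosed n).measurableSet (measure_ne_top _ _), measure_univ,
      tsub_le_iff_left, ← tsub_le_iff_right]
    refine (hF n k).trans ?_
    rw [hU, measure_biUnion_finset]
    · intro t _ t' _ hne
      refine Set.disjoint_left.2 fun T hT hT' => hne (Subtype.ext ?_)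
      exact eq_of_agree_of_heightLE (hT.symm.trans hT') t.2 t'.2
    · exact fun t _ => measurableSet_agree n t.1

theorem eq_of_agree {π π' : Measure PlaneTree} [IsFiniteMeasure π]
    (h : ∀ n t, π {T | Agree n T t} = π' {T | Agree n T t}) : π = π' :=
  Measure.ext_of_closedBall 0 fun n _ t => by rw [closedBall_eq, h]

/-- Tightness provides cluster points. Since the balls are clopen, each cluster point gives them the
probabilities `localProb`, so there is only one. -/
theorem exists_tendsto_nuSeq {μ : ℝ} (hμ : 0 < μ) : ∃ π : ProbabilityMeasure PlaneTree,
    Tendsto (nuSeq μ) atTop (𝓝 π) ∧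
      ∀ n t, (π : Measure PlaneTree) {T | Agree n T t} = ENNReal.ofReal (localProb μ n t) := by
  have hK := isCompact_closure_of_isTightMeasureSet (isTightMeasureSet_nuSeq hμ)
  have hval : ∀ π : ProbabilityMeasure PlaneTree, MapClusterPt π atTop (nuSeq μ) →
      ∀ n t, (π : Measure PlaneTree) {T | Agree n T t} = ENNReal.ofReal (localProb μ n t) := by
    intro π hπ n t
    obtain ⟨U, hU, hUπ⟩ := mapClusterPt_iff_ultrafilter.1 hπ
    have h1 := ProbabilityMeasure.tendsto_measure_of_null_frontier_of_tendsto' hUπ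
      (E := {T | Agree n T t}) (by rw [(isClopen_agree n t).frontier_eq, measure_empty])
    exact tendsto_nhds_unique h1 ((tendsto_nuSeq_agree hμ n t).mono_left hU)
  obtain ⟨π, -, hπ⟩ := hK.exists_mapClusterPt (f := atTop) (u := nuSeq μ)
    (tendsto_principal.2 (Eventually.of_forall fun k => subset_closure ⟨k, rfl⟩))
  refine ⟨π, hK.tendsto_nhds_of_unique_mapClusterPt
    (Eventually.of_forall fun k => subset_closure ⟨k, rfl⟩) fun π' _ hπ' => ?_, hval π hπ⟩
  refine Subtype.ext (eq_of_agree (π := (π' : Measure PlaneTree)) fun n t => ?_)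
  exact (hval π' hπ' n t).trans (hval π hπ n t).symm

theorem tendsto_nuSeq {μ : ℝ} (hμ : 0 < μ) : Tendsto (nuSeq μ) atTop (𝓝 (nu μ)) :=
  tendsto_nhds_limUnder ((exists_tendsto_nuSeq hμ).imp fun _ h => h.1)

theorem nu_agree {μ : ℝ} (hμ : 0 < μ) (n : ℕ) (t : PlaneTree) :
    (nu μ : Measure PlaneTree) {T | Agree n T t} = ENNReal.ofReal (localProb μ n t) := by
  obtain ⟨π, hπ, h⟩ := exists_tendsto_nuSeq hμ
  rw [tendsto_nhds_unique (tendsto_nuSeq hμ) hπ]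
  exact h n t

/-- Just above the height of T its level is empty, and a_0 = 0. -/
theorem nu_singleton {μ : ℝ} (hμ : 0 < μ) {T : PlaneTree} (hT : T.nodes.Finite) :
    (nu μ : Measure PlaneTree) {T} = 0 := by
  obtain ⟨n, hn⟩ := finite_iff_exists_heightLE.1 hT
  have h1 : (nu μ : Measure PlaneTree) {t | Agree n t T} = 0 := by
    rw [nu_agree hμ, localProb, top_eq_zero_of_heightLE hn, (isHarmonic_aCoef hμ).zero]
    simp
  exact measure_mono_null (Set.singleton_subset_iff.2 (Agree.refl n T)) h1

theorem countable_finTree : {T : PlaneTree | T.nodes.Finite}.Countable :=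
  Set.countable_coe_iff.1 (inferInstanceAs (Countable FinTree))

theorem measurableSet_finTree : MeasurableSet {T : PlaneTree | T.nodes.Finite} :=
  countable_finTree.measurableSet

theorem nu_finTree {μ : ℝ} (hμ : 0 < μ) :
    (nu μ : Measure PlaneTree) {T : PlaneTree | T.nodes.Finite} = 0 := by
  rw [← Set.biUnion_of_singleton {T : PlaneTree | T.nodes.Finite}, measure_biUnion_null_iff countable_finTree]
  exact fun T hT => nu_singleton hμ hT

end PlaneTree

/-! ### The critical Bienaymé-Galton-Watson tree -/

namespace PlaneTree

open PowerSeries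

open Classical in
/-- The weight `4 ^ (- |T|)`, which vanishes for infinite trees. -/
noncomputable def quarterWeight (T : PlaneTree) : ENNReal :=
  if T.size = ⊤ then 0 else (1 / 4) ^ T.size.toNat

open Classical in
theorem quarterWeight_node (L : List PlaneTree) :
    quarterWeight (node L) = 1 / 4 * (L.map quarterWeight).prod := by
  have key : ∀ s t : ℕ∞, (if s + t = ⊤ then (0 : ENNReal) else (1 / 4) ^ (s + t).toNat) =
      (if s = ⊤ then (0 : ENNReal) else (1 / 4) ^ s.toNat) *
        if t = ⊤ then (0 : ENNReal) else (1 / 4) ^ t.toNat := by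
    intro s t
    by_cases hs : s = ⊤
    · simp [hs]
    by_cases ht : t = ⊤
    · simp [ht]
    rw [if_neg hs, if_neg ht, if_neg (by simp [hs, ht]), ENat.toNat_add hs ht, pow_add]
  rw [quarterWeight, size_node, key, if_neg (by simp)]
  congr 1
  · simp
  induction L with
  | nil => simp
  | cons t L ih => rw [List.map_cons, List.sum_cons, key, ih, List.map_cons, List.prod_cons]; rfl

theorem quarterWeight_cons (t : PlaneTree) (L : List PlaneTree) :
    quarterWeight (node (t :: L)) = quarterWeight t * quarterWeight (node L) := by
  rw [quarterWeight_node, quarterWeight_node, List.map_cons, List.prod_cons]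
  ring

theorem size_eq_top_iff {T : PlaneTree} : T.size = ⊤ ↔ T.nodes.Infinite := Set.encard_eq_top_iff

theorem quarterWeight_of_infinite {T : PlaneTree} (hT : T.nodes.Infinite) :
    quarterWeight T = 0 := if_pos (size_eq_top_iff.2 hT)

open Classical in
theorem tsum_quarterWeight_heightLE (m : ℕ) :
    ∑' T, (if HeightLE m T then quarterWeight T else 0) ≤ 1 / 2 := by
  refine le_trans (le_of_eq ?_) (heightSeries.evalENN_quarter_le m)
  have h1 : ∀ T : PlaneTree, (if HeightLE m T then quarterWeight T else 0) =
      ∑' N : ℕ, (1 / 4) ^ N * if T.size = N then (if HeightLE m T then 1 else 0) else 0 := by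
    intro T
    by_cases hT : T.size = ⊤
    · have : ¬ HeightLE m T := fun h => by
        have := finite_of_heightLE h
        exact absurd this (size_eq_top_iff.1 hT)
      simp [this]
    · obtain ⟨k, hk⟩ := ENat.ne_top_iff_exists.1 hT
      rw [tsum_eq_single k fun j hj => by
        rw [if_neg, mul_zero]
        rw [← hk]
        exact_mod_cast hj.symm, quarterWeight, if_neg hT, ← hk, if_pos rfl]
      simp
  rw [tsum_congr h1, ENNReal.tsum_comm, evalENN]
  refine tsum_congr fun N => ?_
  rw [ENNReal.tsum_mul_left, ← coeff_gf, (gf_size_heightLE m N).2, mul_comm]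

/-- Splitting off the first subtree gives a = 1/4 + a², with the double root 1/2. That a is finite
has to be known in advance and follows from the bound for trees of bounded height. -/
theorem tsum_quarterWeight : ∑' T, quarterWeight T = 1 / 2 := by
  classical
  have hle : ∑' T, quarterWeight T ≤ 1 / 2 := by
    rw [ENNReal.tsum_eq_iSup_sum]
    refine iSup_le fun s => ?_
    obtain ⟨m, hm⟩ : ∃ m, ∀ T ∈ s, T.nodes.Finite → HeightLE m T := by
      induction s using Finset.induction_on with
      | empty => exact ⟨0, by simp⟩
      | insert a s _ ih =>
        obtain ⟨m, hm⟩ := ih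
        by_cases ha : a.nodes.Finite
        · obtain ⟨k, hk⟩ := finite_iff_exists_heightLE.1 ha
          refine ⟨max m k, fun T hT hfin => ?_⟩
          rcases Finset.mem_insert.1 hT with rfl | hT
          · exact heightLE_mono (le_max_right _ _) hk
          · exact heightLE_mono (le_max_left _ _) (hm T hT hfin)
        · refine ⟨m, fun T hT hfin => ?_⟩
          rcases Finset.mem_insert.1 hT with rfl | hT
          · exact absurd hfin ha
          · exact hm T hT hfin
    refine le_trans (Finset.sum_le_sum fun T hT => ?_)
      ((ENNReal.sum_le_tsum s).trans (tsum_quarterWeight_heightLE m))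
    by_cases hfin : T.nodes.Finite
    · rw [if_pos (hm T hT hfin)]
    · rw [quarterWeight_of_infinite hfin]
      exact zero_le
  have h := congrArg constantCoeff (gf_cons (fun _ => 0) quarterWeight quarterWeight 0 rfl
    (fun t L => by simp) quarterWeight_cons)
  rw [pow_zero, mul_one, map_add, map_mul, constantCoeff_C,
    ← coeff_zero_eq_constantCoeff_apply, coeff_gf] at h
  simp only [Nat.cast_zero, if_true] at h
  rw [quarterWeight_node] at h
  simp only [List.map_nil, List.prod_nil, mul_one] at h
  have hne : ∑' T, quarterWeight T ≠ ⊤ := ne_top_of_le_ne_top (by simp) hle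
  lift ∑' T, quarterWeight T to NNReal using hne with a
  have h2 : (a : ℝ) = 1 / 4 + a * a := by
    have := congrArg ENNReal.toReal h
    rw [ENNReal.toReal_add (by simp) (by finiteness), ENNReal.toReal_mul] at this
    simpa using this
  have h3 : (a : ℝ) = 1 / 2 := by nlinarith [sq_nonneg ((a : ℝ) - 1 / 2)]
  rw [← ENNReal.toReal_eq_toReal_iff' (by simp) (by simp)]
  simpa using h3

theorem sum_numKids {T : PlaneTree} (hT : T.nodes.Finite) :
    ∑ w ∈ hT.toFinset, T.numKids w + 1 = hT.toFinset.card := by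
  have hroot : [] ∈ hT.toFinset := by simpa using T.root_mem
  have hmaps : ∀ w ∈ hT.toFinset.erase [], w.dropLast ∈ hT.toFinset := by
    intro w hw
    rw [Finset.mem_erase, Set.Finite.mem_toFinset] at hw
    rw [Set.Finite.mem_toFinset]
    refine T.mem_of_append (v := [w.getLast hw.1]) ?_
    rw [List.dropLast_append_getLast]
    exact hw.2
  rw [← Finset.card_erase_add_one hroot, Finset.card_eq_sum_card_fiberwise hmaps]
  congr 1
  refine Finset.sum_congr rfl fun w hw => ?_
  rw [Set.Finite.mem_toFinset] at hw
  have hinj : Function.Injective fun j : ℕ => w ++ [j] := fun a b h => by simpa using h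
  rw [← Finset.card_range (T.numKids w), ← Finset.card_image_of_injective _ hinj]
  congr 1
  ext v
  simp only [Finset.mem_image, Finset.mem_range, Finset.mem_filter, Finset.mem_erase,
    Set.Finite.mem_toFinset]
  constructor
  · rintro ⟨j, hj, rfl⟩
    exact ⟨⟨by simp, (T.mem_append_singleton_iff w j).2 ⟨hw, hj⟩⟩, by simp⟩
  · rintro ⟨⟨hne, hv⟩, rfl⟩
    refine ⟨v.getLast hne, ?_, List.dropLast_append_getLast hne⟩
    have h1 := (T.mem_append_singleton_iff v.dropLast (v.getLast hne)).1
      (by rwa [List.dropLast_append_getLast])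
    exact h1.2

/-- The exponents sum to 2 |T| - 1, because every vertex counted except `[]` is an offspring of
exactly one other. -/
theorem prod_numKids {T : PlaneTree} (hT : T.nodes.Finite) :
    ∏ w ∈ hT.toFinset, (2 : ENNReal)⁻¹ ^ (T.numKids w + 1) = 2 * quarterWeight T := by
  have h1 := sum_numKids hT
  have h2 : T.size = (hT.toFinset.card : ℕ∞) := hT.encard_eq_coe_toFinset_card
  have h3 : (1 / 4 : ENNReal) = 2⁻¹ ^ 2 := by
    rw [← ENNReal.inv_pow, one_div]
    norm_num
  rw [Finset.prod_pow_eq_pow_sum, Finset.sum_add_distrib, Finset.sum_const, smul_eq_mul, mul_one,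
    quarterWeight, h2, if_neg (ENat.natCast_ne_top _), ENat.toNat_natCast, h3, ← pow_mul,
    show 2 * hT.toFinset.card =
      (∑ w ∈ hT.toFinset, T.numKids w + hT.toFinset.card) + 1 by omega, pow_succ, mul_comm (2 : ENNReal),
    mul_assoc, ENNReal.inv_mul_cancel (by simp) (by simp), mul_one]

theorem bgwMeasure_apply {A : Set PlaneTree} (hA : MeasurableSet A) :
    bgwMeasure A = ∑' T, A.indicator (fun T => 2 * quarterWeight T) T := by
  classical
  rw [bgwMeasure, Measure.sum_apply _ hA]
  have h1 : ∀ T : FinTree, ((∏ w ∈ T.2.toFinset, (2 : ENNReal)⁻¹ ^ (T.1.numKids w + 1)) •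
      Measure.dirac T.1) A = A.indicator (fun T => 2 * quarterWeight T) T.1 := by
    intro T
    rw [prod_numKids T.2, Measure.smul_apply, Measure.dirac_apply' _ hA, smul_eq_mul,
      Set.indicator_apply, Set.indicator_apply]
    simp
  rw [tsum_congr h1]
  refine Subtype.val_injective.tsum_eq
    (f := fun T => A.indicator (fun T => 2 * quarterWeight T) T) fun T hT => ?_
  by_contra h
  have hinf : T.nodes.Infinite := fun hfin => h ⟨⟨T, hfin⟩, rfl⟩
  refine hT ?_
  simp only [Set.indicator_apply, quarterWeight_of_infinite hinf, mul_zero, ite_self]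

theorem bgwMeasure_singleton (T : PlaneTree) : bgwMeasure {T} = 2 * quarterWeight T := by
  rw [bgwMeasure_apply (measurableSet_singleton T), tsum_eq_single T]
  · simp
  · intro T' h
    simp [h]

instance : IsProbabilityMeasure bgwMeasure := by
  constructor
  rw [bgwMeasure_apply MeasurableSet.univ]
  simp only [Set.indicator_univ]
  rw [ENNReal.tsum_mul_left, tsum_quarterWeight, one_div, ENNReal.mul_inv_cancel (by simp) (by simp)]

/-- The trees on the highest level of t contribute the factor 1/2 each, by `tsum_quarterWeight`. -/
theorem bgwMeasure_agree (n : ℕ) (t : PlaneTree) :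
    bgwMeasure {T | Agree n T t} = ENNReal.ofReal (2 * (1 / 4) ^ below n t * (1 / 2) ^ top n t) := by
  classical
  have h := congrArg (coeff 0) (gf_agree 0 (1 / 4) (fun _ _ => 0) (fun _ => quarterWeight)
    (fun n T => by simp) (fun n T => by
      conv_lhs => rw [← node_kids T]
      exact quarterWeight_node _) n t)
  have h0 : gf (fun _ => 0) quarterWeight = C (1 / 2) := by
    ext N
    rw [coeff_gf, coeff_C, ← tsum_quarterWeight]
    by_cases hN : N = 0
    · simp [hN]
    · have : (0 : ℕ∞) ≠ N := by exact_mod_cast Ne.symm hN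
      simp [hN, this]
  rw [h0, zero_mul, pow_zero, mul_one, ← map_pow, ← map_pow, ← map_mul, coeff_zero_C, coeff_gf] at h
  simp only [Nat.cast_zero, if_true] at h
  rw [bgwMeasure_apply (measurableSet_agree n t)]
  simp only [Set.indicator_apply, Set.mem_ofPred_eq]
  have h2 : ∀ T, (if Agree n T t then 2 * quarterWeight T else 0) =
      2 * if Agree n T t then quarterWeight T else 0 := fun T => by simp
  rw [tsum_congr h2, ENNReal.tsum_mul_left, h, ENNReal.ofReal_mul (by positivity),
    ENNReal.ofReal_mul (by positivity), ENNReal.ofReal_pow (by positivity),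
    ENNReal.ofReal_pow (by positivity), ENNReal.ofReal_div_of_pos (by positivity),
    ENNReal.ofReal_div_of_pos (by positivity), mul_assoc]
  simp

theorem bgwMeasure_infTree : bgwMeasure {T | T.nodes.Infinite} = 0 := by
  classical
  change bgwMeasure {T | T.nodes.Finite}ᶜ = 0
  rw [bgwMeasure_apply (measurableSet_finTree.compl)]
  refine ENNReal.tsum_eq_zero.2 fun T => ?_
  rw [Set.indicator_apply]
  split_ifs with h
  · rw [quarterWeight_of_infinite h, mul_zero]
  · rfl

end PlaneTree

/-! ### A convolution identity for polynomials -/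

namespace DividedPower

open Polynomial

/-- The linear functional with `X ^ (n + 1) ↦ m ^ n / n!` and `1 ↦ 0`. -/
noncomputable def functional (m : ℝ) : ℝ[X] →ₗ[ℝ] ℝ :=
  (Polynomial.basisMonomials ℝ).constr ℝ fun n => if n = 0 then 0 else m ^ (n - 1) / ((n - 1).factorial : ℝ)

theorem functional_monomial (m : ℝ) (n : ℕ) (a : ℝ) : functional m (monomial n a) =
    a * if n = 0 then 0 else m ^ (n - 1) / ((n - 1).factorial : ℝ) := by
  have h1 : monomial n a = a • Polynomial.basisMonomials ℝ n := by
    rw [Polynomial.coe_basisMonomials, Polynomial.smul_monomial, smul_eq_mul, mul_one]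
  rw [h1, map_smul, functional, Module.Basis.constr_basis, smul_eq_mul]

theorem functional_monomial_succ (m : ℝ) (n : ℕ) (a : ℝ) :
    functional m (monomial (n + 1) a) = a * (m ^ n / (n.factorial : ℝ)) := by
  rw [functional_monomial]
  simp

theorem functional_C (m a : ℝ) : functional m (C a) = 0 := by
  rw [← monomial_zero_left, functional_monomial]
  simp

theorem functional_X_pow_succ (m : ℝ) (n : ℕ) :
    functional m (X ^ (n + 1)) = m ^ n / (n.factorial : ℝ) := by
  rw [← monomial_one_right_eq_X_pow, functional_monomial_succ, one_mul]

theorem functional_eq_sum (m : ℝ) (P : ℝ[X]) : functional m P =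
    ∑ n ∈ P.support, P.coeff n * if n = 0 then 0 else m ^ (n - 1) / ((n - 1).factorial : ℝ) := by
  conv_lhs => rw [P.as_sum_support]
  rw [map_sum]
  exact Finset.sum_congr rfl fun n _ => functional_monomial m n _

theorem continuous_functional (P : ℝ[X]) : Continuous fun m => functional m P := by
  simp only [functional_eq_sum]
  refine continuous_finsetSum _ fun n _ => ?_
  split_ifs
  · fun_prop
  · fun_prop

theorem functional_nonneg {m : ℝ} (hm : 0 ≤ m) {P : ℝ[X]} (hP : ∀ n, 0 ≤ P.coeff n) :
    0 ≤ functional m P := by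
  rw [functional_eq_sum]
  refine Finset.sum_nonneg fun n _ => mul_nonneg (hP n) ?_
  split_ifs <;> positivity

/-- A beta integral: under convolution the functions s^n / n! multiply like the powers X^{n+1}. -/
theorem integral_pow_mul_pow (a b : ℕ) (μ : ℝ) :
    ∫ s in (0 : ℝ)..μ, s ^ a / (a.factorial : ℝ) * ((μ - s) ^ b / (b.factorial : ℝ)) =
      μ ^ (a + b + 1) / ((a + b + 1).factorial : ℝ) := by
  have hd : ∀ (n : ℕ) (x : ℝ), HasDerivAt (fun s : ℝ => s ^ (n + 1) / ((n + 1).factorial : ℝ))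
      (x ^ n / (n.factorial : ℝ)) x := by
    intro n x
    refine ((hasDerivAt_pow (n + 1) x).div_const _).congr_deriv ?_
    rw [Nat.factorial_succ]
    push_cast
    have : ((n : ℝ) + 1) ≠ 0 := by positivity
    field_simp
  induction b generalizing a with
  | zero =>
    simp only [pow_zero, Nat.factorial_zero, Nat.cast_one, div_one, mul_one, add_zero]
    rw [intervalIntegral.integral_eq_sub_of_hasDerivAt (fun x _ => hd a x)]
    · simp
    · exact Continuous.intervalIntegrable (by fun_prop) _ _
  | succ b ih =>
    have hv : ∀ x : ℝ, HasDerivAt (fun s : ℝ => (μ - s) ^ (b + 1) / ((b + 1).factorial : ℝ))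
        (-((μ - x) ^ b / (b.factorial : ℝ))) x := by
      intro x
      refine ((hd b (μ - x)).comp x ((hasDerivAt_id x).const_sub μ)).congr_deriv ?_
      ring
    have h1 := intervalIntegral.integral_mul_deriv_eq_deriv_mul (a := 0) (b := μ)
      (fun x _ => hd a x) (fun x _ => hv x)
      (Continuous.intervalIntegrable (by fun_prop) _ _)
      (Continuous.intervalIntegrable (by fun_prop) _ _)
    simp only [sub_self, ne_eq, Nat.add_eq_zero_iff, one_ne_zero, and_false, not_false_eq_true,
      zero_pow, zero_div, mul_zero, zero_mul, mul_neg, intervalIntegral.integral_neg, zero_sub,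
      neg_inj] at h1
    rw [← h1, ih]
    congr 2 <;> ring_nf

/-- The map P ↦ P(0) δ₀ + `functional s P` ds turns products into convolutions. The second factor is
divisible by X and hence has no atom. -/
theorem integral_functional_mul (P Q : ℝ[X]) (μ : ℝ) :
    (∫ s in (0 : ℝ)..μ, functional s P * functional (μ - s) (X * Q)) +
      P.coeff 0 * functional μ (X * Q) = functional μ (P * (X * Q)) := by
  have hint : ∀ P Q : ℝ[X], IntervalIntegrable
      (fun s => functional s P * functional (μ - s) Q) volume 0 μ := fun P Q =>
    Continuous.intervalIntegrable ((continuous_functional P).mul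
      ((continuous_functional Q).comp (by fun_prop))) _ _
  induction P using Polynomial.induction_on' with
  | add P P' hP hP' =>
    simp only [map_add, add_mul, coeff_add]
    rw [intervalIntegral.integral_add (hint P _) (hint P' _), ← hP, ← hP']
    ring
  | monomial a x =>
    induction Q using Polynomial.induction_on' with
    | add Q Q' hQ hQ' =>
      simp only [map_add, mul_add]
      rw [intervalIntegral.integral_add (hint _ _) (hint _ _), ← hQ, ← hQ']
      ring
    | monomial b y =>
      rw [X_mul_monomial, monomial_mul_monomial]
      rcases a with _ | a
      · simp only [functional_monomial, if_true, mul_zero, zero_mul,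
          intervalIntegral.integral_zero, zero_add, coeff_monomial, mul_assoc]
      · rw [show a + 1 + (b + 1) = (a + b + 1) + 1 by ring]
        simp only [functional_monomial_succ, coeff_monomial]
        rw [← integral_pow_mul_pow, if_neg (by omega), zero_mul, add_zero,
          ← intervalIntegral.integral_const_mul]
        refine intervalIntegral.integral_congr fun s _ => ?_
        ring

/-- The value at `m` of the measure `P(0) δ₀ + e^{-c m} functional m P dm` of the half-line, with
respect to the sum of `δ₀` and Lebesgue measure. -/
noncomputable def density (c : ℝ) (P : ℝ[X]) (m : ℝ) : ENNReal :=
  ENNReal.ofReal (if 0 < m then Real.exp (-c * m) * functional m P else P.coeff 0)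

theorem density_of_pos (c : ℝ) (P : ℝ[X]) {m : ℝ} (hm : 0 < m) :
    density c P m = ENNReal.ofReal (Real.exp (-c * m) * functional m P) := by
  rw [density, if_pos hm]

theorem density_of_nonpos (c : ℝ) (P : ℝ[X]) {m : ℝ} (hm : m ≤ 0) :
    density c P m = ENNReal.ofReal (P.coeff 0) := by
  rw [density, if_neg hm.not_gt]

@[fun_prop]
theorem measurable_density (c : ℝ) (P : ℝ[X]) : Measurable (density c P) := by
  refine ENNReal.measurable_ofReal.comp (Measurable.ite measurableSet_Ioi ?_ measurable_const)
  exact Continuous.measurable (by have := continuous_functional P; fun_prop)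

/-- The sum of `δ₀` and Lebesgue measure on the half-line. -/
noncomputable def halfLine : Measure ℝ := Measure.dirac 0 + volume.restrict (Set.Ioi 0)

instance : SigmaFinite halfLine := by
  unfold halfLine
  infer_instance

theorem coeff_mul_nonneg {P Q : ℝ[X]} (hP : ∀ n, 0 ≤ P.coeff n) (hQ : ∀ n, 0 ≤ Q.coeff n) (n : ℕ) :
    0 ≤ (P * Q).coeff n := by
  rw [coeff_mul]
  exact Finset.sum_nonneg fun i _ => mul_nonneg (hP _) (hQ _)

theorem coeff_prod_nonneg {ι : Type*} (s : Finset ι) {P : ι → ℝ[X]}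
    (hP : ∀ i n, 0 ≤ (P i).coeff n) (n : ℕ) : 0 ≤ (∏ i ∈ s, P i).coeff n := by
  classical
  induction s using Finset.induction_on generalizing n with
  | empty => rw [Finset.prod_empty, coeff_one]; split_ifs <;> simp
  | insert a s ha ih => rw [Finset.prod_insert ha]; exact coeff_mul_nonneg (hP a) ih n

/-- The exponential factor is multiplicative along the convolution. The point s = μ, where an atom
of Q would sit, may be left out because `Q.coeff 0 = 0`. -/
theorem lintegral_density_mul (c : ℝ) {P Q : ℝ[X]} (hP : ∀ n, 0 ≤ P.coeff n)
    (hQ : ∀ n, 0 ≤ Q.coeff n) (hQ0 : Q.coeff 0 = 0) {μ : ℝ} (hμ : 0 < μ) :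
    ∫⁻ s in Set.Ico 0 μ, density c P s * density c Q (μ - s) ∂halfLine = density c (P * Q) μ := by
  obtain ⟨Q', rfl⟩ : X ∣ Q := X_dvd_iff.2 hQ0
  have hmeas : Measurable fun s => density c P s * density c (X * Q') (μ - s) := by fun_prop
  rw [halfLine, Measure.restrict_add, lintegral_add_measure, restrict_dirac' measurableSet_Ico,
    if_pos ⟨le_rfl, hμ⟩, lintegral_dirac' _ hmeas, Measure.restrict_restrict measurableSet_Ico]
  have hset : Set.Ico 0 μ ∩ Set.Ioi 0 = Set.Ioo 0 μ := by
    ext s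
    simp only [Set.mem_inter_iff, Set.mem_Ico, Set.mem_Ioi, Set.mem_Ioo]
    constructor
    · exact fun h => ⟨h.2, h.1.2⟩
    · exact fun h => ⟨⟨h.1.le, h.2⟩, h.1⟩
  rw [hset]
  have h1 : ∀ s ∈ Set.Ioo 0 μ, density c P s * density c (X * Q') (μ - s) =
      ENNReal.ofReal (Real.exp (-c * μ) * (functional s P * functional (μ - s) (X * Q'))) := by
    intro s hs
    rw [density_of_pos c P hs.1, density_of_pos c _ (sub_pos.2 hs.2), ← ENNReal.ofReal_mul
      (mul_nonneg (Real.exp_pos _).le (functional_nonneg hs.1.le hP)),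
      show -c * μ = -c * s + -c * (μ - s) by ring, Real.exp_add]
    congr 1
    ring
  have hcont : Continuous fun s =>
      Real.exp (-c * μ) * (functional s P * functional (μ - s) (X * Q')) :=
    continuous_const.mul ((continuous_functional P).mul
      ((continuous_functional _).comp (by fun_prop)))
  rw [setLIntegral_congr_fun measurableSet_Ioo h1, ← ofReal_integral_eq_lintegral_ofReal]
  · rw [density_of_nonpos c P le_rfl, sub_zero, density_of_pos c _ hμ, density_of_pos c _ hμ,
      ← ENNReal.ofReal_mul (hP 0), ← ENNReal.ofReal_add]
    · rw [← integral_functional_mul, ← integral_Ioc_eq_integral_Ioo,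
        ← intervalIntegral.integral_of_le hμ.le, intervalIntegral.integral_const_mul]
      congr 1
      ring
    · exact mul_nonneg (hP 0) (mul_nonneg (Real.exp_pos _).le (functional_nonneg hμ.le hQ))
    · refine setIntegral_nonneg measurableSet_Ioo fun s hs => ?_
      exact mul_nonneg (Real.exp_pos _).le (mul_nonneg (functional_nonneg hs.1.le hP)
        (functional_nonneg (sub_nonneg.2 hs.2.le) hQ))
  · exact (hcont.integrableOn_Icc (a := 0) (b := μ)).mono_set Set.Ioo_subset_Icc_self
  · filter_upwards [ae_restrict_mem measurableSet_Ioo] with s hs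
    exact mul_nonneg (Real.exp_pos _).le (mul_nonneg (functional_nonneg hs.1.le hP)
        (functional_nonneg (sub_nonneg.2 hs.2.le) hQ))

/-- The points of the orthant with sum less than `μ`. -/
def corner (n : ℕ) (μ : ℝ) : Set (Fin n → ℝ) := {x | (∀ i, 0 ≤ x i) ∧ ∑ i, x i < μ}

theorem measurableSet_corner (n : ℕ) (μ : ℝ) : MeasurableSet (corner n μ) := by
  have h1 : corner n μ = (⋂ i, {x : Fin n → ℝ | 0 ≤ x i}) ∩ {x | ∑ i, x i < μ} := by
    ext x
    simp [corner]
  rw [h1]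
  exact (MeasurableSet.iInter fun i => measurableSet_le measurable_const
    (measurable_pi_apply i)).inter (measurableSet_lt (by fun_prop) measurable_const)

/-- Convolution, one coordinate at a time; Q is evaluated at the remainder, which is positive on the
corner. -/
theorem lintegral_corner (c : ℝ) {n : ℕ} (P : Fin n → ℝ[X]) (hP : ∀ i n, 0 ≤ (P i).coeff n)
    {Q : ℝ[X]} (hQ : ∀ n, 0 ≤ Q.coeff n) (hQ0 : Q.coeff 0 = 0) {μ : ℝ} (hμ : 0 < μ) :
    ∫⁻ x in corner n μ, (∏ i, density c (P i) (x i)) * density c Q (μ - ∑ i, x i)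
      ∂Measure.pi (fun _ => halfLine) = density c ((∏ i, P i) * Q) μ := by
  induction n generalizing μ with
  | zero =>
    have h1 : corner 0 μ = Set.univ := by
      ext x
      simp [corner, hμ]
    rw [h1, Measure.restrict_univ, Measure.pi_of_empty, lintegral_dirac]
    simp
  | succ n ih =>
    have hQ' : ∀ k, 0 ≤ ((∏ i : Fin n, P i.succ) * Q).coeff k :=
      coeff_mul_nonneg (coeff_prod_nonneg _ fun i => hP _) hQ
    have hmeas : ∀ (n : ℕ) (μ : ℝ) (P : Fin n → ℝ[X]), Measurable fun x : Fin n → ℝ =>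
        (∏ i, density c (P i) (x i)) * density c Q (μ - ∑ i, x i) := by
      intro n μ P
      refine Measurable.mul (Finset.measurable_prod _ fun i _ =>
        (measurable_density c (P i)).comp (measurable_pi_apply i)) ?_
      exact (measurable_density c Q).comp (by fun_prop)
    have hmp := (measurePreserving_piFinSuccAbove (fun _ : Fin (n + 1) => halfLine) 0).symm
    rw [← lintegral_indicator (measurableSet_corner _ _), ← hmp.lintegral_comp
      ((hmeas _ _ _).indicator (measurableSet_corner _ _)), lintegral_prod (fun z => (corner (n + 1) μ).indicator (fun x =>
        (∏ i, density c (P i) (x i)) * density c Q (μ - ∑ i, x i))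
        ((MeasurableEquiv.piFinSuccAbove (fun _ : Fin (n + 1) => ℝ) 0).symm z)) (Measurable.aemeasurable
        (((hmeas _ _ _).indicator (measurableSet_corner _ _)).comp hmp.measurable)),
      Fin.prod_univ_succ, mul_assoc, ← lintegral_density_mul c (hP 0) hQ' (by simp [hQ0]) hμ,
      ← lintegral_indicator measurableSet_Ico]
    refine lintegral_congr fun s => ?_
    have hcons : ∀ x : Fin n → ℝ,
        (MeasurableEquiv.piFinSuccAbove (fun _ : Fin (n + 1) => ℝ) 0).symm (s, x) =
          (Fin.cons s x : Fin (n + 1) → ℝ) := fun x => Fin.insertNth_zero' s x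
    have hmem : ∀ x : Fin n → ℝ,
        (MeasurableEquiv.piFinSuccAbove (fun _ : Fin (n + 1) => ℝ) 0).symm (s, x) ∈ corner (n + 1) μ ↔
          0 ≤ s ∧ x ∈ corner n (μ - s) := by
      intro x
      simp only [hcons, corner, Set.mem_ofPred_eq, Fin.forall_fin_succ, Fin.sum_univ_succ,
        Fin.cons_zero, Fin.cons_succ, lt_sub_iff_add_lt', and_assoc]
    have hval : ∀ x : Fin n → ℝ, (corner (n + 1) μ).indicator (fun x =>
        (∏ i, density c (P i) (x i)) * density c Q (μ - ∑ i, x i))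
        ((MeasurableEquiv.piFinSuccAbove (fun _ : Fin (n + 1) => ℝ) 0).symm (s, x)) =
        if 0 ≤ s then density c (P 0) s * (corner n (μ - s)).indicator (fun x =>
          (∏ i : Fin n, density c (P i.succ) (x i)) * density c Q (μ - s - ∑ i, x i)) x else 0 := by
      intro x
      classical
      rw [Set.indicator_apply, Set.indicator_apply]
      simp only [hmem]
      by_cases h1 : 0 ≤ s
      · by_cases h2 : x ∈ corner n (μ - s)
        · simp only [hcons, h1, h2, and_self, if_true, Fin.prod_univ_succ, Fin.sum_univ_succ,
            Fin.cons_zero, Fin.cons_succ, mul_assoc, sub_sub]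
        · simp [h2]
      · simp [h1]
    rw [lintegral_congr hval]
    by_cases hs : s ∈ Set.Ico 0 μ
    · rw [Set.indicator_of_mem hs]
      simp only [hs.1, if_true]
      rw [lintegral_const_mul _ ((hmeas _ _ _).indicator (measurableSet_corner _ _)),
        lintegral_indicator (measurableSet_corner _ _), ih _ (fun i => hP _) (sub_pos.2 hs.2)]
    · rw [Set.indicator_of_notMem hs]
      by_cases h1 : 0 ≤ s
      · simp only [h1, if_true]
        have h2 : ∀ x : Fin n → ℝ, x ∉ corner n (μ - s) := by
          intro x hx
          refine hs ⟨h1, ?_⟩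
          have := Finset.sum_nonneg fun i (_ : i ∈ Finset.univ) => hx.1 i
          linarith [hx.2]
        simp [Set.indicator_of_notMem, h2]
      · simp [h1]

/-- The measure on the points of the orthant with sum `μ` which is the sum of the Lebesgue measures
on all faces. -/
noncomputable def faces : (n : ℕ) → ℝ → Measure (Fin n → ℝ)
  | 0, _ => 0
  | n + 1, μ =>
    Measure.map (fun x : Fin n → ℝ => Fin.snoc (α := fun _ => ℝ) x (μ - ∑ i, x i))
      ((Measure.pi fun _ => halfLine).restrict (corner n μ)) +
    Measure.map (fun x : Fin n → ℝ => Fin.snoc (α := fun _ => ℝ) x 0) (faces n μ)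

theorem measurable_snoc {n : ℕ} {f : (Fin n → ℝ) → ℝ} (hf : Measurable f) :
    Measurable fun x : Fin n → ℝ => (Fin.snoc (α := fun _ => ℝ) x (f x) : Fin (n + 1) → ℝ) := by
  refine measurable_pi_iff.2 fun i => ?_
  refine Fin.lastCases ?_ (fun j => ?_) i
  · simpa using hf
  · simpa using measurable_pi_apply j

theorem lintegral_faces (c : ℝ) {n : ℕ} (P : Fin n → ℝ[X]) (hP : ∀ i n, 0 ≤ (P i).coeff n)
    {μ : ℝ} (hμ : 0 < μ) : ∫⁻ x, ∏ i, density c (P i) (x i) ∂faces n μ =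
      ENNReal.ofReal (Real.exp (-c * μ) * functional μ (∏ i, P i)) := by
  induction n with
  | zero =>
    rw [Finset.univ_eq_empty, Finset.prod_empty, ← C_1, functional_C]
    simp [faces]
  | succ n ih =>
    have hmeas : ∀ (n : ℕ) (P : Fin n → ℝ[X]), Measurable fun x : Fin n → ℝ =>
        ∏ i, density c (P i) (x i) := fun n P => Finset.measurable_prod _ fun i _ =>
        (measurable_density c (P i)).comp (measurable_pi_apply i)
    -- The part Q without constant term accounts for the faces with positive last coordinate, the
    -- constant term for those on which it vanishes.
    set Q : ℝ[X] := P (Fin.last n) - C ((P (Fin.last n)).coeff 0) with hQdef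
    have hQ0 : Q.coeff 0 = 0 := by simp [hQdef]
    have hQ : ∀ k, 0 ≤ Q.coeff k := by
      intro k
      rcases k with _ | k
      · exact hQ0.ge
      · rw [hQdef, coeff_sub, coeff_C_succ, sub_zero]
        exact hP _ _
    have hdens : ∀ {m : ℝ}, 0 < m → density c (P (Fin.last n)) m = density c Q m := by
      intro m hm
      rw [density_of_pos c _ hm, density_of_pos c _ hm, hQdef, map_sub, functional_C, sub_zero]
    rw [faces, lintegral_add_measure, lintegral_map (hmeas _ _) (measurable_snoc (by fun_prop)),
      lintegral_map (hmeas _ _) (measurable_snoc (by fun_prop))]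
    simp only [Fin.prod_univ_castSucc, Fin.snoc_castSucc, Fin.snoc_last]
    rw [lintegral_mul_const _ (hmeas _ _), ih _ fun i => hP _,
      setLIntegral_congr_fun (measurableSet_corner n μ) (g := fun x : Fin n → ℝ =>
        (∏ i, density c (P i.castSucc) (x i)) * density c Q (μ - ∑ i, x i)) fun x hx => by
          simp only
          rw [hdens (sub_pos.2 hx.2)],
      lintegral_corner c _ (fun i => hP _) hQ hQ0 hμ, density_of_pos c _ hμ,
      density_of_nonpos c _ le_rfl, ← ENNReal.ofReal_mul, ← ENNReal.ofReal_add]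
    · congr 1
      rw [hQdef, mul_sub, map_sub, mul_comm (∏ i : Fin n, P i.castSucc) (C _), C_mul', map_smul,
        smul_eq_mul]
      ring
    · exact mul_nonneg (Real.exp_pos _).le (functional_nonneg hμ.le
        (coeff_mul_nonneg (coeff_prod_nonneg _ fun i => hP _) hQ))
    · exact mul_nonneg (mul_nonneg (Real.exp_pos _).le (functional_nonneg hμ.le
        (coeff_prod_nonneg _ fun i => hP _))) (hP _ _)
    · exact mul_nonneg (Real.exp_pos _).le (functional_nonneg hμ.le
        (coeff_prod_nonneg _ fun i => hP _))

end DividedPower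

/-! ### The open face and the uniform measure on the simplex. -/

namespace DividedPower

open Polynomial

/-- The points with positive coordinates. -/
def positive (n : ℕ) : Set (Fin n → ℝ) := {x | ∀ i, 0 < x i}

theorem measurableSet_positive (n : ℕ) : MeasurableSet (positive n) := by
  have h1 : positive n = ⋂ i, {x : Fin n → ℝ | 0 < x i} := by
    ext x
    simp [positive]
  rw [h1]
  exact MeasurableSet.iInter fun i => measurableSet_lt measurable_const (measurable_pi_apply i)

/-- The open simplex, without its last coordinate. -/
def openCorner (n : ℕ) (μ : ℝ) : Set (Fin n → ℝ) := {x | (∀ i, 0 < x i) ∧ ∑ i, x i < μ}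

theorem positive_inter_corner (n : ℕ) (μ : ℝ) : positive n ∩ corner n μ = openCorner n μ := by
  ext x
  simp only [positive, corner, openCorner, Set.mem_inter_iff, Set.mem_ofPred_eq]
  exact ⟨fun h => ⟨h.1, h.2.2⟩, fun h => ⟨h.1, fun i => (h.1 i).le, h.2⟩⟩

theorem measurableSet_openCorner (n : ℕ) (μ : ℝ) : MeasurableSet (openCorner n μ) := by
  rw [← positive_inter_corner]
  exact (measurableSet_positive n).inter (measurableSet_corner n μ)

theorem halfLine_restrict : halfLine.restrict (Set.Ioi 0) = volume.restrict (Set.Ioi 0) := by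
  rw [halfLine, Measure.restrict_add, restrict_dirac' measurableSet_Ioi, if_neg (by simp),
    zero_add, Measure.restrict_restrict measurableSet_Ioi, Set.inter_self]

theorem pi_halfLine_restrict (n : ℕ) : (Measure.pi fun _ : Fin n => halfLine).restrict (positive n) =
    volume.restrict (positive n) := by
  have h1 : positive n = Set.pi Set.univ fun _ => Set.Ioi 0 := by
    ext x
    simp [positive]
  rw [h1, Measure.restrict_pi_pi, volume_pi, Measure.restrict_pi_pi]
  simp only [halfLine_restrict]

theorem pi_halfLine_restrict_openCorner (n : ℕ) (μ : ℝ) :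
    (Measure.pi fun _ : Fin n => halfLine).restrict (openCorner n μ) =
      volume.restrict (openCorner n μ) := by
  rw [← positive_inter_corner, Set.inter_comm, ← Measure.restrict_restrict (measurableSet_corner n μ),
    ← Measure.restrict_restrict (measurableSet_corner n μ), pi_halfLine_restrict]

/-- For c = 0 the density of X is the indicator of the positive half-line, so `lintegral_corner`
with all polynomials equal to X evaluates the volume as the functional at X^{n+1}. -/
theorem volume_openCorner (n : ℕ) {μ : ℝ} (hμ : 0 < μ) :
    volume (openCorner n μ) = ENNReal.ofReal (μ ^ n / (n.factorial : ℝ)) := by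
  have hX : ∀ k, 0 ≤ (X : ℝ[X]).coeff k := fun k => by rw [coeff_X]; split_ifs <;> simp
  have h := lintegral_corner 0 (fun _ : Fin n => (X : ℝ[X])) (fun _ => hX) hX (by simp) hμ
  have hf : ∀ m : ℝ, 0 < m → functional m X = 1 := fun m _ => by
    simpa using functional_X_pow_succ m 0
  have h1 : ∀ x ∈ corner n μ, (∏ i, density 0 X (x i)) * density 0 X (μ - ∑ i, x i) =
      (openCorner n μ).indicator 1 x := by
    intro x hx
    rw [density_of_pos 0 X (sub_pos.2 hx.2), hf _ (sub_pos.2 hx.2)]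
    by_cases hpos : ∀ i, 0 < x i
    · rw [Set.indicator_of_mem (show x ∈ openCorner n μ from ⟨hpos, hx.2⟩), Finset.prod_eq_one fun i _ => ?_]
      · simp
      · rw [density_of_pos 0 X (hpos i), hf _ (hpos i)]
        simp
    · rw [Set.indicator_of_notMem fun h => hpos h.1]
      push Not at hpos
      obtain ⟨i, hi⟩ := hpos
      rw [Finset.prod_eq_zero (Finset.mem_univ i), zero_mul]
      rw [density_of_nonpos 0 X hi]
      simp
  rw [setLIntegral_congr_fun (measurableSet_corner n μ) h1,
    lintegral_indicator_one (measurableSet_openCorner n μ),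
    Measure.restrict_apply (measurableSet_openCorner n μ), Set.inter_eq_left.2,
    ← Measure.restrict_apply_self, pi_halfLine_restrict_openCorner, Measure.restrict_apply_self,
    density_of_pos 0 _ hμ, Finset.prod_const, ← pow_succ, Finset.card_univ, Fintype.card_fin,
    functional_X_pow_succ] at h
  · simpa using h
  · rw [← positive_inter_corner]
    exact Set.inter_subset_right

/-- Only the open face has all coordinates positive. Its mass is the factor μ^{R-1} / (R - 1)! of
the theorem. -/
theorem faces_restrict_positive (n : ℕ) {μ : ℝ} (hμ : 0 < μ) :
    (faces (n + 1) μ).restrict (positive (n + 1)) =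
      ENNReal.ofReal (μ ^ n / (n.factorial : ℝ)) • simplexMeasure (n + 1) μ := by
  have hs1 : Measurable fun x : Fin n → ℝ =>
      (Fin.snoc (α := fun _ => ℝ) x (μ - ∑ i, x i) : Fin (n + 1) → ℝ) :=
    measurable_snoc (by fun_prop)
  have hs2 : Measurable fun x : Fin n → ℝ => (Fin.snoc (α := fun _ => ℝ) x 0 : Fin (n + 1) → ℝ) :=
    measurable_snoc (by fun_prop)
  have h2 : (fun x : Fin n → ℝ => (Fin.snoc (α := fun _ => ℝ) x 0 : Fin (n + 1) → ℝ)) ⁻¹'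
      positive (n + 1) = ∅ := by
    refine Set.eq_empty_of_forall_notMem fun x hx => ?_
    have := hx (Fin.last n)
    simp at this
  have h1 : (fun x : Fin n → ℝ => (Fin.snoc (α := fun _ => ℝ) x (μ - ∑ i, x i) :
      Fin (n + 1) → ℝ)) ⁻¹' positive (n + 1) ∩ corner n μ = openCorner n μ := by
    rw [← positive_inter_corner]
    ext x
    simp only [Set.mem_inter_iff, Set.mem_preimage, and_congr_left_iff]
    intro hx
    simp only [positive, Set.mem_ofPred_eq, Fin.forall_fin_succ', Fin.snoc_castSucc, Fin.snoc_last,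
      sub_pos, hx.2, and_true]
  rw [faces, Measure.restrict_add, Measure.restrict_map hs1 (measurableSet_positive _),
    Measure.restrict_map hs2 (measurableSet_positive _), h2, Measure.restrict_empty,
    Measure.map_zero, add_zero, Measure.restrict_restrict (hs1 (measurableSet_positive _)), h1,
    pi_halfLine_restrict_openCorner, ← volume_openCorner n hμ]
  change _ = volume (openCorner n μ) • Measure.map _ (cond volume (openCorner n μ))
  rw [ProbabilityTheory.cond, ← Measure.map_smul, smul_smul, ENNReal.mul_inv_cancel, one_smul]
  · rw [volume_openCorner n hμ]
    exact (ENNReal.ofReal_pos.2 (by positivity)).ne'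
  · rw [volume_openCorner n hμ]
    exact ENNReal.ofReal_ne_top

theorem isProbabilityMeasure_simplexMeasure (n : ℕ) {μ : ℝ} (hμ : 0 < μ) :
    IsProbabilityMeasure (simplexMeasure (n + 1) μ) := by
  have h1 : IsProbabilityMeasure (cond volume (openCorner n μ)) := by
    refine cond_isProbabilityMeasure_of_finite ?_ ?_
    · rw [volume_openCorner n hμ]
      exact (ENNReal.ofReal_pos.2 (by positivity)).ne'
    · rw [volume_openCorner n hμ]
      exact ENNReal.ofReal_ne_top
  change IsProbabilityMeasure (Measure.map _ (cond volume (openCorner n μ)))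
  exact Measure.isProbabilityMeasure_map (measurable_snoc (by fun_prop)).aemeasurable

theorem simplexMeasure_positive (n : ℕ) {μ : ℝ} (hμ : 0 < μ) :
    ∀ᵐ x ∂simplexMeasure (n + 1) μ, x ∈ positive (n + 1) := by
  have h1 : (simplexMeasure (n + 1) μ) ≪ (faces (n + 1) μ).restrict (positive (n + 1)) := by
    rw [faces_restrict_positive n hμ]
    exact Measure.absolutelyContinuous_smul (ENNReal.ofReal_pos.2 (by positivity)).ne'
  exact h1.ae_le (ae_restrict_mem (measurableSet_positive _))

end DividedPower

/-! ### Mixtures of local limits -/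

namespace PlaneTree

open DividedPower Polynomial

open Classical in
/-- The local limit for a positive parameter, the law of the critical tree for the others. -/
noncomputable def branchLaw (m : ℝ) : Measure PlaneTree :=
  if 0 < m then (nu m : Measure PlaneTree) else bgwMeasure

theorem branchLaw_of_pos {m : ℝ} (hm : 0 < m) : branchLaw m = (nu m : Measure PlaneTree) :=
  if_pos hm

theorem branchLaw_of_nonpos {m : ℝ} (hm : m ≤ 0) : branchLaw m = bgwMeasure := if_neg hm.not_gt

instance (m : ℝ) : IsProbabilityMeasure (branchLaw m) := by
  unfold branchLaw
  split_ifs <;> infer_instance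

/-- The dependence on K is through the power (1 + X)^K, so adding numbers of vertices corresponds to
multiplying polynomials. -/
theorem aCoef_eq (m : ℝ) (K : ℕ) :
    aCoef m K = 2 * (1 / 2) ^ K * functional m ((1 + X) ^ K) := by
  rw [aCoef, add_comm (1 : ℝ[X]), add_pow, map_sum, Finset.sum_range_succ']
  simp only [one_pow, mul_one, pow_zero, one_mul]
  congr 1
  rw [show ((K.choose 0 : ℕ) : ℝ[X]) = C ((K.choose 0 : ℕ) : ℝ) by simp, functional_C, add_zero]
  refine Finset.sum_congr rfl fun j _ => ?_
  rw [mul_comm (X ^ (j + 1)), ← C_eq_natCast, C_mul', map_smul, functional_X_pow_succ, smul_eq_mul]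

theorem coeff_one_add_X_pow_nonneg (K n : ℕ) : 0 ≤ ((1 + X : ℝ[X]) ^ K).coeff n := by
  rw [coeff_one_add_X_pow]
  positivity

/-- One formula covers both laws: the constant term 1 of (1 + X)^K, the atom at m = 0, reproduces
the ball probabilities of ρ. -/
theorem branchLaw_agree (m : ℝ) (n : ℕ) (t : PlaneTree) : branchLaw m {T | Agree n T t} =
    ENNReal.ofReal (2 * (1 / 4) ^ below n t * (1 / 2) ^ top n t) *
      density n ((1 + X) ^ top n t) m := by
  rcases lt_or_ge 0 m with hm | hm
  · rw [branchLaw_of_pos hm, nu_agree hm, density_of_pos _ _ hm, localProb, aCoef_eq,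
      ← ENNReal.ofReal_mul (by positivity)]
    congr 1
    rw [← Real.exp_nat_mul, neg_mul, mul_neg]
    ring
  · rw [branchLaw_of_nonpos hm, bgwMeasure_agree, density_of_nonpos _ _ hm]
    simp [coeff_one_add_X_pow]

/-- The law of a family of independent branches. -/
noncomputable def branchesLaw {n : ℕ} (m : Fin n → ℝ) : Measure (Fin n → PlaneTree) :=
  Measure.pi fun i => branchLaw (m i)

instance {n : ℕ} (m : Fin n → ℝ) : IsProbabilityMeasure (branchesLaw m) := by
  unfold branchesLaw
  infer_instance

theorem branchesLaw_closedBall {n : ℕ} (m : Fin n → ℝ) (k : ℕ) (t : Fin n → PlaneTree) :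
    branchesLaw m (Metric.closedBall t (1 / ((k : ℝ) + 1))) =
      ∏ i, branchLaw (m i) {T | Agree k T (t i)} := by
  rw [branchesLaw, closedBall_pi _ (by positivity), Measure.pi_pi]
  simp only [closedBall_eq]

theorem measurable_branchesLaw {n : ℕ} : Measurable (branchesLaw (n := n)) := by
  refine Measurable.measure_of_isPiSystem_of_isProbabilityMeasure (generateFrom_closedBall 0)
    (isPiSystem_closedBall 0) ?_
  rintro _ ⟨k, -, t, rfl⟩
  simp only [branchesLaw_closedBall, branchLaw_agree]
  refine Finset.measurable_prod _ fun i _ => Measurable.const_mul ?_ _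
  exact (measurable_density _ _).comp (measurable_pi_apply i)

/-- The mixture of the laws of independent branches over all faces of the simplex. -/
noncomputable def fullMixture (n : ℕ) (μ : ℝ) : Measure (Fin n → PlaneTree) :=
  (faces n μ).bind branchesLaw

/-- The polynomials of the branches multiply to (1 + X) to the total number of top vertices, so
`lintegral_faces` leaves only the totals, as for a ball around a grafted tree. -/
theorem fullMixture_closedBall {n : ℕ} {μ : ℝ} (hμ : 0 < μ) (k : ℕ) (t : Fin n → PlaneTree) :
    fullMixture n μ (Metric.closedBall t (1 / ((k : ℝ) + 1))) =
      ENNReal.ofReal (Real.exp (-μ) ^ k * (2 ^ n / 2 * (1 / 4) ^ (∑ i, below k (t i)) *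
        aCoef μ (∑ i, top k (t i)))) := by
  rw [fullMixture, Measure.bind_apply Metric.isClosed_closedBall.measurableSet
    measurable_branchesLaw.aemeasurable]
  simp only [branchesLaw_closedBall, branchLaw_agree, Finset.prod_mul_distrib]
  have hmeas : Measurable fun x : Fin n → ℝ => ∏ i, density k ((1 + X) ^ top k (t i)) (x i) :=
    Finset.measurable_prod _ fun i _ => (measurable_density _ _).comp (measurable_pi_apply i)
  rw [lintegral_const_mul _ hmeas, lintegral_faces _ _ (fun i => coeff_one_add_X_pow_nonneg _) hμ,
    ← ENNReal.ofReal_prod_of_nonneg fun i _ => by positivity, ← ENNReal.ofReal_mul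
      (Finset.prod_nonneg fun i _ => by positivity)]
  congr 1
  rw [Finset.prod_pow_eq_pow_sum, aCoef_eq, Finset.prod_mul_distrib, Finset.prod_mul_distrib,
    Finset.prod_pow_eq_pow_sum, Finset.prod_pow_eq_pow_sum, Finset.prod_const, Finset.card_univ,
    Fintype.card_fin, ← Real.exp_nat_mul, neg_mul, mul_neg]
  ring

theorem branchesLaw_of_positive {n : ℕ} {m : Fin n → ℝ} (hm : m ∈ positive n) :
    branchesLaw m = Measure.pi fun i => (nu (m i) : Measure PlaneTree) := by
  unfold branchesLaw
  congr 1
  funext i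
  exact branchLaw_of_pos (hm i)

theorem mixedMeasure_eq_bind (n : ℕ) {μ : ℝ} (hμ : 0 < μ) :
    mixedMeasure (n + 1) μ = (simplexMeasure (n + 1) μ).bind branchesLaw := by
  rw [mixedMeasure, Measure.bind, Measure.bind]
  congr 1
  refine Measure.map_congr ?_
  filter_upwards [simplexMeasure_positive n hμ] with m hm
  exact (branchesLaw_of_positive hm).symm

theorem isProbabilityMeasure_mixedMeasure (n : ℕ) {μ : ℝ} (hμ : 0 < μ) :
    IsProbabilityMeasure (mixedMeasure (n + 1) μ) := by
  have := isProbabilityMeasure_simplexMeasure n hμ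
  constructor
  rw [mixedMeasure_eq_bind n hμ, Measure.bind_apply MeasurableSet.univ
    measurable_branchesLaw.aemeasurable]
  simp

/-- The families of infinite trees. -/
def infFamilies (n : ℕ) : Set (Fin n → PlaneTree) := {x | ∀ i, (x i).nodes.Infinite}

theorem infFamilies_eq_pi (n : ℕ) :
    infFamilies n = Set.pi Set.univ fun _ => {T : PlaneTree | T.nodes.Finite}ᶜ := by
  ext x
  simp only [infFamilies, Set.mem_pi, Set.mem_univ, true_implies]
  exact Iff.rfl

theorem measurableSet_infFamilies (n : ℕ) : MeasurableSet (infFamilies n) := by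
  rw [infFamilies_eq_pi]
  exact MeasurableSet.univ_pi fun _ => measurableSet_finTree.compl

/-- A positive parameter gives an infinite tree almost surely, parameter zero a finite one; hence
infinite branches single out the open face. -/
theorem branchesLaw_infFamilies {n : ℕ} (m : Fin n → ℝ) :
    (m ∈ positive n → branchesLaw m (infFamilies n)ᶜ = 0) ∧
      (m ∉ positive n → branchesLaw m (infFamilies n) = 0) := by
  have h1 : branchesLaw m (infFamilies n) = ∏ i, branchLaw (m i) {T : PlaneTree | T.nodes.Finite}ᶜ := by
    rw [infFamilies_eq_pi, branchesLaw, Measure.pi_pi]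
  constructor
  · intro hm
    rw [prob_compl_eq_zero_iff (measurableSet_infFamilies n), h1]
    refine Finset.prod_eq_one fun i _ => ?_
    rw [prob_compl_eq_one_iff measurableSet_finTree, branchLaw_of_pos (hm i), nu_finTree (hm i)]
  · intro hm
    simp only [positive, Set.mem_ofPred_eq, not_forall, not_lt] at hm
    obtain ⟨i, hi⟩ := hm
    rw [h1, Finset.prod_eq_zero (Finset.mem_univ i)]
    rw [branchLaw_of_nonpos hi]
    exact bgwMeasure_infTree

theorem fullMixture_inter_infFamilies (n : ℕ) {μ : ℝ} (hμ : 0 < μ) {A : Set (Fin (n + 1) → PlaneTree)}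
    (hA : MeasurableSet A) : fullMixture (n + 1) μ (A ∩ infFamilies (n + 1)) =
      ENNReal.ofReal (μ ^ n / (n.factorial : ℝ)) * mixedMeasure (n + 1) μ A := by
  rw [fullMixture, Measure.bind_apply (hA.inter (measurableSet_infFamilies _))
    measurable_branchesLaw.aemeasurable, mixedMeasure_eq_bind n hμ,
    Measure.bind_apply hA measurable_branchesLaw.aemeasurable, ← smul_eq_mul,
    ← lintegral_smul_measure, ← faces_restrict_positive n hμ,
    ← lintegral_indicator (measurableSet_positive _)]
  refine lintegral_congr fun m => ?_
  by_cases hm : m ∈ positive (n + 1)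
  · rw [Set.indicator_of_mem hm]
    exact measure_inter_conull ((branchesLaw_infFamilies m).1 hm)
  · rw [Set.indicator_of_notMem hm]
    exact measure_mono_null Set.inter_subset_right ((branchesLaw_infFamilies m).2 hm)

end PlaneTree

/-! ### Interleaving lists -/

namespace List

variable {α β γ : Type*}

/-- The list `f 0 ++ [x 0] ++ f 1 ++ ⋯ ++ [x (k - 1)] ++ f k`. -/
def weave : List α → (ℕ → List α) → List α
  | [], f => f 0
  | x :: xs, f => f 0 ++ x :: weave xs fun n => f (n + 1)

theorem weave_congr {xs : List α} {f g : ℕ → List α} (h : ∀ n ≤ xs.length, f n = g n) :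
    weave xs f = weave xs g := by
  induction xs generalizing f g with
  | nil => exact h 0 le_rfl
  | cons x xs ih =>
    rw [weave, weave, h 0 (Nat.zero_le _), ih fun n hn => h (n + 1) (by simpa using hn)]

theorem map_weave (φ : α → β) (xs : List α) (f : ℕ → List α) :
    (weave xs f).map φ = weave (xs.map φ) fun n => (f n).map φ := by
  induction xs generalizing f with
  | nil => rfl
  | cons x xs ih => simp [weave, ih]

theorem weave_range_map (k : ℕ) (x : ℕ → α) (f : ℕ → List α) :
    weave ((range k).map x) f = (range k).flatMap (fun n => f n ++ [x n]) ++ f k := by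
  induction k generalizing x f with
  | zero => simp [weave]
  | succ k ih =>
    rw [range_succ_eq_map, map_cons, weave, map_map, flatMap_cons, flatMap_map]
    have := ih (x ∘ Nat.succ) fun n => f (n + 1)
    rw [this]
    simp [Nat.succ_eq_add_one]

theorem sum_weave (xs : List ℕ) (f : ℕ → List ℕ) :
    (weave xs f).sum = ∑ n ∈ Finset.range (xs.length + 1), (f n).sum + xs.sum := by
  induction xs generalizing f with
  | nil => simp [weave]
  | cons x xs ih =>
    rw [weave, sum_append, sum_cons, ih, length_cons, Finset.sum_range_succ' _ (xs.length + 1),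
      sum_cons]
    ring

theorem forall₂_weave {R : α → β → Prop} {xs : List α} {ys : List β} (h : Forall₂ R xs ys)
    {f : ℕ → List α} {g : ℕ → List β} (hfg : ∀ n ≤ ys.length, Forall₂ R (f n) (g n)) :
    Forall₂ R (weave xs f) (weave ys g) := by
  induction h generalizing f g with
  | nil => exact hfg 0 le_rfl
  | cons hx _ ih =>
    exact rel_append (hfg 0 (Nat.zero_le _)) (Forall₂.cons hx
      (ih fun n hn => hfg (n + 1) (by simpa using hn)))

theorem forall₂_append_right {R : α → β → Prop} {L : List α} {l₁ l₂ : List β}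
    (h : Forall₂ R L (l₁ ++ l₂)) : ∃ L₁ L₂, L = L₁ ++ L₂ ∧ Forall₂ R L₁ l₁ ∧ Forall₂ R L₂ l₂ :=
  ⟨L.take l₁.length, L.drop l₁.length, (take_append_drop _ _).symm,
    by simpa using forall₂_take_append L l₁ l₂ h, by simpa using forall₂_drop_append L l₁ l₂ h⟩

theorem exists_eq_weave_of_forall₂ {R : α → β → Prop} {ys : List β} {g : ℕ → List β} {L : List α}
    (h : Forall₂ R L (weave ys g)) : ∃ xs f, L = weave xs f ∧ Forall₂ R xs ys ∧
      ∀ n ≤ ys.length, Forall₂ R (f n) (g n) := by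
  induction ys generalizing g L with
  | nil =>
    refine ⟨[], fun _ => L, rfl, Forall₂.nil, fun n hn => ?_⟩
    rw [Nat.le_zero.1 hn]
    exact h
  | cons y ys ih =>
    obtain ⟨L₁, L₂, rfl, h₁, h₂⟩ := forall₂_append_right h
    rcases L₂ with _ | ⟨x, L₂⟩
    · simp at h₂
    rw [forall₂_cons] at h₂
    obtain ⟨xs, f, rfl, hxs, hf⟩ := ih h₂.2
    refine ⟨x :: xs, fun n => n.casesOn L₁ f, rfl, Forall₂.cons h₂.1 hxs, fun n hn => ?_⟩
    rcases n with _ | n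
    · exact h₁
    · exact hf n (by simpa using hn)

theorem forall₂_weave_iff {R : α → β → Prop} {xs : List α} {ys : List β} {f : ℕ → List α}
    {g : ℕ → List β} (hlen : xs.length = ys.length)
    (hfg : ∀ n ≤ xs.length, (f n).length = (g n).length) :
    Forall₂ R (weave xs f) (weave ys g) ↔
      Forall₂ R xs ys ∧ ∀ n ≤ xs.length, Forall₂ R (f n) (g n) := by
  refine ⟨fun h => ?_, fun h => forall₂_weave h.1 fun n hn => h.2 n (by omega)⟩
  induction xs generalizing ys f g with
  | nil =>
    obtain rfl : ys = [] := eq_nil_of_length_eq_zero hlen.symm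
    refine ⟨Forall₂.nil, fun n hn => ?_⟩
    rw [Nat.le_zero.1 hn]
    exact h
  | cons x xs ih =>
    rcases ys with _ | ⟨y, ys⟩
    · simp at hlen
    rw [weave, weave] at h
    have h1 : Forall₂ R (f 0) (g 0) := by
      have := forall₂_take (f 0).length h
      rwa [take_left, hfg 0 (Nat.zero_le _), take_left] at this
    have h2 := forall₂_drop (f 0).length h
    rw [drop_left, hfg 0 (Nat.zero_le _), drop_left, forall₂_cons] at h2
    obtain ⟨h3, h4⟩ := ih (by simpa using hlen) (fun n hn => hfg (n + 1) (by simpa using hn)) h2.2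
    refine ⟨Forall₂.cons h2.1 h3, fun n hn => ?_⟩
    rcases n with _ | n
    · exact h1
    · exact h4 n (by simpa using hn)

theorem filter_weave (p : α → Bool) {xs : List α} {f : ℕ → List α} (hxs : ∀ x ∈ xs, p x = true)
    (hf : ∀ n ≤ xs.length, ∀ a ∈ f n, p a = false) : (weave xs f).filter p = xs := by
  induction xs generalizing f with
  | nil => exact filter_eq_nil_iff.2 fun a ha => by simp [hf 0 le_rfl a ha]
  | cons x xs ih =>
    rw [weave, filter_append, filter_eq_nil_iff.2 fun a ha => by simp [hf 0 (Nat.zero_le _) a ha],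
      nil_append, filter_cons_of_pos (hxs x (by simp)),
      ih (fun x hx => hxs x (by simp [hx])) fun n hn => hf (n + 1) (by simpa using hn)]

theorem exists_eq_weave_filter (p : α → Bool) (L : List α) : ∃ f : ℕ → List α,
    L = weave (L.filter p) f ∧ ∀ n ≤ (L.filter p).length, ∀ a ∈ f n, p a = false := by
  induction L with
  | nil => exact ⟨fun _ => [], rfl, by simp⟩
  | cons a L ih =>
    obtain ⟨f, hL, hf⟩ := ih
    by_cases ha : p a = true
    · refine ⟨fun n => n.casesOn [] f, ?_, ?_⟩
      · rw [filter_cons_of_pos ha, weave, ← hL]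
        rfl
      · rw [filter_cons_of_pos ha]
        intro n hn b hb
        rcases n with _ | n
        · simp at hb
        · exact hf n (by simpa using hn) b hb
    · refine ⟨fun n => n.casesOn (a :: f 0) fun n => f (n + 1), ?_, ?_⟩
      · rw [filter_cons_of_neg ha]
        rcases h : L.filter p with _ | ⟨x, xs⟩
        · rw [h, weave] at hL
          conv_lhs => rw [hL]
          rfl
        · rw [h, weave] at hL
          conv_lhs => rw [hL]
          rfl
      · rw [filter_cons_of_neg ha]
        intro n hn b hb
        rcases n with _ | n
        · rcases mem_cons.1 hb with rfl | hb
          · simpa using ha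
          · exact hf 0 hn b hb
        · exact hf (n + 1) hn b hb

/-- When p holds on the woven entries and fails in the gaps, filtering recovers the entries, and the
gaps are the pieces between them. For p = "infinite" this makes the decomposition along the spine
unique. -/
theorem weave_inj (p : α → Bool) {xs ys : List α} {f g : ℕ → List α} (hxs : ∀ x ∈ xs, p x = true)
    (hys : ∀ y ∈ ys, p y = true) (hf : ∀ n ≤ xs.length, ∀ a ∈ f n, p a = false)
    (hg : ∀ n ≤ ys.length, ∀ a ∈ g n, p a = false) (h : weave xs f = weave ys g) :
    xs = ys ∧ ∀ n ≤ xs.length, f n = g n := by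
  obtain rfl : xs = ys := by rw [← filter_weave p hxs hf, h, filter_weave p hys hg]
  refine ⟨rfl, ?_⟩
  induction xs generalizing f g with
  | nil =>
    intro n hn
    rw [Nat.le_zero.1 hn]
    exact h
  | cons x xs ih =>
    rw [weave, weave] at h
    have key : ∀ (l l' : List α), (∀ a ∈ l, p a = false) → (∀ a ∈ l', p a = false) →
        ∀ m m', l ++ x :: m = l' ++ x :: m' → l = l' ∧ m = m' := by
      intro l
      induction l with
      | nil =>
        intro l' _ hl' m m' he
        rcases l' with _ | ⟨a, l'⟩
        · simpa using he
        · have h1 := hl' a (by simp)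
          have h2 := hxs x (by simp)
          simp only [nil_append, cons_append, cons.injEq] at he
          rw [he.1, h1] at h2
          simp at h2
      | cons a l ihl =>
        intro l' hl hl' m m' he
        rcases l' with _ | ⟨a', l'⟩
        · have h1 := hl a (by simp)
          have h2 := hxs x (by simp)
          simp only [nil_append, cons_append, cons.injEq] at he
          rw [← he.1, h1] at h2
          simp at h2
        · simp only [cons_append, cons.injEq] at he
          obtain ⟨h1, h2⟩ := ihl l' (fun b hb => hl b (by simp [hb])) (fun b hb => hl' b (by simp [hb]))
            m m' he.2
          exact ⟨by rw [he.1, h1], h2⟩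
    obtain ⟨h1, h2⟩ := key _ _ (hf 0 (Nat.zero_le _)) (hg 0 (Nat.zero_le _)) _ _ h
    have h3 := ih (f := fun n => f (n + 1)) (g := fun n => g (n + 1))
      (fun y hy => hxs y (by simp [hy])) (fun n hn => hf (n + 1) (by simpa using hn))
      (fun y hy => hys y (by simp [hy])) (fun n hn => hg (n + 1) (by simpa using hn)) h2
    intro n hn
    rcases n with _ | n
    · exact h1
    · exact h3 n (by simpa using hn)

end List

/-! ### Grafting -/

namespace PlaneTree

theorem numKids_sub (T : PlaneTree) (j : ℕ) (w : List ℕ) :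
    (T.sub j).numKids w = T.numKids (j :: w) := by
  have : ∀ i, w ++ [i] ∈ (T.sub j).nodes ↔ (j :: w) ++ [i] ∈ T.nodes := fun i => by
    change w ++ [i] = [] ∨ j :: (w ++ [i]) ∈ T.nodes ↔ _
    simp
  simp only [numKids, this]

theorem mem_sub {T : PlaneTree} {j : ℕ} (hj : j < T.numKids []) {w : List ℕ} :
    w ∈ (T.sub j).nodes ↔ j :: w ∈ T.nodes := by
  change w = [] ∨ j :: w ∈ T.nodes ↔ _
  refine ⟨fun h => ?_, Or.inr⟩
  rcases h with rfl | h
  · exact singleton_mem_iff.2 hj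
  · exact h

theorem slots_eq_weave (T₀ : PlaneTree) (b : List ℕ → ℕ → PlaneTree) (p : List ℕ) :
    slots T₀ b p = List.weave ((List.range (T₀.numKids p)).map Sum.inl)
      fun n => (List.range ((b p n).numKids [])).map fun c => Sum.inr (n, c) :=
  (List.weave_range_map _ _ _).symm

theorem slots_sub (T₀ : PlaneTree) (b : List ℕ → ℕ → PlaneTree) (j : ℕ) (p : List ℕ) :
    slots (T₀.sub j) (fun p => b (j :: p)) p = slots T₀ b (j :: p) := by
  rw [slots_eq_weave, slots_eq_weave, numKids_sub]

theorem graftMem_sub (T₀ : PlaneTree) (b : List ℕ → ℕ → PlaneTree) (j : ℕ) (p w : List ℕ) :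
    graftMem (T₀.sub j) (fun p => b (j :: p)) p w ↔ graftMem T₀ b (j :: p) w := by
  induction w generalizing p with
  | nil => simp [graftMem]
  | cons x w ih =>
    rw [graftMem, graftMem, slots_sub]
    rcases (slots T₀ b (j :: p))[x]? with _ | (n | ⟨n, c⟩)
    · rfl
    · exact ih _
    · rfl

/-- The recursive form of grafting: subtrees of T₀, themselves grafted, interleaved with the
subtrees of the branches in the sectors at `[]`. The inductions below use this form only. -/
theorem graft_eq (T₀ : PlaneTree) (b : List ℕ → ℕ → PlaneTree) : graft T₀ b =
    node (List.weave ((List.range (T₀.numKids [])).map fun j =>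
      graft (T₀.sub j) fun p => b (j :: p)) fun n => kids (b [] n)) := by
  let val : ℕ ⊕ ℕ × ℕ → PlaneTree := fun s => match s with
    | Sum.inl n => graft (T₀.sub n) fun p => b (n :: p)
    | Sum.inr (n, c) => (b [] n).sub c
  have h1 : List.weave ((List.range (T₀.numKids [])).map fun j =>
      graft (T₀.sub j) fun p => b (j :: p)) (fun n => kids (b [] n)) = (slots T₀ b []).map val := by
    rw [slots_eq_weave, List.map_weave, List.map_map]
    congr 1
    funext n
    rw [List.map_map, kids]
    rfl
  rw [h1]
  ext w
  rcases w with _ | ⟨x, w⟩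
  · simp [root_mem]
  rw [cons_mem_node, List.getElem?_map]
  change graftMem T₀ b [] (x :: w) ↔ _
  rw [graftMem]
  rcases hx : (slots T₀ b [])[x]? with _ | (n | ⟨n, c⟩)
  · simp
  · simp only [Option.map_some, Option.some.injEq, exists_eq_left', List.nil_append]
    exact (graftMem_sub T₀ b n [] w).symm
  · simp only [Option.map_some, Option.some.injEq, exists_eq_left']
    have := mem_of_slot hx
    change _ ↔ w = [] ∨ c :: w ∈ (b [] n).nodes
    refine ⟨Or.inr, ?_⟩
    rintro (rfl | h)
    · exact this
    · exact h

theorem kids_graft (T₀ : PlaneTree) (b : List ℕ → ℕ → PlaneTree) : kids (graft T₀ b) =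
    List.weave ((List.range (T₀.numKids [])).map fun j =>
      graft (T₀.sub j) fun p => b (j :: p)) fun n => kids (b [] n) := by
  rw [graft_eq, kids_node]

theorem graft_of_numKids_eq_zero {T₀ : PlaneTree} (h : T₀.numKids [] = 0)
    (b : List ℕ → ℕ → PlaneTree) : graft T₀ b = b [] 0 := by
  rw [graft_eq, h]
  exact node_kids _

/-- All leaves of the tree are at height `h + 1`. -/
def Level : ℕ → PlaneTree → Prop
  | 0, T => T.numKids [] = 0
  | h + 1, T => T.numKids [] ≠ 0 ∧ ∀ j < T.numKids [], Level h (T.sub j)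

/-- The vertex `p` is a leaf. -/
def IsLeaf (T : PlaneTree) (p : List ℕ) : Prop := p ∈ T.nodes ∧ T.numKids p = 0

/-- There is a sector `n` at `p`, and `p` is not a leaf. -/
def IsInner (T : PlaneTree) (p : List ℕ) (n : ℕ) : Prop :=
  p ∈ T.nodes ∧ T.numKids p ≠ 0 ∧ n ≤ T.numKids p

theorem isLeaf_cons {T : PlaneTree} {j : ℕ} (hj : j < T.numKids []) {p : List ℕ} :
    IsLeaf T (j :: p) ↔ IsLeaf (T.sub j) p := by
  rw [IsLeaf, IsLeaf, mem_sub hj, numKids_sub]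

theorem isInner_cons {T : PlaneTree} {j : ℕ} (hj : j < T.numKids []) {p : List ℕ} {n : ℕ} :
    IsInner T (j :: p) n ↔ IsInner (T.sub j) p n := by
  rw [IsInner, IsInner, mem_sub hj, numKids_sub]

theorem isInner_nil {T : PlaneTree} (h : T.numKids [] ≠ 0) {n : ℕ} :
    IsInner T [] n ↔ n ≤ T.numKids [] := by
  simp [IsInner, root_mem, h]

theorem isLeaf_nil {T : PlaneTree} : IsLeaf T [] ↔ T.numKids [] = 0 := by
  simp [IsLeaf, root_mem]

theorem lt_numKids_of_cons_mem {T : PlaneTree} {j : ℕ} {w : List ℕ} (h : j :: w ∈ T.nodes) :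
    j < T.numKids [] := singleton_mem_iff.1 (singleton_mem_of_cons h)

/-- The leaves lift their branches by h levels, so agreement of order k suffices there; branches at
lower vertices are lifted less and are compared up to order k + h. -/
theorem agree_graft {h k : ℕ} {T₀ : PlaneTree} (hT₀ : Level h T₀) {b b' : List ℕ → ℕ → PlaneTree}
    (hleaf : ∀ p, IsLeaf T₀ p → Agree k (b p 0) (b' p 0))
    (hinner : ∀ p n, IsInner T₀ p n → Agree (k + h) (b p n) (b' p n)) :
    Agree (k + h) (graft T₀ b) (graft T₀ b') := by
  induction h generalizing T₀ b b' with
  | zero =>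
    rw [graft_of_numKids_eq_zero hT₀, graft_of_numKids_eq_zero hT₀]
    exact hleaf [] (isLeaf_nil.2 hT₀)
  | succ h ih =>
    rw [← add_assoc, agree_succ, kids_graft, kids_graft]
    refine List.forall₂_weave ?_ fun n hn => ?_
    · rw [List.forall₂_map_left_iff, List.forall₂_map_right_iff, List.forall₂_same]
      intro j hj
      rw [List.mem_range] at hj
      exact ih (hT₀.2 j hj) (fun p hp => hleaf _ ((isLeaf_cons hj).2 hp))
        fun p n hn => (hinner _ n ((isInner_cons hj).2 hn)).mono (by omega)
    · rw [← agree_succ]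
      exact hinner [] n ((isInner_nil hT₀.1).2 (by simpa using hn))

theorem graft_congr {h : ℕ} {T₀ : PlaneTree} (hT₀ : Level h T₀) {b b' : List ℕ → ℕ → PlaneTree}
    (hleaf : ∀ p, IsLeaf T₀ p → b p 0 = b' p 0) (hinner : ∀ p n, IsInner T₀ p n → b p n = b' p n) :
    graft T₀ b = graft T₀ b' :=
  eq_of_forall_agree fun k => (agree_graft (k := k) hT₀ (fun p hp => by rw [hleaf p hp]; rfl)
    fun p n hp => by rw [hinner p n hp]; rfl).mono (Nat.le_add_right k h)

/-- Trees close to a grafted tree are grafted trees with the same finite branches. -/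
theorem exists_eq_graft {h k : ℕ} {T₀ T : PlaneTree} (hT₀ : Level h T₀) (hk : 1 ≤ k)
    {b : List ℕ → ℕ → PlaneTree} (hinner : ∀ p n, IsInner T₀ p n → HeightLE k (b p n))
    (hT : Agree (k + h) T (graft T₀ b)) : ∃ b', (∀ p n, IsInner T₀ p n → b' p n = b p n) ∧
      (∀ p, IsLeaf T₀ p → Agree k (b' p 0) (b p 0)) ∧ T = graft T₀ b' := by
  induction h generalizing T₀ T b with
  | zero =>
    rw [graft_of_numKids_eq_zero hT₀] at hT
    refine ⟨fun _ _ => T, ?_, ?_, (graft_of_numKids_eq_zero hT₀ fun _ _ => T).symm⟩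
    · rintro p n ⟨hp, hp', -⟩
      rcases p with _ | ⟨j, p⟩
      · exact absurd hT₀ hp'
      · exact absurd (lt_numKids_of_cons_mem hp) (by rw [hT₀]; omega)
    · rintro p ⟨hp, -⟩
      rcases p with _ | ⟨j, p⟩
      · exact hT
      · exact absurd (lt_numKids_of_cons_mem hp) (by rw [hT₀]; omega)
  | succ h ih =>
    rw [← add_assoc, agree_succ, kids_graft] at hT
    obtain ⟨xs, f, hL, hxs, hf⟩ := List.exists_eq_weave_of_forall₂ hT
    rw [List.forall₂_iff_get] at hxs
    have hlen : xs.length = T₀.numKids [] := by simpa using hxs.1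
    have hex : ∀ j (hj : j < T₀.numKids []), ∃ b', (∀ p n, IsInner (T₀.sub j) p n →
        b' p n = b (j :: p) n) ∧ (∀ p, IsLeaf (T₀.sub j) p → Agree k (b' p 0) (b (j :: p) 0)) ∧
        xs[j]'(hlen ▸ hj) = graft (T₀.sub j) b' := by
      intro j hj
      have h1 := hxs.2 j (hlen ▸ hj) (by simpa using hj)
      simp only [List.get_eq_getElem, List.getElem_map, List.getElem_range] at h1
      exact ih (hT₀.2 j hj) (fun p n hn => hinner _ n ((isInner_cons hj).2 hn)) h1
    choose c hc using hex
    let b' : List ℕ → ℕ → PlaneTree := fun p n => match p with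
      | [] => b [] n
      | j :: p => if hj : j < T₀.numKids [] then c j hj p n else T
    refine ⟨b', ?_, ?_, ?_⟩
    · intro p n hp
      rcases p with _ | ⟨j, p⟩
      · rfl
      · have hj := lt_numKids_of_cons_mem hp.1
        simp only [b', hj, dite_true]
        exact (hc j hj).1 p n ((isInner_cons hj).1 hp)
    · intro p hp
      rcases p with _ | ⟨j, p⟩
      · exact absurd (isLeaf_nil.1 hp) hT₀.1
      · have hj := lt_numKids_of_cons_mem hp.1
        simp only [b', hj, dite_true]
        exact (hc j hj).2.1 p ((isLeaf_cons hj).1 hp)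
    · rw [graft_eq, ← node_kids T, hL]
      congr 1
      have h1 : xs = (List.range (T₀.numKids [])).map fun j =>
          graft (T₀.sub j) fun p => b' (j :: p) := by
        refine List.ext_getElem (by simp [hlen]) fun j h1 h2 => ?_
        have hj : j < T₀.numKids [] := hlen ▸ h1
        rw [(hc j hj).2.2]
        simp [b', hj]
      rw [← h1]
      refine List.weave_congr fun n hn => ?_
      have h2 := hf n (by simpa [hlen] using hn)
      change f n = kids (b [] n)
      have h3 := hinner [] n ((isInner_nil hT₀.1).2 (by omega))
      obtain ⟨k, rfl⟩ : ∃ k', k = k' + 1 := ⟨k - 1, by omega⟩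
      rw [heightLE_succ] at h3
      rw [← List.forall₂_eq_eq_eq]
      rw [List.forall₂_iff_get] at h2 ⊢
      refine ⟨h2.1, fun i h4 h5 => ?_⟩
      -- The comparison reaches beyond the height of the branch in this sector and hence determines
      -- it completely.
      exact eq_of_agree_of_heightLE' ((h2.2 i h4 h5).mono (by omega : k + 1 ≤ k + 1 + h))
        (heightLE_mono (Nat.le_succ k) (h3 _ (List.get_mem _ _)))

theorem agree_of_agree_graft {h k : ℕ} {T₀ : PlaneTree} (hT₀ : Level h T₀)
    {b b' : List ℕ → ℕ → PlaneTree} (hinner : ∀ p n, IsInner T₀ p n → b p n = b' p n)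
    (hagree : Agree (k + h) (graft T₀ b) (graft T₀ b')) {p : List ℕ} (hp : IsLeaf T₀ p) :
    Agree k (b p 0) (b' p 0) := by
  induction h generalizing T₀ b b' p with
  | zero =>
    rw [graft_of_numKids_eq_zero hT₀, graft_of_numKids_eq_zero hT₀] at hagree
    rcases p with _ | ⟨j, p⟩
    · exact hagree
    · exact absurd (lt_numKids_of_cons_mem hp.1) (by rw [hT₀]; omega)
  | succ h ih =>
    rw [← add_assoc, agree_succ, kids_graft, kids_graft, List.forall₂_weave_iff (by simp)] at hagree
    · rcases p with _ | ⟨j, p⟩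
      · exact absurd (isLeaf_nil.1 hp) hT₀.1
      · have hj := lt_numKids_of_cons_mem hp.1
        have h1 := hagree.1
        rw [List.forall₂_map_left_iff, List.forall₂_map_right_iff, List.forall₂_same] at h1
        exact ih (hT₀.2 j hj) (fun p n hn => hinner _ n ((isInner_cons hj).2 hn))
          (h1 j (List.mem_range.2 hj)) ((isLeaf_cons hj).1 hp)
    · intro n hn
      rw [hinner [] n ((isInner_nil hT₀.1).2 (by simpa using hn))]

end PlaneTree

namespace PlaneTree

/-! ### Levels of a grafted tree -/

theorem consInjective {α : Type*} (a : α) : Function.Injective (List.cons a) :=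
  fun _ _ h => by simpa using h

/-- The leaves of a tree all of whose leaves are at height `h + 1`. -/
noncomputable def leaves : ℕ → PlaneTree → Finset (List ℕ)
  | 0, _ => {[]}
  | h + 1, T => (Finset.range (T.numKids [])).biUnion fun j =>
      (leaves h (T.sub j)).map ⟨_, consInjective j⟩

theorem mem_leaves {h : ℕ} {T : PlaneTree} (hT : Level h T) {p : List ℕ} :
    p ∈ leaves h T ↔ IsLeaf T p := by
  induction h generalizing T p with
  | zero =>
    rcases p with _ | ⟨j, p⟩
    · simp [leaves, isLeaf_nil, show T.numKids [] = 0 from hT]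
    · simp only [leaves, Finset.mem_singleton, reduceCtorEq, false_iff]
      intro hp
      have := lt_numKids_of_cons_mem hp.1
      rw [show T.numKids [] = 0 from hT] at this
      omega
  | succ h ih =>
    simp only [leaves, Finset.mem_biUnion, Finset.mem_range, Finset.mem_map,
      Function.Embedding.coeFn_mk]
    constructor
    · rintro ⟨j, hj, q, hq, rfl⟩
      exact (isLeaf_cons hj).2 ((ih (hT.2 j hj)).1 hq)
    · intro hp
      rcases p with _ | ⟨j, p⟩
      · exact absurd (isLeaf_nil.1 hp) hT.1
      · have hj := lt_numKids_of_cons_mem hp.1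
        exact ⟨j, hj, p, (ih (hT.2 j hj)).2 ((isLeaf_cons hj).1 hp), rfl⟩

theorem sum_leaves_succ (h : ℕ) (T : PlaneTree) (f : List ℕ → ℕ) : ∑ p ∈ leaves (h + 1) T, f p =
    ∑ j ∈ Finset.range (T.numKids []), ∑ p ∈ leaves h (T.sub j), f (j :: p) := by
  rw [leaves, Finset.sum_biUnion]
  · simp only [Finset.sum_map, Function.Embedding.coeFn_mk]
  · intro i _ j _ hij
    refine Finset.disjoint_left.2 fun p hp hp' => hij ?_
    obtain ⟨q, -, rfl⟩ := Finset.mem_map.1 hp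
    obtain ⟨q', -, hq'⟩ := Finset.mem_map.1 hp'
    simp only [Function.Embedding.coeFn_mk, List.cons.injEq] at hq'
    exact hq'.1.symm

/-- The sectors at the vertices which are neither leaves nor the root, for a tree all of whose
leaves are at height `h + 1`. -/
noncomputable def sectors : ℕ → PlaneTree → Finset (List ℕ × ℕ)
  | 0, _ => ∅
  | h + 1, T => (Finset.range (T.numKids [] + 1)).image (fun n => ([], n)) ∪
      (Finset.range (T.numKids [])).biUnion fun j =>
        (sectors h (T.sub j)).image fun s => (j :: s.1, s.2)

theorem mem_sectors {h : ℕ} {T : PlaneTree} (hT : Level h T) {s : List ℕ × ℕ} :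
    s ∈ sectors h T ↔ IsInner T s.1 s.2 := by
  induction h generalizing T s with
  | zero =>
    obtain ⟨p, n⟩ := s
    simp only [sectors, Finset.notMem_empty, false_iff]
    rintro ⟨hp, hp', -⟩
    rcases p with _ | ⟨j, p⟩
    · exact hp' hT
    · have := lt_numKids_of_cons_mem hp
      rw [show T.numKids [] = 0 from hT] at this
      omega
  | succ h ih =>
    simp only [sectors, Finset.mem_union, Finset.mem_image, Finset.mem_biUnion, Finset.mem_range]
    constructor
    · rintro (⟨n, hn, rfl⟩ | ⟨j, hj, s, hs, rfl⟩)
      · exact (isInner_nil hT.1).2 (by omega)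
      · exact (isInner_cons hj).2 ((ih (hT.2 j hj)).1 hs)
    · intro hs
      obtain ⟨_ | ⟨j, p⟩, n⟩ := s
      · exact Or.inl ⟨n, by have := (isInner_nil hT.1).1 hs; omega, rfl⟩
      · have hj := lt_numKids_of_cons_mem hs.1
        exact Or.inr ⟨j, hj, (p, n), (ih (hT.2 j hj)).2 ((isInner_cons hj).1 hs), rfl⟩

theorem sum_sectors_succ (h : ℕ) (T : PlaneTree) (f : List ℕ × ℕ → ℕ) :
    ∑ s ∈ sectors (h + 1) T, f s = ∑ n ∈ Finset.range (T.numKids [] + 1), f ([], n) +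
      ∑ j ∈ Finset.range (T.numKids []), ∑ s ∈ sectors h (T.sub j), f (j :: s.1, s.2) := by
  rw [sectors, Finset.sum_union, Finset.sum_biUnion, Finset.sum_image]
  · congr 1
    refine Finset.sum_congr rfl fun j _ => Finset.sum_image ?_
    rintro ⟨p, n⟩ - ⟨p', n'⟩ - he
    simpa using he
  · intro n _ n' _ he
    simpa using he
  · intro i _ j _ hij
    refine Finset.disjoint_left.2 fun p hp hp' => hij ?_
    obtain ⟨q, -, rfl⟩ := Finset.mem_image.1 hp
    obtain ⟨q', -, hq'⟩ := Finset.mem_image.1 hp'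
    simp only [Prod.mk.injEq, List.cons.injEq] at hq'
    exact hq'.1.1.symm
  · refine Finset.disjoint_left.2 fun p hp hp' => ?_
    obtain ⟨n, -, rfl⟩ := Finset.mem_image.1 hp
    obtain ⟨j, -, hj⟩ := Finset.mem_biUnion.1 hp'
    obtain ⟨s, -, hs⟩ := Finset.mem_image.1 hj
    simp at hs

/-- The inner branches end below the level in question, and only branches at leaves reach it. -/
theorem top_graft {h k : ℕ} {T₀ : PlaneTree} (hT₀ : Level h T₀) {b : List ℕ → ℕ → PlaneTree}
    (hinner : ∀ p n, IsInner T₀ p n → HeightLE k (b p n)) :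
    top (k + h) (graft T₀ b) = ∑ p ∈ leaves h T₀, top k (b p 0) := by
  induction h generalizing T₀ b with
  | zero => simp [graft_of_numKids_eq_zero hT₀, leaves]
  | succ h ih =>
    rw [← add_assoc, top, kids_graft, List.map_weave, List.sum_weave, List.map_map,
      sum_leaves_succ, Finset.sum_eq_zero, zero_add, Finset.sum_range]
    · rw [← Fin.sum_ofFn, List.ofFn_eq_map, ← List.map_coe_finRange_eq_range, List.map_map]
      congr 1
      refine List.map_congr_left fun j _ => ?_
      exact ih (hT₀.2 j j.2) fun p n hn => hinner _ n ((isInner_cons j.2).2 hn)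
    · intro n hn
      rw [← top]
      refine top_eq_zero_of_heightLE (heightLE_mono (by omega) (hinner [] n ?_))
      rw [isInner_nil hT₀.1]
      simpa using Nat.lt_succ_iff.1 (Finset.mem_range.1 hn)

theorem below_of_heightLE {k m : ℕ} (hkm : k ≤ m) {T : PlaneTree} (hT : HeightLE k T) :
    below m T = below k T := by
  have h := size_eq_below (heightLE_mono hkm hT)
  rw [size_eq_below hT] at h
  exact_mod_cast h.symm

/-- Each grafting identifies one edge, so the number of edges counted is |T₀| - #sectors - #leaves
plus those of the branches. A vertex with c > 0 offspring has c + 1 sectors, whence #sectors +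
#leaves = 2 |T₀| - 1. Eliminating |T₀| gives the identity, written without subtraction. -/
theorem below_graft {h k : ℕ} {T₀ : PlaneTree} (hT₀ : Level h T₀) {b : List ℕ → ℕ → PlaneTree}
    (hinner : ∀ p n, IsInner T₀ p n → HeightLE k (b p n)) :
    2 * below (k + h) (graft T₀ b) + (sectors h T₀).card + (leaves h T₀).card =
      1 + 2 * ∑ s ∈ sectors h T₀, below k (b s.1 s.2) + 2 * ∑ p ∈ leaves h T₀, below k (b p 0) := by
  induction h generalizing T₀ b with
  | zero => simp [graft_of_numKids_eq_zero hT₀, leaves, sectors]; ring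
  | succ h ih =>
    have h1 : ((List.range (T₀.numKids [])).map fun j =>
        below (k + h) (graft (T₀.sub j) fun p => b (j :: p))).sum =
        ∑ j ∈ Finset.range (T₀.numKids []), below (k + h) (graft (T₀.sub j) fun p => b (j :: p)) := by
      rw [Finset.sum_range, ← Fin.sum_ofFn, List.ofFn_eq_map, ← List.map_coe_finRange_eq_range,
        List.map_map]
      rfl
    have h2 : ∑ n ∈ Finset.range (T₀.numKids [] + 1), below k (b [] n) =
        ∑ n ∈ Finset.range (T₀.numKids [] + 1), ((kids (b [] n)).map (below (k + h))).sum +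
          (T₀.numKids [] + 1) := by
      suffices h : ∑ n ∈ Finset.range (T₀.numKids [] + 1), below k (b [] n) =
          ∑ n ∈ Finset.range (T₀.numKids [] + 1),
            (((kids (b [] n)).map (below (k + h))).sum + 1) by
        rw [h, Finset.sum_add_distrib]
        simp
      refine Finset.sum_congr rfl fun n hn => ?_
      have h3 : HeightLE k (b [] n) := hinner [] n
        ((isInner_nil hT₀.1).2 (Nat.lt_succ_iff.1 (Finset.mem_range.1 hn)))
      rw [← below_of_heightLE (by omega : k ≤ k + h + 1) h3, below, add_comm]
    have h3 := Finset.sum_congr (rfl : Finset.range (T₀.numKids []) = _) fun j hj =>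
      ih (b := fun p => b (j :: p)) (hT₀.2 j (Finset.mem_range.1 hj)) fun p n hn =>
        hinner _ n ((isInner_cons (Finset.mem_range.1 hj)).2 hn)
    simp only [Finset.sum_add_distrib, ← Finset.mul_sum, Finset.sum_const, Finset.card_range,
      smul_eq_mul, mul_one] at h3
    rw [← add_assoc, below, kids_graft, List.map_weave, List.sum_weave, List.map_map,
      List.length_map, List.length_range, Finset.card_eq_sum_ones,
      Finset.card_eq_sum_ones, sum_leaves_succ, sum_leaves_succ, sum_sectors_succ,
      sum_sectors_succ, h2]
    simp only [← Finset.card_eq_sum_ones, Finset.card_range, Function.comp_def, h1]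
    linarith

/-! ### The spine -/

theorem infinite_iff {T : PlaneTree} : T.nodes.Infinite ↔ ∃ t ∈ kids T, t.nodes.Infinite := by
  suffices key : T.nodes.Finite ↔ ∀ t ∈ kids T, t.nodes.Finite by
    simp only [Set.Infinite, key, not_forall, exists_prop]
  constructor
  · intro h t ht
    obtain ⟨n, hn⟩ := finite_iff_exists_heightLE.1 h
    exact finite_of_heightLE (heightLE_succ.1 (heightLE_mono (Nat.le_succ n) hn) t ht)
  · intro h
    have h1 : ∀ L : List PlaneTree, (∀ t ∈ L, t.nodes.Finite) → ∃ n, ∀ t ∈ L, HeightLE n t := by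
      intro L
      induction L with
      | nil => exact fun _ => ⟨0, by simp⟩
      | cons t L ih =>
        intro hL
        obtain ⟨n, hn⟩ := ih fun u hu => hL u (by simp [hu])
        obtain ⟨m, hm⟩ := finite_iff_exists_heightLE.1 (hL t (by simp))
        refine ⟨max m n, fun u hu => ?_⟩
        rcases List.mem_cons.1 hu with rfl | hu
        · exact heightLE_mono (le_max_left _ _) hm
        · exact heightLE_mono (le_max_right _ _) (hn u hu)
    obtain ⟨n, hn⟩ := h1 _ h
    exact finite_of_heightLE (heightLE_succ.2 hn)

/-- The position in the filtered list is the number of earlier entries satisfying p, which is how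
the spine relabels offspring. -/
theorem getElem?_filter_iff {α : Type*} (p : α → Bool) (L : List α) (m : ℕ) (t : α) :
    (L.filter p)[m]? = some t ↔ ∃ j, L[j]? = some t ∧ p t = true ∧
      {i : ℕ | i < j ∧ ∃ u, L[i]? = some u ∧ p u = true}.ncard = m := by
  classical
  have hcount : ∀ j, {i : ℕ | i < j ∧ ∃ u, L[i]? = some u ∧ p u = true}.ncard = (L.take j).countP p := by
    intro j
    induction j with
    | zero => simp
    | succ j ih =>
      have hfin : {i : ℕ | i < j ∧ ∃ u, L[i]? = some u ∧ p u = true}.Finite :=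
        (Set.finite_Iio j).subset fun i hi => hi.1
      by_cases hj : ∃ u, L[j]? = some u ∧ p u = true
      · have h1 : {i : ℕ | i < j + 1 ∧ ∃ u, L[i]? = some u ∧ p u = true} =
            insert j {i : ℕ | i < j ∧ ∃ u, L[i]? = some u ∧ p u = true} := by
          ext i
          simp only [Set.mem_ofPred_eq, Set.mem_insert_iff]
          constructor
          · rintro ⟨h1, h2⟩
            rcases Nat.lt_succ_iff_lt_or_eq.1 h1 with h | h
            · exact Or.inr ⟨h, h2⟩
            · exact Or.inl h
          · rintro (rfl | ⟨h1, h2⟩)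
            · exact ⟨by omega, hj⟩
            · exact ⟨by omega, h2⟩
        obtain ⟨u, hu, hpu⟩ := hj
        rw [h1, Set.ncard_insert_of_notMem (by simp) hfin, ih, List.take_add_one, hu]
        simp [hpu]
      · have h1 : {i : ℕ | i < j + 1 ∧ ∃ u, L[i]? = some u ∧ p u = true} =
            {i : ℕ | i < j ∧ ∃ u, L[i]? = some u ∧ p u = true} := by
          ext i
          simp only [Set.mem_ofPred_eq]
          constructor
          · rintro ⟨h1, h2⟩
            rcases Nat.lt_succ_iff_lt_or_eq.1 h1 with h | h
            · exact ⟨h, h2⟩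
            · exact absurd (h ▸ h2) hj
          · rintro ⟨h1, h2⟩
            exact ⟨by omega, h2⟩
        rw [h1, ih, List.take_add_one]
        rcases hL : L[j]? with _ | u
        · simp
        · have : ¬ p u = true := fun h => hj ⟨u, hL, h⟩
          simp [this]
  simp only [hcount]
  clear hcount
  induction L generalizing m with
  | nil => simp
  | cons a L ih =>
    by_cases ha : p a = true
    · rw [List.filter_cons_of_pos ha]
      rcases m with _ | m
      · simp only [List.getElem?_cons_zero, Option.some.injEq]
        constructor
        · rintro rfl
          exact ⟨0, by simp [ha]⟩
        · rintro ⟨j, h1, -, h3⟩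
          rcases j with _ | j
          · simpa using h1
          · simp [ha] at h3
      · rw [List.getElem?_cons_succ]
        refine (ih m).trans ?_
        constructor
        · rintro ⟨j, h1, h2, h3⟩
          exact ⟨j + 1, by simpa using h1, h2, by simp [ha, h3]⟩
        · rintro ⟨j, h1, h2, h3⟩
          rcases j with _ | j
          · simp at h3
          · exact ⟨j, by simpa using h1, h2, by simpa [ha] using h3⟩
    · rw [List.filter_cons_of_neg ha]
      refine (ih m).trans ?_
      constructor
      · rintro ⟨j, h1, h2, h3⟩
        exact ⟨j + 1, by simpa using h1, h2, by simpa [ha] using h3⟩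
      · rintro ⟨j, h1, h2, h3⟩
        rcases j with _ | j
        · simp only [List.getElem?_cons_zero, Option.some.injEq] at h1
          exact absurd (h1 ▸ h2) ha
        · exact ⟨j, by simpa using h1, h2, by simpa [ha] using h3⟩

open Classical in
/-- The infinite trees among the subtrees above the offspring of the vertex `[]`. -/
noncomputable def infKids (T : PlaneTree) : List PlaneTree :=
  (kids T).filter fun t => decide t.nodes.Infinite

theorem infinite_of_mem_infKids {T t : PlaneTree} (h : t ∈ infKids T) : t.nodes.Infinite := by
  have := (List.mem_filter.1 h).2
  simpa using this

theorem spine_eq (T : InfTree) : (spine T).1 = node ((infKids T.1).pmap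
    (fun t ht => (spine ⟨t, ht⟩).1) fun _ => infinite_of_mem_infKids) := by
  have hdesc : ∀ {j : ℕ} {t : PlaneTree}, (kids T.1)[j]? = some t →
      Spine.desc T.1.nodes [j] = t.nodes := by
    intro j t ht
    ext v
    change j :: v ∈ T.1.nodes ↔ _
    rw [cons_mem_iff, ht]
    simp
  have hinf : ∀ j, [j] ∈ Spine.infType T.1.nodes ↔
      ∃ t, (kids T.1)[j]? = some t ∧ t.nodes.Infinite := by
    intro j
    change (Spine.desc T.1.nodes [j]).Infinite ↔ _
    constructor
    · intro h
      obtain ⟨v, hv⟩ := h.nonempty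
      obtain ⟨t, ht, -⟩ := cons_mem_iff.1 hv
      exact ⟨t, ht, hdesc ht ▸ h⟩
    · rintro ⟨t, ht, h⟩
      rw [hdesc ht]
      exact h
  ext w
  rcases w with _ | ⟨m, u⟩
  · simp [root_mem]
  change m :: u ∈ Spine.spineNodes T.1.nodes ↔ _
  rw [Spine.cons_mem_spineNodes, cons_mem_node]
  constructor
  · rintro ⟨j, hj, hm, hu⟩
    obtain ⟨t, ht, htinf⟩ := (hinf j).1 hj
    have h1 : (infKids T.1)[m]? = some t := by
      rw [infKids, getElem?_filter_iff]
      refine ⟨j, ht, by simpa using htinf, ?_⟩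
      simpa only [decide_eq_true_eq, ← hinf] using hm
    refine ⟨(spine ⟨t, htinf⟩).1, ?_, ?_⟩
    · rw [List.getElem?_pmap]
      simp [h1]
    · change u ∈ Spine.spineNodes t.nodes
      rwa [← hdesc ht]
  · rintro ⟨s, hs, hu⟩
    rw [List.getElem?_pmap] at hs
    obtain ⟨t, htinf, ht, rfl⟩ := Option.pmap_eq_some_iff.1 hs
    rw [infKids, getElem?_filter_iff] at ht
    obtain ⟨j, hj, -, hm⟩ := ht
    refine ⟨j, (hinf j).2 ⟨t, hj, htinf⟩, ?_, ?_⟩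
    · simpa only [decide_eq_true_eq, ← hinf] using hm
    · rw [hdesc hj]
      exact hu

/-- `T` is infinite, and its spine agrees with `T₀` up to height `h + 1`. -/
def SpineAgree (h : ℕ) (T T₀ : PlaneTree) : Prop :=
  ∃ hT : T.nodes.Infinite, Agree h (spine ⟨T, hT⟩).1 T₀

theorem spineAgree_succ {h : ℕ} {T T₀ : PlaneTree} : SpineAgree (h + 1) T T₀ ↔
    T.nodes.Infinite ∧ List.Forall₂ (SpineAgree h) (infKids T) (kids T₀) := by
  have key : ∀ hT : T.nodes.Infinite, Agree (h + 1) (spine ⟨T, hT⟩).1 T₀ ↔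
      List.Forall₂ (SpineAgree h) (infKids T) (kids T₀) := by
    intro hT
    rw [agree_succ, spine_eq, kids_node, List.forall₂_iff_get, List.forall₂_iff_get]
    constructor
    · rintro ⟨hlen, h⟩
      refine ⟨by simpa using hlen, fun i h1 h2 => ?_⟩
      have := h i (by simpa using h1) h2
      simp only [List.get_eq_getElem, List.getElem_pmap] at this
      exact ⟨_, this⟩
    · rintro ⟨hlen, h⟩
      refine ⟨by simpa using hlen, fun i h1 h2 => ?_⟩
      obtain ⟨h3, h4⟩ := h i (by simpa using h1) h2
      simpa only [List.get_eq_getElem, List.getElem_pmap] using h4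
  constructor
  · rintro ⟨hT, h⟩
    exact ⟨hT, (key hT).1 h⟩
  · rintro ⟨hT, h⟩
    exact ⟨hT, (key hT).2 h⟩

end PlaneTree

namespace PlaneTree

/-! ### Grafting infinite trees onto the leaves and finite trees in the sectors -/

/-- The trees grafted onto the leaves are infinite, those grafted in the other sectors finite. -/
structure IsGraftData (T₀ : PlaneTree) (b : List ℕ → ℕ → PlaneTree) : Prop where
  inner : ∀ p n, IsInner T₀ p n → (b p n).nodes.Finite
  leaf : ∀ p, IsLeaf T₀ p → (b p 0).nodes.Infinite

theorem IsGraftData.sub {T₀ : PlaneTree} {b : List ℕ → ℕ → PlaneTree} (hb : IsGraftData T₀ b)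
    {j : ℕ} (hj : j < T₀.numKids []) : IsGraftData (T₀.sub j) fun p => b (j :: p) :=
  ⟨fun _ n hn => hb.inner _ n ((isInner_cons hj).2 hn), fun _ hp => hb.leaf _ ((isLeaf_cons hj).2 hp)⟩

theorem finite_of_mem_kids {T t : PlaneTree} (hT : T.nodes.Finite) (ht : t ∈ kids T) :
    t.nodes.Finite := by
  by_contra h
  exact infinite_iff.2 ⟨t, ht, h⟩ hT

/-- Branches in the sectors contribute only finite subtrees. That the grafted subtrees are infinite
is assumed here since `infinite_graft` is proved from this lemma by induction. -/
theorem infKids_graft_of_infinite {h : ℕ} {T₀ : PlaneTree} (hT₀ : Level (h + 1) T₀)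
    {b : List ℕ → ℕ → PlaneTree} (hb : IsGraftData T₀ b)
    (hinf : ∀ j < T₀.numKids [], (graft (T₀.sub j) fun p => b (j :: p)).nodes.Infinite) :
    infKids (graft T₀ b) =
      (List.range (T₀.numKids [])).map fun j => graft (T₀.sub j) fun p => b (j :: p) := by
  classical
  rw [infKids, kids_graft]
  refine List.filter_weave _ ?_ ?_
  · intro t ht
    obtain ⟨j, hj, rfl⟩ := List.mem_map.1 ht
    simpa using hinf j (List.mem_range.1 hj)
  · intro n hn t ht
    have := finite_of_mem_kids (hb.inner [] n ((isInner_nil hT₀.1).2 (by simpa using hn))) ht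
    simpa using this

theorem infinite_graft {h : ℕ} {T₀ : PlaneTree} (hT₀ : Level h T₀)
    {b : List ℕ → ℕ → PlaneTree} (hb : IsGraftData T₀ b) : (graft T₀ b).nodes.Infinite := by
  induction h generalizing T₀ b with
  | zero =>
    rw [graft_of_numKids_eq_zero hT₀]
    exact hb.leaf [] (isLeaf_nil.2 hT₀)
  | succ h ih =>
    have h1 := infKids_graft_of_infinite hT₀ hb fun j hj => ih (hT₀.2 j hj) (hb.sub hj)
    have h2 : graft (T₀.sub 0) (fun p => b (0 :: p)) ∈ infKids (graft T₀ b) := by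
      rw [h1]
      exact List.mem_map_of_mem (f := fun j => graft (T₀.sub j) fun p => b (j :: p))
        (List.mem_range.2 (Nat.pos_of_ne_zero hT₀.1))
    exact infinite_iff.2 ⟨_, List.mem_of_mem_filter h2, infinite_of_mem_infKids h2⟩

theorem infKids_graft {h : ℕ} {T₀ : PlaneTree} (hT₀ : Level (h + 1) T₀)
    {b : List ℕ → ℕ → PlaneTree} (hb : IsGraftData T₀ b) : infKids (graft T₀ b) =
      (List.range (T₀.numKids [])).map fun j => graft (T₀.sub j) fun p => b (j :: p) :=
  infKids_graft_of_infinite hT₀ hb fun j hj => infinite_graft (hT₀.2 j hj) (hb.sub hj)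

theorem spineAgree_graft {h : ℕ} {T₀ : PlaneTree} (hT₀ : Level h T₀)
    {b : List ℕ → ℕ → PlaneTree} (hb : IsGraftData T₀ b) : SpineAgree h (graft T₀ b) T₀ := by
  induction h generalizing T₀ b with
  | zero => exact ⟨infinite_graft hT₀ hb, agree_zero _ _⟩
  | succ h ih =>
    rw [spineAgree_succ, infKids_graft hT₀ hb, kids, List.forall₂_map_left_iff,
      List.forall₂_map_right_iff, List.forall₂_same]
    exact ⟨infinite_graft hT₀ hb, fun j hj =>
      ih (hT₀.2 j (List.mem_range.1 hj)) (hb.sub (List.mem_range.1 hj))⟩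

/-- The infinite subtrees at `[]` match the offspring in T₀, and the runs of finite subtrees between
them make up the branches in the sectors. -/
theorem exists_graft_of_spineAgree {h : ℕ} {T T₀ : PlaneTree} (hT₀ : Level h T₀)
    (hT : SpineAgree h T T₀) : ∃ b, IsGraftData T₀ b ∧ T = graft T₀ b := by
  classical
  induction h generalizing T T₀ with
  | zero =>
    refine ⟨fun _ _ => T, ⟨?_, fun _ _ => hT.1⟩, (graft_of_numKids_eq_zero hT₀ fun _ _ => T).symm⟩
    rintro p n ⟨hp, hp', -⟩
    rcases p with _ | ⟨j, p⟩
    · exact absurd hT₀ hp'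
    · exact absurd (lt_numKids_of_cons_mem hp) (by rw [show T₀.numKids [] = 0 from hT₀]; omega)
  | succ h ih =>
    obtain ⟨hinf, hkids⟩ := spineAgree_succ.1 hT
    rw [List.forall₂_iff_get] at hkids
    have hlen : (infKids T).length = T₀.numKids [] := hkids.1.trans (length_kids T₀)
    have hex : ∀ j (hj : j < T₀.numKids []), ∃ b, IsGraftData (T₀.sub j) b ∧
        (infKids T)[j]'(hlen ▸ hj) = graft (T₀.sub j) b := by
      intro j hj
      have h1 := hkids.2 j (hlen ▸ hj) (by rwa [length_kids])
      simp only [List.get_eq_getElem, kids, List.getElem_map, List.getElem_range] at h1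
      exact ih (hT₀.2 j hj) h1
    choose c hc using hex
    obtain ⟨f, hf, hfin⟩ := List.exists_eq_weave_filter (fun t : PlaneTree => decide t.nodes.Infinite)
      (kids T)
    change kids T = List.weave (infKids T) f at hf
    change ∀ n ≤ (infKids T).length, _ at hfin
    let b : List ℕ → ℕ → PlaneTree := fun p n => match p with
      | [] => node (f n)
      | j :: p => if hj : j < T₀.numKids [] then c j hj p n else T
    refine ⟨b, ⟨?_, ?_⟩, ?_⟩
    · intro p n hp
      rcases p with _ | ⟨j, p⟩
      · change (node (f n)).nodes.Finite
        by_contra hc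
        obtain ⟨t, ht, htinf⟩ := infinite_iff.1 hc
        rw [kids_node] at ht
        have := hfin n (by rw [hlen]; exact (isInner_nil hT₀.1).1 hp) t ht
        simp only [decide_eq_false_iff_not] at this
        exact this htinf
      · have hj := lt_numKids_of_cons_mem hp.1
        simp only [b, hj, dite_true]
        exact (hc j hj).1.inner p n ((isInner_cons hj).1 hp)
    · intro p hp
      rcases p with _ | ⟨j, p⟩
      · exact absurd (isLeaf_nil.1 hp) hT₀.1
      · have hj := lt_numKids_of_cons_mem hp.1
        simp only [b, hj, dite_true]
        exact (hc j hj).1.leaf p ((isLeaf_cons hj).1 hp)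
    · rw [graft_eq, ← node_kids T, hf]
      congr 1
      have h1 : infKids T = (List.range (T₀.numKids [])).map fun j =>
          graft (T₀.sub j) fun p => b (j :: p) := by
        refine List.ext_getElem (by simp [hlen]) fun j h1 h2 => ?_
        have hj : j < T₀.numKids [] := hlen ▸ h1
        rw [(hc j hj).2]
        simp [b, hj]
      rw [← h1]
      congr 1
      funext n
      exact (kids_node (f n)).symm

theorem graft_injective {h : ℕ} {T₀ : PlaneTree} (hT₀ : Level h T₀)
    {b b' : List ℕ → ℕ → PlaneTree} (hb : IsGraftData T₀ b) (hb' : IsGraftData T₀ b')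
    (heq : graft T₀ b = graft T₀ b') : (∀ p n, IsInner T₀ p n → b p n = b' p n) ∧
      ∀ p, IsLeaf T₀ p → b p 0 = b' p 0 := by
  classical
  induction h generalizing T₀ b b' with
  | zero =>
    rw [graft_of_numKids_eq_zero hT₀, graft_of_numKids_eq_zero hT₀] at heq
    constructor
    · rintro p n ⟨hp, hp', -⟩
      rcases p with _ | ⟨j, p⟩
      · exact absurd hT₀ hp'
      · exact absurd (lt_numKids_of_cons_mem hp) (by rw [show T₀.numKids [] = 0 from hT₀]; omega)
    · rintro p ⟨hp, -⟩
      rcases p with _ | ⟨j, p⟩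
      · exact heq
      · exact absurd (lt_numKids_of_cons_mem hp) (by rw [show T₀.numKids [] = 0 from hT₀]; omega)
  | succ h ih =>
    have h1 := congrArg kids heq
    rw [kids_graft, kids_graft] at h1
    have h2 : ∀ {b : List ℕ → ℕ → PlaneTree}, IsGraftData T₀ b →
        (∀ t ∈ (List.range (T₀.numKids [])).map fun j => graft (T₀.sub j) fun p => b (j :: p),
          decide t.nodes.Infinite = true) ∧
        ∀ n ≤ ((List.range (T₀.numKids [])).map fun j =>
          graft (T₀.sub j) fun p => b (j :: p)).length,
          ∀ t ∈ kids (b [] n), decide t.nodes.Infinite = false := by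
      intro b hb
      constructor
      · intro t ht
        obtain ⟨j, hj, rfl⟩ := List.mem_map.1 ht
        rw [List.mem_range] at hj
        simpa using infinite_graft (hT₀.2 j hj) (hb.sub hj)
      · intro n hn t ht
        have := finite_of_mem_kids (hb.inner [] n ((isInner_nil hT₀.1).2 (by simpa using hn))) ht
        simpa using this
    obtain ⟨h3, h4⟩ := List.weave_inj (fun t : PlaneTree => decide t.nodes.Infinite)
      (h2 hb).1 (h2 hb').1 (h2 hb).2 (h2 hb').2 h1
    have h5 : ∀ j < T₀.numKids [], (graft (T₀.sub j) fun p => b (j :: p)) =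
        graft (T₀.sub j) fun p => b' (j :: p) := by
      intro j hj
      exact List.map_inj_left.1 h3 j (List.mem_range.2 hj)
    constructor
    · intro p n hp
      rcases p with _ | ⟨j, p⟩
      · rw [← node_kids (b [] n), ← node_kids (b' [] n),
          h4 n (by simpa using (isInner_nil hT₀.1).1 hp)]
      · have hj := lt_numKids_of_cons_mem hp.1
        exact (ih (hT₀.2 j hj) (hb.sub hj) (hb'.sub hj) (h5 j hj)).1 p n ((isInner_cons hj).1 hp)
    · intro p hp
      rcases p with _ | ⟨j, p⟩
      · exact absurd (isLeaf_nil.1 hp) hT₀.1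
      · have hj := lt_numKids_of_cons_mem hp.1
        exact (ih (hT₀.2 j hj) (hb.sub hj) (hb'.sub hj) (h5 j hj)).2 p ((isLeaf_cons hj).1 hp)

/-! ### Trees all of whose leaves are at the same height -/

theorem exists_isLeaf {T : PlaneTree} (hT : T.nodes.Finite) : ∃ p, IsLeaf T p := by
  obtain ⟨p, hp, hmax⟩ := Set.exists_max_image T.nodes List.length hT ⟨[], T.root_mem⟩
  refine ⟨p, hp, ?_⟩
  by_contra h
  have := hmax _ ((T.mem_append_singleton_iff p 0).2 ⟨hp, Nat.pos_of_ne_zero h⟩)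
  simp at this

theorem finite_sub {T : PlaneTree} (hT : T.nodes.Finite) {j : ℕ} (hj : j < T.numKids []) :
    (T.sub j).nodes.Finite :=
  finite_of_mem_kids hT (List.mem_map_of_mem (List.mem_range.2 hj))

theorem level_of_forall_isLeaf {h : ℕ} {T : PlaneTree} (hT : T.nodes.Finite)
    (hleaf : ∀ p, IsLeaf T p → p.length = h) : Level h T := by
  induction h generalizing T with
  | zero =>
    by_contra hne
    have h0 : 0 < T.numKids [] := Nat.pos_of_ne_zero hne
    obtain ⟨p, hp⟩ := exists_isLeaf (finite_sub hT h0)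
    have := hleaf _ ((isLeaf_cons h0).2 hp)
    simp at this
  | succ h ih =>
    refine ⟨fun h0 => ?_, fun j hj => ih (finite_sub hT hj) fun p hp => ?_⟩
    · have := hleaf [] (isLeaf_nil.2 h0)
      simp at this
    · have := hleaf _ ((isLeaf_cons hj).2 hp)
      simpa using this

theorem numKids_eq_of_agree {n : ℕ} {T t : PlaneTree} (h : Agree (n + 1) T t) :
    T.numKids [] = t.numKids [] := by
  rw [← length_kids, ← length_kids, (agree_succ.1 h).length_eq]

theorem sub_ball (n : ℕ) (T : PlaneTree) {j : ℕ} (hj : j < T.numKids []) :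
    (ball (n + 1 + 1) T).sub j = ball (n + 1) (T.sub j) := by
  have hj' : j < (ball (n + 1 + 1) T).numKids [] := by
    rwa [numKids_eq_of_agree (ball_agree (n + 1) T)]
  ext w
  rw [mem_sub hj', mem_ball_succ, mem_ball_succ, mem_sub hj]
  simp

/-- In a spine every vertex has offspring, so a truncated spine has leaves only at its last level.
-/
theorem level_ball_of_spineAgree {h : ℕ} {T S : PlaneTree} (hT : SpineAgree h T S) :
    Level h (ball (h + 1) S) := by
  induction h generalizing T S with
  | zero =>
    change (ball 1 S).numKids [] = 0
    by_contra hne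
    have h1 := singleton_mem_iff.2 (Nat.pos_of_ne_zero hne)
    rw [mem_ball_succ] at h1
    simp at h1
  | succ h ih =>
    obtain ⟨hinf, hkids⟩ := spineAgree_succ.1 hT
    have hnum := numKids_eq_of_agree (ball_agree (h + 1) S)
    refine ⟨fun h0 => ?_, fun j hj => ?_⟩
    · obtain ⟨t, ht, htinf⟩ := infinite_iff.1 hinf
      have h1 : t ∈ infKids T := List.mem_filter.2 ⟨ht, by simpa using htinf⟩
      have h2 := hkids.length_eq
      rw [length_kids, ← hnum, h0] at h2
      rw [List.eq_nil_of_length_eq_zero h2] at h1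
      simp at h1
    · rw [hnum] at hj
      rw [sub_ball h S hj]
      rw [List.forall₂_iff_get] at hkids
      have h1 := hkids.2 j (by rw [hkids.1, length_kids]; exact hj) (by rwa [length_kids])
      simp only [List.get_eq_getElem, kids, List.getElem_map, List.getElem_range] at h1
      exact ih h1

theorem spineEvent_eq (T₀ : PlaneTree) (h : ℕ) :
    spineEvent T₀ (h + 1) = {T | SpineAgree h T T₀} := by
  ext T
  simp only [spineEvent, spineBall, Set.mem_image, Set.mem_preimage, Set.mem_ofPred_eq, spineTrees,
    Set.mem_range_self, true_and, Nat.cast_add, Nat.cast_one, dist_le_iff]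
  constructor
  · rintro ⟨T, hT, rfl⟩
    exact ⟨T.2, hT⟩
  · rintro ⟨hT, h⟩
    exact ⟨⟨T, hT⟩, h, rfl⟩

end PlaneTree

theorem List.filter_weave_eq_filter {α : Type*} (p : α → Bool) {xs : List α} {f : ℕ → List α}
    (hf : ∀ n ≤ xs.length, ∀ a ∈ f n, p a = false) :
    (List.weave xs f).filter p = xs.filter p := by
  induction xs generalizing f with
  | nil => exact List.filter_eq_nil_iff.2 fun a ha => by simp [hf 0 le_rfl a ha]
  | cons x xs ih =>
    rw [weave, filter_append, filter_eq_nil_iff.2 fun a ha => by simp [hf 0 (Nat.zero_le _) a ha],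
      nil_append, filter_cons, filter_cons, ih fun n hn => hf (n + 1) (by simpa using hn)]

namespace PlaneTree

/-- Grafted trees with finite inner branches and the spine of `T₀` have infinite branches
at all leaves. -/
theorem isGraftData_of_spineAgree {h : ℕ} {T₀ : PlaneTree} (hT₀ : Level h T₀)
    {b : List ℕ → ℕ → PlaneTree} (hinner : ∀ p n, IsInner T₀ p n → (b p n).nodes.Finite)
    (hT : SpineAgree h (graft T₀ b) T₀) : IsGraftData T₀ b := by
  classical
  refine ⟨hinner, ?_⟩
  induction h generalizing T₀ b with
  | zero =>
    obtain ⟨hT, -⟩ := hT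
    rw [graft_of_numKids_eq_zero hT₀] at hT
    rintro (_ | ⟨j, p⟩) hp
    · exact hT
    · have := lt_numKids_of_cons_mem hp.1
      rw [show T₀.numKids [] = 0 from hT₀] at this
      omega
  | succ h ih =>
    have hinf : infKids (graft T₀ b) = ((List.range (T₀.numKids [])).map fun j =>
        graft (T₀.sub j) fun p => b (j :: p)).filter fun t => decide t.nodes.Infinite := by
      rw [infKids, kids_graft]
      refine List.filter_weave_eq_filter _ fun n hn t ht => ?_
      have := finite_of_mem_kids (hinner [] n ((isInner_nil hT₀.1).2 (by simpa using hn))) ht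
      simpa using this
    -- The spine demands as many infinite subtrees as `[]` has offspring in T₀, so the filter
    -- removes none.
    have hF := (spineAgree_succ.1 hT).2
    have hlen := hF.length_eq
    rw [hinf, kids, List.length_map, List.length_range] at hlen
    have hall := List.length_filter_eq_length_iff.1
      (hlen.trans (by rw [List.length_map, List.length_range]))
    rw [hinf, List.filter_eq_self.2 hall, kids, List.forall₂_map_left_iff,
      List.forall₂_map_right_iff, List.forall₂_same] at hF
    rintro (_ | ⟨j, p⟩) hp
    · exact absurd hp.2 hT₀.1
    · have hj := lt_numKids_of_cons_mem hp.1
      exact ih (hT₀.2 j hj) (b := fun p => b (j :: p))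
        (fun p n hn => hinner _ n ((isInner_cons hj).2 hn)) (hF j (List.mem_range.2 hj)) p
        ((isLeaf_cons hj).1 hp)

/-! ### Grafting with branches indexed by the leaves and the inner sectors. -/

section GraftAll

variable {T₀ : PlaneTree} {R : ℕ} (e : Fin R ≃ Leaf T₀)

open Classical in
/-- The branches of `graftAll T₀ e x y`. -/
noncomputable def branch (x : Fin R → PlaneTree) (y : InnerSector T₀ → PlaneTree) (p : List ℕ)
    (n : ℕ) : PlaneTree :=
  if hp : p ∈ T₀.nodes ∧ T₀.numKids p = 0 then x (e.symm ⟨p, hp⟩)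
  else if hs : p ∈ T₀.nodes ∧ T₀.numKids p ≠ 0 ∧ n ≤ T₀.numKids p then y ⟨(p, n), hs⟩
  else star 0

theorem graftAll_eq (x : Fin R → PlaneTree) (y : InnerSector T₀ → PlaneTree) :
    graftAll T₀ e x y = graft T₀ (branch e x y) := rfl

theorem branch_leaf (x : Fin R → PlaneTree) (y : InnerSector T₀ → PlaneTree) {p : List ℕ}
    (hp : IsLeaf T₀ p) (n : ℕ) : branch e x y p n = x (e.symm ⟨p, hp⟩) := dif_pos hp

theorem branch_equiv (x : Fin R → PlaneTree) (y : InnerSector T₀ → PlaneTree) (i : Fin R)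
    (n : ℕ) : branch e x y (e i).1 n = x i := by
  rw [branch_leaf e x y (e i).2, Subtype.coe_eta, Equiv.symm_apply_apply]

theorem branch_inner (x : Fin R → PlaneTree) (y : InnerSector T₀ → PlaneTree) {p : List ℕ} {n : ℕ}
    (hp : IsInner T₀ p n) : branch e x y p n = y ⟨(p, n), hp⟩ :=
  (dif_neg fun h => hp.2.1 h.2).trans (dif_pos hp)

variable {e}

theorem graft_eq_graftAll {h : ℕ} (hT₀ : Level h T₀) (b : List ℕ → ℕ → PlaneTree) :
    graft T₀ b = graftAll T₀ e (fun i => b (e i).1 0) fun s => b s.1.1 s.1.2 := by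
  rw [graftAll_eq]
  refine graft_congr hT₀ (fun p hp => ?_) fun p n hp => ?_
  · rw [branch_leaf e _ _ hp, Equiv.apply_symm_apply]
  · rw [branch_inner e _ _ hp]

theorem agree_graftAll {h : ℕ} (hT₀ : Level h T₀) {k : ℕ} {x x' : Fin R → PlaneTree}
    {y y' : InnerSector T₀ → PlaneTree}
    (hx : ∀ i, Agree k (x i) (x' i)) (hy : ∀ s, Agree (k + h) (y s) (y' s)) :
    Agree (k + h) (graftAll T₀ e x y) (graftAll T₀ e x' y') := by
  refine agree_graft hT₀ (fun p hp => ?_) fun p n hp => ?_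
  · change Agree k (branch e x y p 0) (branch e x' y' p 0)
    rw [branch_leaf e _ _ hp, branch_leaf e _ _ hp]
    exact hx _
  · change Agree (k + h) (branch e x y p n) (branch e x' y' p n)
    rw [branch_inner e _ _ hp, branch_inner e _ _ hp]
    exact hy _

theorem exists_eq_graftAll {h : ℕ} (hT₀ : Level h T₀) {k : ℕ} (hk : 1 ≤ k) {T : PlaneTree}
    {x : Fin R → PlaneTree}
    {y : InnerSector T₀ → PlaneTree} (hy : ∀ s, HeightLE k (y s))
    (hT : Agree (k + h) T (graftAll T₀ e x y)) :
    ∃ x', (∀ i, Agree k (x' i) (x i)) ∧ T = graftAll T₀ e x' y := by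
  obtain ⟨b, hb1, hb2, rfl⟩ := exists_eq_graft hT₀ hk (b := branch e x y)
    (fun p n hp => by rw [branch_inner e x y hp]; exact hy _) hT
  refine ⟨fun i => b (e i).1 0, fun i => ?_, ?_⟩
  · have := hb2 _ (e i).2
    rwa [branch_equiv] at this
  · rw [graft_eq_graftAll (e := e) hT₀]
    congr 1
    ext1 s
    rw [hb1 _ _ s.2, branch_inner e x y s.2]

theorem agree_of_agree_graftAll {h : ℕ} (hT₀ : Level h T₀) {k : ℕ} {x x' : Fin R → PlaneTree}
    {y : InnerSector T₀ → PlaneTree}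
    (hagree : Agree (k + h) (graftAll T₀ e x y) (graftAll T₀ e x' y)) (i : Fin R) :
    Agree k (x i) (x' i) := by
  have := agree_of_agree_graft hT₀ (b := branch e x y) (b' := branch e x' y)
    (fun p n hp => by rw [branch_inner e _ _ hp, branch_inner e _ _ hp]) hagree (e i).2
  rwa [branch_equiv, branch_equiv] at this

theorem graftAll_injective_left {h : ℕ} (hT₀ : Level h T₀) (y : InnerSector T₀ → PlaneTree) :
    Function.Injective fun x => graftAll T₀ e x y := fun x x' heq => by
  funext i
  refine eq_of_forall_agree fun k => agree_of_agree_graftAll hT₀ (y := y) (e := e) ?_ i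
  change graftAll T₀ e x y = graftAll T₀ e x' y at heq
  rw [heq]
  exact Agree.refl _ _

theorem isGraftData_branch {x : Fin R → PlaneTree} {y : InnerSector T₀ → PlaneTree}
    (hx : ∀ i, (x i).nodes.Infinite) (hy : ∀ s, (y s).nodes.Finite) :
    IsGraftData T₀ (branch e x y) where
  inner p n hp := by rw [branch_inner e x y hp]; exact hy _
  leaf p hp := by rw [branch_leaf e x y hp]; exact hx _

theorem spineAgree_graftAll {h : ℕ} (hT₀ : Level h T₀) {x : Fin R → PlaneTree}
    {y : InnerSector T₀ → PlaneTree}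
    (hx : ∀ i, (x i).nodes.Infinite) (hy : ∀ s, (y s).nodes.Finite) :
    SpineAgree h (graftAll T₀ e x y) T₀ :=
  spineAgree_graft hT₀ (isGraftData_branch hx hy)

theorem exists_graftAll_of_spineAgree {h : ℕ} (hT₀ : Level h T₀) (e : Fin R ≃ Leaf T₀)
    {T : PlaneTree}
    (hT : SpineAgree h T T₀) :
    ∃ x y, (∀ i, (x i).nodes.Infinite) ∧ (∀ s, (y s).nodes.Finite) ∧ T = graftAll T₀ e x y := by
  obtain ⟨b, hb, rfl⟩ := exists_graft_of_spineAgree hT₀ hT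
  exact ⟨_, _, fun i => hb.leaf _ (e i).2, fun s => hb.inner _ _ s.2, graft_eq_graftAll hT₀ b⟩

theorem infinite_of_spineAgree_graftAll {h : ℕ} (hT₀ : Level h T₀) {x : Fin R → PlaneTree}
    {y : InnerSector T₀ → PlaneTree}
    (hy : ∀ s, (y s).nodes.Finite) (hT : SpineAgree h (graftAll T₀ e x y) T₀) (i : Fin R) :
    (x i).nodes.Infinite := by
  have := (isGraftData_of_spineAgree hT₀ (b := branch e x y)
    (fun p n hp => by rw [branch_inner e x y hp]; exact hy _) hT).leaf _ (e i).2
  rwa [branch_equiv] at this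

theorem graftAll_injective {h : ℕ} (hT₀ : Level h T₀) {x x' : Fin R → PlaneTree}
    {y y' : InnerSector T₀ → PlaneTree}
    (hx : ∀ i, (x i).nodes.Infinite) (hy : ∀ s, (y s).nodes.Finite)
    (hx' : ∀ i, (x' i).nodes.Infinite) (hy' : ∀ s, (y' s).nodes.Finite)
    (heq : graftAll T₀ e x y = graftAll T₀ e x' y') : x = x' ∧ y = y' := by
  obtain ⟨h1, h2⟩ := graft_injective hT₀ (isGraftData_branch hx hy)
    (isGraftData_branch hx' hy') heq
  constructor
  · funext i
    have := h2 _ (e i).2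
    rwa [branch_equiv, branch_equiv] at this
  · funext s
    have := h1 _ _ s.2
    rwa [branch_inner e _ _ s.2, branch_inner e _ _ s.2] at this

theorem sum_leaves_eq {h : ℕ} (hT₀ : Level h T₀) (e : Fin R ≃ Leaf T₀) (f : List ℕ → ℕ) :
    ∑ p ∈ leaves h T₀, f p = ∑ i, f (e i).1 := by
  let _ : Fintype (Leaf T₀) := Fintype.ofEquiv _ e
  rw [Finset.sum_subtype _ fun p => mem_leaves hT₀]
  exact (Equiv.sum_comp e fun w : Leaf T₀ => f w.1).symm

theorem sum_sectors_eq {h : ℕ} (hT₀ : Level h T₀) [Fintype (InnerSector T₀)] (f : List ℕ × ℕ → ℕ) :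
    ∑ s ∈ sectors h T₀, f s = ∑ s : InnerSector T₀, f s.1 :=
  Finset.sum_subtype _ (fun _ => mem_sectors hT₀) _

theorem top_graftAll {h : ℕ} (hT₀ : Level h T₀) {k : ℕ} (x : Fin R → PlaneTree)
    {y : InnerSector T₀ → PlaneTree}
    (hy : ∀ s, HeightLE k (y s)) :
    top (k + h) (graftAll T₀ e x y) = ∑ i, top k (x i) := by
  rw [graftAll_eq, top_graft hT₀ fun p n hp => by rw [branch_inner e x y hp]; exact hy _,
    sum_leaves_eq hT₀ e]
  simp only [branch_equiv]

theorem below_graftAll {h : ℕ} (hT₀ : Level h T₀) [Fintype (InnerSector T₀)] {k : ℕ}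
    (x : Fin R → PlaneTree)
    {y : InnerSector T₀ → PlaneTree} (hy : ∀ s, HeightLE k (y s)) :
    2 * below (k + h) (graftAll T₀ e x y) + Fintype.card (InnerSector T₀) + R =
      1 + 2 * ∑ s, below k (y s) + 2 * ∑ i, below k (x i) := by
  have h1 := below_graft hT₀ (b := branch e x y) (k := k)
    fun p n hp => by rw [branch_inner e x y hp]; exact hy _
  rw [Finset.card_eq_sum_ones, Finset.card_eq_sum_ones, sum_leaves_eq hT₀ e, sum_leaves_eq hT₀ e,
    sum_sectors_eq hT₀, sum_sectors_eq hT₀] at h1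
  simp only [branch_equiv, Finset.sum_const, Finset.card_univ, Fintype.card_fin, smul_eq_mul,
    mul_one] at h1
  rw [graftAll_eq, h1]
  congr 3
  exact Finset.sum_congr rfl fun s _ => by rw [branch_inner e x y s.2]

end GraftAll

theorem eventually_agree (n : ℕ) (T : PlaneTree) : ∀ᶠ T' in 𝓝 T, Agree n T' T := by
  have h := Metric.closedBall_mem_nhds T (ε := 1 / ((n : ℝ) + 1)) (by positivity)
  rw [closedBall_eq] at h
  exact h

theorem tendsto_of_eventually_agree {X : Type*} {l : Filter X} {f : X → PlaneTree} {T : PlaneTree}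
    (hf : ∀ n, ∀ᶠ x in l, Agree n (f x) T) : Tendsto f l (𝓝 T) := by
  refine Metric.tendsto_nhds.2 fun ε hε => ?_
  obtain ⟨n, hn⟩ := exists_nat_one_div_lt hε
  filter_upwards [hf n] with x hx
  exact (dist_le_iff.2 hx).trans_lt hn

theorem continuous_graftAll {T₀ : PlaneTree} [Finite (InnerSector T₀)] {R : ℕ}
    (e : Fin R ≃ Leaf T₀) {h : ℕ} (hT₀ : Level h T₀) :
    Continuous fun z : (Fin R → PlaneTree) × (InnerSector T₀ → PlaneTree) =>
      graftAll T₀ e z.1 z.2 := by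
  refine continuous_iff_continuousAt.2 fun z => tendsto_of_eventually_agree fun n => ?_
  have h1 : ∀ᶠ z' in 𝓝 z, ∀ i, Agree n (z'.1 i) (z.1 i) := eventually_all.2 fun i =>
    ((by fun_prop : Continuous fun z' : (Fin R → PlaneTree) × (InnerSector T₀ → PlaneTree) =>
      z'.1 i).continuousAt (x := z)).eventually (eventually_agree n (z.1 i))
  have h2 : ∀ᶠ z' in 𝓝 z, ∀ s, Agree (n + h) (z'.2 s) (z.2 s) := eventually_all.2 fun s =>
    ((by fun_prop : Continuous fun z' : (Fin R → PlaneTree) × (InnerSector T₀ → PlaneTree) =>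
      z'.2 s).continuousAt (x := z)).eventually (eventually_agree (n + h) (z.2 s))
  filter_upwards [h1, h2] with z' h1 h2
  exact (agree_graftAll hT₀ h1 h2).mono (Nat.le_add_right n h)

end PlaneTree

/-! ### The local limit on grafted trees. -/

namespace PlaneTree

theorem quarterWeight_of_heightLE {k : ℕ} {T : PlaneTree} (hT : HeightLE k T) :
    quarterWeight T = ENNReal.ofReal ((1 / 4) ^ below k T) := by
  rw [quarterWeight, size_eq_below hT, if_neg (ENat.natCast_ne_top _), ENat.toNat_natCast,
    ENNReal.ofReal_pow (by norm_num), ENNReal.ofReal_div_of_pos (by norm_num)]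
  simp

variable {T₀ : PlaneTree} {R : ℕ} {h : ℕ}

/-- Both sides depend on x only through the total numbers of top vertices and of edges below them.
The exponent k + h splits off e^{-hμ}, and `below_graftAll` supplies exactly the powers of 2 that
turn 4^{-|y s|} into the ρ-mass of y s and complete `fullMixture_closedBall`. -/
theorem nu_agree_graftAll [Fintype (InnerSector T₀)] (e : Fin R ≃ Leaf T₀) (hT₀ : Level h T₀)
    {μ : ℝ} (hμ : 0 < μ) {k : ℕ} (x : Fin R → PlaneTree) {y : InnerSector T₀ → PlaneTree}
    (hy : ∀ s, HeightLE k (y s)) :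
    (nu μ : Measure PlaneTree) {T | Agree (k + h) T (graftAll T₀ e x y)} =
      ENNReal.ofReal (Real.exp (-μ) ^ h) * (∏ s, bgwMeasure {y s}) *
        fullMixture R μ (Metric.closedBall x (1 / ((k : ℝ) + 1))) := by
  have hbgw : ∀ s, bgwMeasure {y s} = ENNReal.ofReal (2 * (1 / 4) ^ below k (y s)) := fun s => by
    rw [bgwMeasure_singleton, quarterWeight_of_heightLE (hy s), ENNReal.ofReal_mul zero_le_two]
    simp
  simp only [hbgw]
  rw [nu_agree hμ, localProb, top_graftAll hT₀ x hy, fullMixture_closedBall hμ,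
    ← ENNReal.ofReal_prod_of_nonneg fun s _ => by positivity, ← ENNReal.ofReal_mul (by positivity),
    ← ENNReal.ofReal_mul (by positivity)]
  congr 1
  rw [Finset.prod_mul_distrib, Finset.prod_const, Finset.prod_pow_eq_pow_sum, Finset.card_univ]
  -- The count in `below_graftAll` is doubled, so it is exponentiated with base 1/2.
  have h1 := congrArg (fun n => (1 / 2 : ℝ) ^ n) (below_graftAll (e := e) hT₀ x hy)
  simp only [pow_add, pow_mul, pow_one] at h1
  rw [show (1 / 2 : ℝ) ^ 2 = 1 / 4 by norm_num] at h1
  have h2 : ∀ n, (2 : ℝ) ^ n * (1 / 2) ^ n = 1 := fun n => by rw [← mul_pow]; norm_num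
  have h3 : (1 / 4 : ℝ) ^ below (k + h) (graftAll T₀ e x y) =
      2 ^ Fintype.card (InnerSector T₀) * (1 / 4) ^ (∑ s, below k (y s)) *
        (2 ^ R / 2 * (1 / 4) ^ (∑ i, below k (x i))) := by
    calc _ = (1 / 4 : ℝ) ^ below (k + h) (graftAll T₀ e x y) *
          (2 ^ Fintype.card (InnerSector T₀) * (1 / 2) ^ Fintype.card (InnerSector T₀)) *
          (2 ^ R * (1 / 2) ^ R) := by rw [h2, h2, mul_one, mul_one]
      _ = 2 ^ Fintype.card (InnerSector T₀) * 2 ^ R *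
          ((1 / 4 : ℝ) ^ below (k + h) (graftAll T₀ e x y) *
          (1 / 2) ^ Fintype.card (InnerSector T₀) * (1 / 2) ^ R) := by ring
      _ = _ := by rw [h1]; ring
  rw [h3, pow_add]
  ring

theorem mem_closedBall_iff_agree {x x' : Fin R → PlaneTree} {k : ℕ} :
    x' ∈ Metric.closedBall x (1 / ((k : ℝ) + 1)) ↔ ∀ i, Agree k (x' i) (x i) := by
  rw [Metric.mem_closedBall, dist_pi_le_iff (by positivity)]
  exact forall_congr' fun i => dist_le_iff

theorem image_graftAll_closedBall {e : Fin R ≃ Leaf T₀} (hT₀ : Level h T₀) {k : ℕ} (hk : 1 ≤ k)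
    (x : Fin R → PlaneTree) {y : InnerSector T₀ → PlaneTree} (hy : ∀ s, HeightLE k (y s)) :
    (fun x => graftAll T₀ e x y) '' Metric.closedBall x (1 / ((k : ℝ) + 1)) =
      {T | Agree (k + h) T (graftAll T₀ e x y)} := by
  ext T
  constructor
  · rintro ⟨x', hx', rfl⟩
    exact agree_graftAll hT₀ (mem_closedBall_iff_agree.1 hx') fun s => Agree.refl _ _
  · intro hT
    obtain ⟨x', hx', rfl⟩ := exists_eq_graftAll hT₀ hk hy hT
    exact ⟨x', mem_closedBall_iff_agree.2 hx', rfl⟩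

/-- An injective continuous map on a Polish space has Borel images. -/
theorem measurableEmbedding_graftAll [Finite (InnerSector T₀)] (e : Fin R ≃ Leaf T₀)
    (hT₀ : Level h T₀) (y : InnerSector T₀ → PlaneTree) :
    MeasurableEmbedding fun x => graftAll T₀ e x y :=
  ((continuous_graftAll e hT₀).comp (Continuous.prodMk_left y)).measurableEmbedding
    (graftAll_injective_left hT₀ y)

theorem exists_heightLE [Finite (InnerSector T₀)] {y : InnerSector T₀ → PlaneTree}
    (hy : ∀ s, (y s).nodes.Finite) (n : ℕ) : ∃ k ≥ n, ∀ s, HeightLE k (y s) := by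
  have := Fintype.ofFinite (InnerSector T₀)
  choose m hm using fun s => finite_iff_exists_heightLE.1 (hy s)
  exact ⟨n + ∑ s, m s, Nat.le_add_right _ _, fun s => heightLE_mono
    ((Finset.single_le_sum (fun _ _ => Nat.zero_le _) (Finset.mem_univ s)).trans
      (Nat.le_add_left _ _)) (hm s)⟩

/-- Only radii finer than the heights of all finite branches are compared, since for these the image
of a ball is known to be a ball. -/
theorem comap_graftAll_nu [Fintype (InnerSector T₀)] (e : Fin R ≃ Leaf T₀) (hT₀ : Level h T₀)
    {μ : ℝ} (hμ : 0 < μ) {y : InnerSector T₀ → PlaneTree} (hy : ∀ s, (y s).nodes.Finite) :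
    Measure.comap (fun x => graftAll T₀ e x y) (nu μ : Measure PlaneTree) =
      (ENNReal.ofReal (Real.exp (-μ) ^ h) * ∏ s, bgwMeasure {y s}) • fullMixture R μ := by
  have hemb := measurableEmbedding_graftAll e hT₀ y
  have : IsFiniteMeasure (Measure.comap (fun x => graftAll T₀ e x y)
      (nu μ : Measure PlaneTree)) := ⟨by rw [hemb.comap_apply]; exact measure_lt_top _ _⟩
  obtain ⟨k₀, hk₀, hyk⟩ := exists_heightLE hy 1
  refine Measure.ext_of_closedBall k₀ fun k hk x => ?_
  have hyk' := fun s => heightLE_mono hk (hyk s)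
  rw [hemb.comap_apply, image_graftAll_closedBall hT₀ (hk₀.trans hk) x hyk',
    nu_agree_graftAll e hT₀ hμ x hyk', Measure.smul_apply, smul_eq_mul]

theorem nu_image_graftAll {n : ℕ} [Fintype (InnerSector T₀)] (e : Fin (n + 1) ≃ Leaf T₀)
    (hT₀ : Level h T₀) {μ : ℝ} (hμ : 0 < μ) {y : InnerSector T₀ → PlaneTree}
    (hy : ∀ s, (y s).nodes.Finite) {A : Set (Fin (n + 1) → PlaneTree)} (hA : MeasurableSet A) :
    (nu μ : Measure PlaneTree) ((fun x => graftAll T₀ e x y) '' (A ∩ infFamilies (n + 1))) =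
      ENNReal.ofReal (Real.exp (-μ) ^ h * (μ ^ n / (n.factorial : ℝ))) *
        mixedMeasure (n + 1) μ A * ∏ s, bgwMeasure {y s} := by
  rw [← (measurableEmbedding_graftAll e hT₀ y).comap_apply, comap_graftAll_nu e hT₀ hμ hy,
    Measure.smul_apply, smul_eq_mul, fullMixture_inter_infFamilies n hμ hA,
    ENNReal.ofReal_mul (by positivity)]
  ring

/-- The grafted trees with infinite branches in `A` and finite branches in `B`. -/
def graftSet (e : Fin R ≃ Leaf T₀) (A : Set (Fin R → PlaneTree))
    (B : Set (InnerSector T₀ → PlaneTree)) : Set PlaneTree :=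
  {T | ∃ x ∈ A ∩ infFamilies R, ∃ y ∈ B, (∀ s, (y s).nodes.Finite) ∧ T = graftAll T₀ e x y}

theorem graftSet_univ (e : Fin R ≃ Leaf T₀) (hT₀ : Level h T₀) :
    graftSet e Set.univ Set.univ = spineEvent T₀ (h + 1) := by
  rw [spineEvent_eq]
  ext T
  constructor
  · rintro ⟨x, hx, y, -, hy, rfl⟩
    exact spineAgree_graftAll hT₀ hx.2 hy
  · intro hT
    obtain ⟨x, y, hx, hy, rfl⟩ := exists_graftAll_of_spineAgree hT₀ e hT
    exact ⟨x, ⟨trivial, hx⟩, y, trivial, hy, rfl⟩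

theorem graftSet_eq_iUnion (e : Fin R ≃ Leaf T₀) (A : Set (Fin R → PlaneTree))
    (B : Set (InnerSector T₀ → PlaneTree)) : graftSet e A B =
      ⋃ y : {y : InnerSector T₀ → FinTree // (fun s => (y s).1) ∈ B},
        (fun x => graftAll T₀ e x fun s => (y.1 s).1) '' (A ∩ infFamilies R) := by
  ext T
  simp only [graftSet, Set.mem_iUnion, Set.mem_image]
  constructor
  · rintro ⟨x, hx, y, hyB, hy, rfl⟩
    exact ⟨⟨fun s => ⟨y s, hy s⟩, hyB⟩, x, hx, rfl⟩
  · rintro ⟨y, x, hx, rfl⟩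
    exact ⟨x, hx, _, y.2, fun s => (y.1 s).2, rfl⟩

theorem measurableSet_graftSet [Finite (InnerSector T₀)] (e : Fin R ≃ Leaf T₀) (hT₀ : Level h T₀)
    {A : Set (Fin R → PlaneTree)} (hA : MeasurableSet A) (B : Set (InnerSector T₀ → PlaneTree)) :
    MeasurableSet (graftSet e A B) := by
  rw [graftSet_eq_iUnion]
  exact MeasurableSet.iUnion fun y => (measurableEmbedding_graftAll e hT₀ _).measurableSet_image.2
    (hA.inter (measurableSet_infFamilies R))

/-- The product of copies of ρ is carried by a countable set, so the formula holds for every B,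
measurable or not. -/
theorem pi_bgwMeasure_apply {ι : Type*} [Fintype ι] (B : Set (ι → PlaneTree)) :
    ∑' y : {y : ι → FinTree // (fun s => (y s).1) ∈ B}, ∏ s, bgwMeasure {(y.1 s).1} =
      Measure.pi (fun _ : ι => bgwMeasure) B := by
  set π := Measure.pi (fun _ : ι => bgwMeasure)
  let C : Set (ι → PlaneTree) := {y | ∀ s, (y s).nodes.Finite}
  have hC : ∀ᵐ y ∂π, y ∈ C := by
    refine ae_all_iff.2 fun s => ?_
    have h1 : ∀ᵐ T ∂bgwMeasure, T.nodes.Finite := by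
      have := bgwMeasure_infTree
      rw [ae_iff]
      exact this
    exact (measurePreserving_eval (fun _ : ι => bgwMeasure) s).quasiMeasurePreserving.ae h1
  have h1 : ∀ y : ι → PlaneTree, π {y} = ∏ s, bgwMeasure {y s} := fun y => by
    rw [← Set.univ_pi_singleton, Measure.pi_pi]
  have h2 : B ∩ C = ⋃ y : {y : ι → FinTree // (fun s => (y s).1) ∈ B}, {fun s => (y.1 s).1} := by
    ext y
    simp only [Set.mem_iUnion, Set.mem_singleton_iff]
    constructor
    · rintro ⟨hyB, hy⟩
      exact ⟨⟨fun s => ⟨y s, hy s⟩, hyB⟩, rfl⟩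
    · rintro ⟨y, rfl⟩
      exact ⟨y.2, fun s => (y.1 s).2⟩
  have h3 : π (B ∩ C) = π B := measure_inter_conull hC
  rw [← h3, h2, measure_iUnion _ fun y => measurableSet_singleton _]
  · simp only [h1]
  · intro y y' hne
    refine Set.disjoint_singleton.2 fun heq => hne (Subtype.ext (funext fun s => Subtype.ext ?_))
    exact congrFun heq s

/-- Sum over the countably many families of finite branches. The full sets give part i), rectangles
give part ii). -/
theorem nu_graftSet {n : ℕ} [Fintype (InnerSector T₀)] (e : Fin (n + 1) ≃ Leaf T₀)
    (hT₀ : Level h T₀) {μ : ℝ} (hμ : 0 < μ) {A : Set (Fin (n + 1) → PlaneTree)}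
    (hA : MeasurableSet A) (B : Set (InnerSector T₀ → PlaneTree)) :
    (nu μ : Measure PlaneTree) (graftSet e A B) =
      ENNReal.ofReal (Real.exp (-μ) ^ h * (μ ^ n / (n.factorial : ℝ))) *
        mixedMeasure (n + 1) μ A * Measure.pi (fun _ => bgwMeasure) B := by
  rw [graftSet_eq_iUnion, measure_iUnion, ← pi_bgwMeasure_apply, ← ENNReal.tsum_mul_left]
  · exact tsum_congr fun y => nu_image_graftAll e hT₀ hμ (fun s => (y.1 s).2) hA
  · intro y y' hne
    refine Set.disjoint_left.2 ?_
    rintro _ ⟨x, hx, rfl⟩ ⟨x', hx', heq⟩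
    have := (graftAll_injective hT₀ hx.2 (fun s => (y.1 s).2) hx'.2 (fun s => (y'.1 s).2)
      heq.symm).2
    exact hne (Subtype.ext (funext fun s => Subtype.ext (congrFun this s)))
  · exact fun y => (measurableEmbedding_graftAll e hT₀ _).measurableSet_image.2
      (hA.inter (measurableSet_infFamilies _))

theorem nu_spineEvent {n : ℕ} [Fintype (InnerSector T₀)] (e : Fin (n + 1) ≃ Leaf T₀)
    (hT₀ : Level h T₀) {μ : ℝ} (hμ : 0 < μ) : (nu μ : Measure PlaneTree) (spineEvent T₀ (h + 1)) =
      ENNReal.ofReal (Real.exp (-μ) ^ h * (μ ^ n / (n.factorial : ℝ))) := by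
  have := isProbabilityMeasure_mixedMeasure n hμ
  rw [← graftSet_univ e hT₀, nu_graftSet e hT₀ hμ MeasurableSet.univ, measure_univ, measure_univ,
    mul_one, mul_one]

end PlaneTree

/-! ### Measurability of the spine map and the pushforward measure. -/

namespace PlaneTree

theorem finite_leaf {T : PlaneTree} (hT : T.nodes.Finite) : Finite (Leaf T) :=
  (hT.subset fun _ hp => hp.1).to_subtype

theorem finite_ball (n : ℕ) (T : PlaneTree) : (ball (n + 1) T).nodes.Finite :=
  finite_of_heightLE (ball_heightLE n T)

theorem measurableSet_spineEvent {h : ℕ} {T₀ : PlaneTree} (hfin : T₀.nodes.Finite)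
    (hT₀ : Level h T₀) : MeasurableSet (spineEvent T₀ (h + 1)) := by
  have := finite_leaf hfin
  have := finite_innerSector ⟨T₀, hfin⟩
  rw [← graftSet_univ (Finite.equivFin (Leaf T₀)).symm hT₀]
  exact measurableSet_graftSet _ hT₀ MeasurableSet.univ _

/-- The preimage of a ball is empty or the spine event of a truncated spine, to which the
description by grafting applies. -/
theorem measurable_spine : Measurable spine := by
  suffices h : Measurable fun T : InfTree => (spine T).1 from h.subtype_mk (h := fun T => (spine T).2)
  refine (measurable_generateFrom ?_).mono le_rfl (generateFrom_closedBall (X := PlaneTree) 0).le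
  rintro _ ⟨n, -, S, rfl⟩
  rw [closedBall_eq]
  change MeasurableSet {T : InfTree | Agree n (spine T).1 S}
  rcases Set.eq_empty_or_nonempty {T : InfTree | Agree n (spine T).1 S} with h0 | ⟨T₁, hT₁⟩
  · rw [h0]
    exact MeasurableSet.empty
  · have hlevel := level_ball_of_spineAgree ⟨T₁.2, hT₁⟩
    convert measurable_subtype_coe (measurableSet_spineEvent (finite_ball n S) hlevel) using 1
    ext T
    rw [spineEvent_eq]
    exact ⟨fun hT => ⟨T.2, hT.trans (ball_agree n S).symm⟩,
      fun hT => hT.2.trans (ball_agree n S)⟩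

theorem spineMeasure_spineBall (μ : ℝ) {h : ℕ} {T₀ : PlaneTree} :
    spineMeasure μ (spineBall T₀ (1 / ((h + 1 : ℕ) : ℝ))) =
      (nu μ : Measure PlaneTree) (spineEvent T₀ (h + 1)) := by
  have hval : MeasurableEmbedding (Subtype.val : InfTree → PlaneTree) :=
    MeasurableEmbedding.subtype_coe measurableSet_finTree.compl
  let C : Set InfTree := {S | Agree h S.1 T₀}
  have hC : MeasurableSet C := measurable_subtype_coe (measurableSet_agree h T₀)
  have hsub : spineBall T₀ (1 / ((h + 1 : ℕ) : ℝ)) ⊆ C := fun S hS => by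
    have := hS.2
    rw [Nat.cast_add, Nat.cast_one, dist_le_iff] at this
    exact this
  have hpre : spine ⁻¹' C ⊆ spine ⁻¹' spineBall T₀ (1 / ((h + 1 : ℕ) : ℝ)) := fun T hT => by
    refine ⟨⟨T, rfl⟩, ?_⟩
    rw [Nat.cast_add, Nat.cast_one, dist_le_iff]
    exact hT
  rw [spineMeasure, spineEvent, ← hval.comap_apply]
  -- The measurability of `spineBall`, which involves the range of `spine`, is not needed: one
  -- inequality holds for every set, and for the other the set is enlarged to the measurable C,
  -- whose preimage is no larger.
  refine le_antisymm ?_ (Measure.le_map_apply measurable_spine.aemeasurable _)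
  refine (measure_mono hsub).trans ?_
  rw [Measure.map_apply measurable_spine hC]
  exact measure_mono hpre

/-! ### Grafting as a homeomorphism. -/

section Homeomorph

variable {T₀ : PlaneTree} {R h : ℕ} (e : Fin R ≃ Leaf T₀) (hT₀ : Level h T₀)

/-- Grafting infinite trees at the leaves and finite trees in the inner sectors, as a bijection. -/
noncomputable def graftEquiv :
    (Fin R → InfTree) × (InnerSector T₀ → FinTree) ≃ spineEvent T₀ (h + 1) :=
  Equiv.ofBijective (fun z => ⟨graftAll T₀ e (fun i => (z.1 i).1) fun s => (z.2 s).1, by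
      rw [spineEvent_eq]
      exact spineAgree_graftAll hT₀ (fun i => (z.1 i).2) fun s => (z.2 s).2⟩) <| by
    constructor
    · intro z z' heq
      obtain ⟨h1, h2⟩ := graftAll_injective hT₀ (fun i => (z.1 i).2) (fun s => (z.2 s).2)
        (fun i => (z'.1 i).2) (fun s => (z'.2 s).2) (congrArg Subtype.val heq)
      exact Prod.ext (funext fun i => Subtype.ext (congrFun h1 i))
        (funext fun s => Subtype.ext (congrFun h2 s))
    · rintro ⟨T, hT⟩
      have hT' := hT
      rw [spineEvent_eq] at hT'
      obtain ⟨x, y, hx, hy, rfl⟩ := exists_graftAll_of_spineAgree hT₀ e hT'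
      exact ⟨(fun i => ⟨x i, hx i⟩, fun s => ⟨y s, hy s⟩), rfl⟩

theorem coe_graftEquiv (z : (Fin R → InfTree) × (InnerSector T₀ → FinTree)) :
    (graftEquiv e hT₀ z : PlaneTree) =
      graftAll T₀ e (fun i => (z.1 i).1) fun s => (z.2 s).1 := rfl

/-- A tree of the event close enough to a grafted tree is a graft with the same finite branches. Its
spine forces the branches at the leaves to be infinite, and injectivity identifies them with its own
branches. -/
theorem eventually_graftEquiv_symm [Finite (InnerSector T₀)]
    (z : (Fin R → InfTree) × (InnerSector T₀ → FinTree)) (n : ℕ) :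
    ∀ᶠ T in 𝓝 (graftEquiv e hT₀ z), ((graftEquiv e hT₀).symm T).2 = z.2 ∧
      ∀ i, Agree n (((graftEquiv e hT₀).symm T).1 i).1 (z.1 i).1 := by
  obtain ⟨k, hk, hyk⟩ := exists_heightLE (fun s => (z.2 s).2) (n + 1)
  filter_upwards [continuous_subtype_val.continuousAt.eventually
    (eventually_agree (k + h) (graftEquiv e hT₀ z).1)] with T hT
  obtain ⟨z', rfl⟩ := (graftEquiv e hT₀).surjective T
  rw [coe_graftEquiv e hT₀ z] at hT
  obtain ⟨x, hx, heq⟩ := exists_eq_graftAll hT₀ (by omega) hyk hT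
  have hmem := heq ▸ (spineEvent_eq T₀ h).subset (graftEquiv e hT₀ z').2
  have hinf := infinite_of_spineAgree_graftAll hT₀ (fun s => (z.2 s).2) hmem
  obtain ⟨h1, h2⟩ := graftAll_injective hT₀ (fun i => (z'.1 i).2) (fun s => (z'.2 s).2) hinf
    (fun s => (z.2 s).2) heq
  rw [Equiv.symm_apply_apply]
  refine ⟨funext fun s => Subtype.ext (congrFun h2 s), fun i => ?_⟩
  rw [congrFun h1 i]
  exact (hx i).mono (by omega)

theorem continuous_graftEquiv [Finite (InnerSector T₀)] : Continuous (graftEquiv e hT₀) := by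
  refine Continuous.subtype_mk ((continuous_graftAll e hT₀).comp
    (f := fun z : (Fin R → InfTree) × (InnerSector T₀ → FinTree) =>
      ((fun i => (z.1 i).1, fun s => (z.2 s).1) :
        (Fin R → PlaneTree) × (InnerSector T₀ → PlaneTree))) ?_) _
  fun_prop

theorem continuous_graftEquiv_symm [Finite (InnerSector T₀)] :
    Continuous (graftEquiv e hT₀).symm := by
  refine continuous_iff_continuousAt.2 fun T => ?_
  obtain ⟨z, rfl⟩ := (graftEquiv e hT₀).surjective T
  have key := eventually_graftEquiv_symm e hT₀ z
  rw [ContinuousAt, Equiv.symm_apply_apply, nhds_prod_eq]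
  refine Tendsto.prodMk (tendsto_pi_nhds.2 fun i => tendsto_subtype_rng.2 ?_) ?_
  · exact tendsto_of_eventually_agree fun n => (key n).mono fun T hT => hT.2 i
  · exact tendsto_nhds_of_eventually_eq ((key 0).mono fun T hT => hT.1)

/-- Grafting, as a homeomorphism. -/
noncomputable def graftHomeomorph [Finite (InnerSector T₀)] :
    spineEvent T₀ (h + 1) ≃ₜ (Fin R → InfTree) × (InnerSector T₀ → FinTree) where
  toEquiv := (graftEquiv e hT₀).symm
  continuous_toFun := continuous_graftEquiv_symm e hT₀
  continuous_invFun := continuous_graftEquiv e hT₀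

end Homeomorph

end PlaneTree

namespace PlaneTree

/-! ### The conditional law of the branches. -/

section Decomposition

variable {T₀ : PlaneTree} {n h : ℕ} {e : Fin (n + 1) ≃ Leaf T₀}

theorem measurable_infBranches
    (G : spineEvent T₀ (h + 1) ≃ₜ (Fin (n + 1) → InfTree) × (InnerSector T₀ → FinTree)) :
    Measurable fun T i => ((G T).1 i).1 :=
  measurable_pi_iff.2 fun i => (by fun_prop : Continuous fun T => ((G T).1 i).1).measurable

theorem measurable_finBranch
    (G : spineEvent T₀ (h + 1) ≃ₜ (Fin (n + 1) → InfTree) × (InnerSector T₀ → FinTree))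
    (s : InnerSector T₀) : Measurable fun T => ((G T).2 s).1 :=
  (by fun_prop : Continuous fun T => ((G T).2 s).1).measurable

theorem image_preimage_branches
    (G : spineEvent T₀ (h + 1) ≃ₜ (Fin (n + 1) → InfTree) × (InnerSector T₀ → FinTree))
    (hG : ∀ x y, (G.symm (x, y) : PlaneTree) = graftAll T₀ e (fun i => (x i).1) fun s => (y s).1)
    (A : Set (Fin (n + 1) → PlaneTree))
    (B : Set (InnerSector T₀ → PlaneTree)) :
    Subtype.val '' ((fun T => ((fun i => ((G T).1 i).1, fun s => ((G T).2 s).1) :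
      (Fin (n + 1) → PlaneTree) × (InnerSector T₀ → PlaneTree))) ⁻¹' (A ×ˢ B)) =
      graftSet e A B := by
  ext T
  constructor
  · rintro ⟨T, ⟨hA, hB⟩, rfl⟩
    refine ⟨_, ⟨hA, fun i => ((G T).1 i).2⟩, _, hB, fun s => ((G T).2 s).2, ?_⟩
    rw [← hG]
    exact congrArg Subtype.val (G.symm_apply_apply T).symm
  · rintro ⟨x, ⟨hA, hx⟩, y, hB, hy, rfl⟩
    refine ⟨G.symm (fun i => ⟨x i, hx i⟩, fun s => ⟨y s, hy s⟩), ?_, hG _ _⟩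
    rw [Set.mem_preimage, G.apply_symm_apply]
    exact ⟨hA, hB⟩

/-- It suffices to check rectangles, where the constant in `nu_graftSet` cancels against
`nu_spineEvent`. -/
theorem map_branches_condNu [Fintype (InnerSector T₀)] (hT₀ : Level h T₀) {μ : ℝ} (hμ : 0 < μ)
    (G : spineEvent T₀ (h + 1) ≃ₜ (Fin (n + 1) → InfTree) × (InnerSector T₀ → FinTree))
    (hG : ∀ x y, (G.symm (x, y) : PlaneTree) = graftAll T₀ e (fun i => (x i).1) fun s => (y s).1) :
    Measure.map (fun T => ((fun i => ((G T).1 i).1, fun s => ((G T).2 s).1) :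
      (Fin (n + 1) → PlaneTree) × (InnerSector T₀ → PlaneTree))) (condNu μ T₀ (h + 1)) =
      (mixedMeasure (n + 1) μ).prod (Measure.pi fun _ => bgwMeasure) := by
  have := isProbabilityMeasure_mixedMeasure n hμ
  have hE : MeasurableSet (spineEvent T₀ (h + 1)) :=
    graftSet_univ e hT₀ ▸ measurableSet_graftSet e hT₀ MeasurableSet.univ _
  refine (Measure.prod_eq fun A B hA hB => ?_).symm
  rw [Measure.map_apply ((measurable_infBranches G).prodMk
    (measurable_pi_iff.2 (measurable_finBranch G))) (hA.prod hB), condNu,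
    (MeasurableEmbedding.subtype_coe hE).comap_apply, image_preimage_branches G hG,
    ProbabilityTheory.cond_apply hE, Set.inter_eq_self_of_subset_right,
    nu_graftSet e hT₀ hμ hA, nu_spineEvent e hT₀ hμ, mul_assoc, ← mul_assoc,
    ENNReal.inv_mul_cancel, one_mul]
  · exact (ENNReal.ofReal_pos.2 (by positivity)).ne'
  · exact ENNReal.ofReal_ne_top
  · rw [← graftSet_univ e hT₀]
    rintro _ ⟨x, hx, y, -, hy⟩
    exact ⟨x, ⟨trivial, hx.2⟩, y, trivial, hy⟩

theorem isProbabilityMeasure_condNu [Fintype (InnerSector T₀)] (hT₀ : Level h T₀) {μ : ℝ} (hμ : 0 < μ)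
    (G : spineEvent T₀ (h + 1) ≃ₜ (Fin (n + 1) → InfTree) × (InnerSector T₀ → FinTree))
    (hG : ∀ x y, (G.symm (x, y) : PlaneTree) = graftAll T₀ e (fun i => (x i).1) fun s => (y s).1)
    : IsProbabilityMeasure (condNu μ T₀ (h + 1)) := by
  have := isProbabilityMeasure_mixedMeasure n hμ
  constructor
  have h1 := congrArg (fun m => m Set.univ) (map_branches_condNu hT₀ hμ G hG)
  simp only [measure_univ] at h1
  rwa [Measure.map_apply ((measurable_infBranches G).prodMk
    (measurable_pi_iff.2 (measurable_finBranch G))) MeasurableSet.univ, Set.preimage_univ] at h1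

theorem map_infBranches_condNu [Fintype (InnerSector T₀)] (hT₀ : Level h T₀) {μ : ℝ} (hμ : 0 < μ)
    (G : spineEvent T₀ (h + 1) ≃ₜ (Fin (n + 1) → InfTree) × (InnerSector T₀ → FinTree))
    (hG : ∀ x y, (G.symm (x, y) : PlaneTree) = graftAll T₀ e (fun i => (x i).1) fun s => (y s).1)
    : Measure.map (fun T i => ((G T).1 i).1) (condNu μ T₀ (h + 1)) =
    mixedMeasure (n + 1) μ := by
  have h1 := congrArg (Measure.map Prod.fst) (map_branches_condNu hT₀ hμ G hG)
  rw [Measure.map_map measurable_fst ((measurable_infBranches G).prodMk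
    (measurable_pi_iff.2 (measurable_finBranch G))), Measure.map_fst_prod, measure_univ,
    one_smul] at h1
  exact h1

theorem map_finBranches_condNu [Fintype (InnerSector T₀)] (hT₀ : Level h T₀) {μ : ℝ} (hμ : 0 < μ)
    (G : spineEvent T₀ (h + 1) ≃ₜ (Fin (n + 1) → InfTree) × (InnerSector T₀ → FinTree))
    (hG : ∀ x y, (G.symm (x, y) : PlaneTree) = graftAll T₀ e (fun i => (x i).1) fun s => (y s).1)
    : Measure.map (fun T s => ((G T).2 s).1) (condNu μ T₀ (h + 1)) =
    Measure.pi fun _ => bgwMeasure := by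
  have := isProbabilityMeasure_mixedMeasure n hμ
  have h1 := congrArg (Measure.map Prod.snd) (map_branches_condNu hT₀ hμ G hG)
  rw [Measure.map_map measurable_snd ((measurable_infBranches G).prodMk
    (measurable_pi_iff.2 (measurable_finBranch G))), Measure.map_snd_prod, measure_univ,
    one_smul] at h1
  exact h1

theorem map_finBranch_condNu [Fintype (InnerSector T₀)] (hT₀ : Level h T₀) {μ : ℝ} (hμ : 0 < μ)
    (G : spineEvent T₀ (h + 1) ≃ₜ (Fin (n + 1) → InfTree) × (InnerSector T₀ → FinTree))
    (hG : ∀ x y, (G.symm (x, y) : PlaneTree) = graftAll T₀ e (fun i => (x i).1) fun s => (y s).1)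
    (s : InnerSector T₀) :
    Measure.map (fun T => ((G T).2 s).1) (condNu μ T₀ (h + 1)) = bgwMeasure := by
  have h1 := congrArg (Measure.map (Function.eval s)) (map_finBranches_condNu hT₀ hμ G hG)
  rw [Measure.map_map (measurable_pi_apply s) (measurable_pi_iff.2 (measurable_finBranch G)),
    (measurePreserving_eval _ s).map_eq] at h1
  exact h1

theorem iIndepFun_finBranches [Fintype (InnerSector T₀)] (hT₀ : Level h T₀) {μ : ℝ} (hμ : 0 < μ)
    (G : spineEvent T₀ (h + 1) ≃ₜ (Fin (n + 1) → InfTree) × (InnerSector T₀ → FinTree))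
    (hG : ∀ x y, (G.symm (x, y) : PlaneTree) = graftAll T₀ e (fun i => (x i).1) fun s => (y s).1) :
    iIndepFun (fun s T => ((G T).2 s).1) (condNu μ T₀ (h + 1)) := by
  have := isProbabilityMeasure_condNu hT₀ hμ G hG
  rw [iIndepFun_iff_map_fun_eq_pi_map fun s => (measurable_finBranch G s).aemeasurable,
    map_finBranches_condNu hT₀ hμ G hG]
  simp only [map_finBranch_condNu hT₀ hμ G hG]

theorem indepFun_branches [Fintype (InnerSector T₀)] (hT₀ : Level h T₀) {μ : ℝ} (hμ : 0 < μ)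
    (G : spineEvent T₀ (h + 1) ≃ₜ (Fin (n + 1) → InfTree) × (InnerSector T₀ → FinTree))
    (hG : ∀ x y, (G.symm (x, y) : PlaneTree) = graftAll T₀ e (fun i => (x i).1) fun s => (y s).1)
    : IndepFun (fun T i => ((G T).1 i).1) (fun T s => ((G T).2 s).1)
    (condNu μ T₀ (h + 1)) := by
  have := isProbabilityMeasure_condNu hT₀ hμ G hG
  rw [indepFun_iff_map_prod_eq_prod_map_map (measurable_infBranches G).aemeasurable
    (measurable_pi_iff.2 (measurable_finBranch G)).aemeasurable,
    map_finBranches_condNu hT₀ hμ G hG, map_infBranches_condNu hT₀ hμ G hG]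
  exact map_branches_condNu hT₀ hμ G hG

end Decomposition

end PlaneTree

theorem mainTheorem6 (μ : ℝ) (hμ : 0 < μ) (T₀ : FinTree) (r R : ℕ)
    (hr : T₀.1.height = (r : ℕ∞))
    (hleaf : ∀ w : Leaf T₀.1, w.1.length + 1 = r)
    (hR : Nat.card (Leaf T₀.1) = R) :
    -- the local limit exists
    Tendsto (nuSeq μ) atTop (𝓝 (nu μ)) ∧
    -- i)
    spineMeasure μ (spineBall T₀.1 (1 / (r : ℝ))) =
      ENNReal.ofReal (Real.exp (-((r : ℝ) - 1) * μ) * μ ^ (R - 1) / ((R - 1).factorial : ℝ)) ∧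
    -- ii)
    ∀ e : Fin R ≃ Leaf T₀.1,
      -- the identification of trees with their infinite and finite branches
      ∃ G : spineEvent T₀.1 r ≃ₜ (Fin R → InfTree) × (InnerSector T₀.1 → FinTree),
        (∀ x y, (G.symm (x, y) : PlaneTree) =
          graftAll T₀.1 e (fun i => (x i).1) (fun s => (y s).1)) ∧
        Measure.map (fun T => ((fun i => ((G T).1 i).1, fun s => ((G T).2 s).1) :
            (Fin R → PlaneTree) × (InnerSector T₀.1 → PlaneTree))) (condNu μ T₀.1 r) =
          (mixedMeasure R μ).prod (Measure.pi fun _ => bgwMeasure) ∧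
        -- equivalently: the finite branches are i.i.d. with law `ρ`, and independent of the
        -- infinite branches, whose joint law is the mixture
        iIndepFun (fun s T => ((G T).2 s).1) (condNu μ T₀.1 r) ∧
        (∀ s, Measure.map (fun T => ((G T).2 s).1) (condNu μ T₀.1 r) = bgwMeasure) ∧
        IndepFun (fun T i => ((G T).1 i).1) (fun T s => ((G T).2 s).1) (condNu μ T₀.1 r) ∧
        Measure.map (fun T i => ((G T).1 i).1) (condNu μ T₀.1 r) = mixedMeasure R μ := by
  refine ⟨tendsto_nuSeq hμ, ?_⟩
  -- A finite tree has a leaf, so r ≥ 1 and R ≥ 1; thus r - 1 and R - 1 are genuine differences.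
  obtain ⟨p, hp⟩ := exists_isLeaf T₀.2
  obtain ⟨h, rfl⟩ : ∃ h, r = h + 1 := ⟨_, (hleaf ⟨p, hp⟩).symm⟩
  have hT₀ : Level h T₀.1 := level_of_forall_isLeaf T₀.2 fun q hq =>
    Nat.succ.inj (hleaf ⟨q, hq⟩)
  have := finite_leaf T₀.2
  have : Nonempty (Leaf T₀.1) := ⟨⟨p, hp⟩⟩
  obtain ⟨n, rfl⟩ : ∃ n, R = n + 1 := ⟨R - 1, by
    have := Nat.card_pos (α := Leaf T₀.1)
    omega⟩
  constructor
  · rw [spineMeasure_spineBall,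
      nu_spineEvent ((Finite.equivFinOfCardEq hR).symm) hT₀ hμ, ← Real.exp_nat_mul, mul_div_assoc]
    congr 3
    push_cast
    ring_nf
  · intro e
    have hG : ∀ x y, ((graftHomeomorph e hT₀).symm (x, y) : PlaneTree) =
        graftAll T₀.1 e (fun i => (x i).1) fun s => (y s).1 := fun x y => rfl
    exact ⟨graftHomeomorph e hT₀, hG, map_branches_condNu hT₀ hμ _ hG,
      iIndepFun_finBranches hT₀ hμ _ hG, map_finBranch_condNu hT₀ hμ _ hG,
      indepFun_branches hT₀ hμ _ hG, map_infBranches_condNu hT₀ hμ _ hG⟩
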